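/- Let $\Omega\subseteq\mathbb{R}^d$, $d\ge 1$, be a bounded simplicial Lipschitz domain whose boundary is split into pairwise disjoint, relatively open parts $\Gamma_I\neq\emptyset$, $\Gamma_D$, $\Gamma_N$ with $\partial\Omega=\overline{\Gamma}_I\cup\overline{\Gamma}_D\cup\overline{\Gamma}_N$, such that $\partial\Omega$ is a finite union of $(d-1)$-simplices, each having its relative interior contained in one of the three parts ($\Omega$ need not be connected). For $X\in\{I,D,N\}$ let $H^1_X(\Omega)$ be the set of $v\in H^1(\Omega)$ with $\operatorname{tr}v=0$ a.e. on $\Gamma_X$ (we write $v$ for $\operatorname{tr}v$ on the boundary), let $H^{1/2}(\Gamma_X)$ be the range of $v\mapsto(\operatorname{tr}v)|_{\Gamma_X}$ on $H^1(\Omega)$ with the quotient norm, and let $H^{-1/2}(\Gamma_X)$ be its topological dual. For $y\in H(\mathrm{div};\Omega)$ and $v\in H^1(\Omega)$ put $\langle y\cdot n,v\rangle_{\partial\Omega}:=(\nabla v,y)_\Omega+(v,\operatorname{div}y)_\Omega$. Let $\overline{H}_I(\mathrm{div};\Omega)$ be the set of $y\in H(\mathrm{div};\Omega)$ for which there is a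 (necessarily unique) $\overline{y\cdot n}\in L^\infty(\Gamma_I)$ with $(\overline{y\cdot n},v)_{\Gamma_I}=\langle y\cdot n,v\rangle_{\partial\Omega}$ for all $v\in H^1_D(\Omega)\cap H^1_N(\Omega)$. Let $m>0$, $f\in L^2(\Omega)$, $g\in H^{-1/2}(\Gamma_N)$, and $u_D\in H^{1/2}(\Gamma_D)$ with a lift $\widehat{u}_D\in H^1(\Omega)$, i.e. $\widehat{u}_D=u_D$ a.e. on $\Gamma_D$. Define $I\colon H^1(\Omega)\to\mathbb{R}\cup\{+\infty\}$ by $$I(v)=\tfrac12\|\nabla v\|_\Omega^2+\tfrac1{2m}\|v\|_{1,\Gamma_I}^2-(f,v)_\Omega-\langle g,v\rangle_{\Gamma_N}$$ if $v=u_D$ a.e. on $\Gamma_D$ and $I(v)=+\infty$ otherwise, and $D\colon\overline{H}_I(\mathrm{div};\Omega)\to\mathbb{R}\cup\{-\infty\}$ by $$D(y)=-\tfrac12\|y\|_\Omega^2-\tfrac m2\|\overline{y\cdot n}\|_{\infty,\Gamma_I}^2+\langle y\cdot n,\widehat{u}_D\rangle_{\partial\Omega}-(\overline{y\cdot n},\widehat{u}_D)_{\Gamma_I}-\langle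 g,\widehat{u}_D\rangle_{\Gamma_N}$$ if $\operatorname{div}y=-f$ a.e. in $\Omega$ and $\langle y\cdot n,v\rangle_{\partial\Omega}=\langle g,v\rangle_{\Gamma_N}$ for all $v\in H^1_I(\Omega)\cap H^1_D(\Omega)$, and $D(y)=-\infty$ otherwise. Let $K=\operatorname{dom}(I)$ and $K^*=\operatorname{dom}(-D)$. Let $u\in K$ be a primal solution (a minimizer of $I$) and $z\in K^*$ a dual solution (a maximizer of $D$), and for $v\in K$, $y\in K^*$ set $$\rho_I^2(v)=I(v)-I(u),\quad \rho_{-D}^2(y)=-D(y)+D(z),\quad \rho_{\rm tot}^2(v,y)=\rho_I^2(v)+\rho_{-D}^2(y),\quad \eta_{\rm gap}^2(v,y)=I(v)-D(y).$$ Then, for every $v\in K$ and $y\in K^*$, $$\rho_{\rm tot}^2(v,y)=\eta_{\rm gap}^2(v,y).$$ Moreover, with $b(\eta,w):=\tfrac m2\|\eta\|_{\infty,\Gamma_I}^2+(\eta,w)_{\Gamma_I}+\tfrac1{2m}\|w\|_{1,\Gamma_I}^2$ for $\eta\in L^\infty(\Gamma_I)$ and $w\in H^1(\Omega)$, one has the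 representations $$\eta_{\rm gap}^2(v,y)=\tfrac12\|\nabla v-y\|_\Omega^2+b(\overline{y\cdot n},v),$$ $$\rho_I^2(v)=\tfrac12\|\nabla v-\nabla u\|_\Omega^2+b(\overline{z\cdot n},v),\qquad \rho_{-D}^2(y)=\tfrac12\|y-z\|_\Omega^2+b(\overline{y\cdot n},u).$$ -/

import Mathlib

open MeasureTheory Set
open scoped ContDiff

noncomputable section

namespace Insulation

/-- The Euclidean space `ℝ^d`. -/
abbrev E (d : ℕ) : Type := EuclideanSpace ℝ (Fin d)

variable {d : ℕ}

/-! ### Geometry -/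

/-- `Ω` has a Lipschitz boundary: near every boundary point there are a unit vector `e` and a
Lipschitz function `γ` on the hyperplane `e^⊥` such that `Ω` is locally the strict epigraph of `γ`
in direction `e`. -/
def HasLipschitzBoundary (Ω : Set (E d)) : Prop :=
  ∀ x ∈ frontier Ω, ∃ (e : E d) (L : NNReal) (γ : (Submodule.span ℝ {e})ᗮ → ℝ) (U : Set (E d)),
    ‖e‖ = 1 ∧ LipschitzWith L γ ∧ IsOpen U ∧ x ∈ U ∧
      ∀ y ∈ U, y ∈ Ω ↔ γ ((Submodule.span ℝ {e})ᗮ.orthogonalProjectionOnto y) < inner ℝ e y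

/-- A bounded simplicial Lipschitz domain `Ω ⊆ ℝ^d` whose boundary is split into three disjoint
relatively open parts, the insulated part `ΓI ≠ ∅`, the Dirichlet part `ΓD` and the Neumann part
`ΓN`; the boundary is a finite union of `(d-1)`-simplices (sides), and the relative interior of
each side (the points with positive barycentric coordinates) lies in one of the three parts. -/
structure Body (d : ℕ) where
  Ω : Set (E d)
  ΓI : Set (E d)
  ΓD : Set (E d)
  ΓN : Set (E d)
  isOpen : IsOpen Ω
  isBounded : Bornology.IsBounded Ω
  lipschitz : HasLipschitzBoundary Ω
  openI : ∃ U : Set (E d), IsOpen U ∧ ΓI = U ∩ frontier Ω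
  openD : ∃ U : Set (E d), IsOpen U ∧ ΓD = U ∩ frontier Ω
  openN : ∃ U : Set (E d), IsOpen U ∧ ΓN = U ∩ frontier Ω
  nonemptyI : ΓI.Nonempty
  disjointID : Disjoint ΓI ΓD
  disjointIN : Disjoint ΓI ΓN
  disjointDN : Disjoint ΓD ΓN
  closure_union : frontier Ω = closure ΓI ∪ closure ΓD ∪ closure ΓN
  sides : ∃ S : Set (Affine.Simplex ℝ (E d) (d - 1)), S.Finite ∧
    frontier Ω = (⋃ s ∈ S, convexHull ℝ (Set.range s.points)) ∧
    ∀ s ∈ S, s.setInterior (Set.Ioi 0) ⊆ ΓI ∨ s.setInterior (Set.Ioi 0) ⊆ ΓD ∨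
      s.setInterior (Set.Ioi 0) ⊆ ΓN

/-! ### Function spaces -/

/-- Lebesgue measure on `Ω`. -/
abbrev vol (Ω : Set (E d)) : Measure (E d) := volume.restrict Ω

/-- Surface measure on `∂Ω`: the `(d-1)`-dimensional Hausdorff measure with the Euclidean
normalization. -/
abbrev surf (Ω : Set (E d)) : Measure (E d) :=
  (Measure.euclideanHausdorffMeasure (d - 1)).restrict (frontier Ω)

/-- Test functions `C_c^∞(Ω)`. -/
def IsTest (Ω : Set (E d)) (φ : E d → ℝ) : Prop :=
  ContDiff ℝ ∞ φ ∧ HasCompactSupport φ ∧ tsupport φ ⊆ Ω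

/-- `G ∈ L²(Ω)^d` is the weak gradient of `v ∈ L²(Ω)`. -/
def IsWeakGradient (Ω : Set (E d)) (v : Lp ℝ 2 (vol Ω)) (G : Lp (E d) 2 (vol Ω)) : Prop :=
  ∀ φ : E d → ℝ, IsTest Ω φ → ∀ i : Fin d,
    ∫ x in Ω, v x * fderiv ℝ φ x (EuclideanSpace.single i 1) = - ∫ x in Ω, G x i * φ x

/-- `q ∈ L²(Ω)` is the weak divergence of `y ∈ L²(Ω)^d`. -/
def IsWeakDiv (Ω : Set (E d)) (y : Lp (E d) 2 (vol Ω)) (q : Lp ℝ 2 (vol Ω)) : Prop :=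
  ∀ φ : E d → ℝ, IsTest Ω φ →
    ∫ x in Ω, inner ℝ (y x) (gradient φ x) = - ∫ x in Ω, q x * φ x

lemma IsTest.memLp {Ω : Set (E d)} {φ : E d → ℝ} (h : IsTest Ω φ) : MemLp φ 2 (vol Ω) :=
  (h.1.continuous.memLp_of_hasCompactSupport h.2.1).restrict _

lemma IsTest.memLp_fderiv {Ω : Set (E d)} {φ : E d → ℝ} (h : IsTest Ω φ) (e : E d) :
    MemLp (fun x => fderiv ℝ φ x e) 2 (vol Ω) := by
  refine (Continuous.memLp_of_hasCompactSupport ?_ ?_).restrict _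
  · exact (h.1.continuous_fderiv (by simp)).clm_apply continuous_const
  · exact h.2.1.fderiv_apply (𝕜 := ℝ) e

lemma memLp_coord {Ω : Set (E d)} (G : Lp (E d) 2 (vol Ω)) (i : Fin d) :
    MemLp (fun x => G x i) 2 (vol Ω) :=
  (EuclideanSpace.proj (𝕜 := ℝ) i : E d →L[ℝ] ℝ).comp_memLp' (Lp.memLp G)

/-- `H¹(Ω)`, realized as the space of pairs `(v, ∇v) ∈ L²(Ω) × L²(Ω)^d` with norm
`(‖v‖² + ‖∇v‖²)^{1/2}`; the weak gradient is determined by `v`. -/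
def H1 (Ω : Set (E d)) : Submodule ℝ (WithLp 2 (Lp ℝ 2 (vol Ω) × Lp (E d) 2 (vol Ω))) where
  carrier := {p | IsWeakGradient Ω p.fst p.snd}
  zero_mem' := by
    intro φ hφ i
    have h1 : ∫ x in Ω, (0 : Lp ℝ 2 (vol Ω)) x * fderiv ℝ φ x (EuclideanSpace.single i 1) = 0 :=
      integral_eq_zero_of_ae (by
        filter_upwards [Lp.coeFn_zero ℝ 2 (vol Ω)] with x hx
        rw [hx]
        simp)
    have h2 : ∫ x in Ω, (0 : Lp (E d) 2 (vol Ω)) x i * φ x = 0 :=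
      integral_eq_zero_of_ae (by
        filter_upwards [Lp.coeFn_zero (E d) 2 (vol Ω)] with x hx
        rw [hx]
        simp)
    simp only [WithLp.zero_fst, WithLp.zero_snd]
    rw [h1, h2, neg_zero]
  add_mem' := by
    intro p q hp hq φ hφ i
    have a1 := (Lp.memLp p.fst).integrable_mul (hφ.memLp_fderiv (EuclideanSpace.single i 1))
    have a2 := (Lp.memLp q.fst).integrable_mul (hφ.memLp_fderiv (EuclideanSpace.single i 1))
    have b1 := (memLp_coord p.snd i).integrable_mul hφ.memLp
    have b2 := (memLp_coord q.snd i).integrable_mul hφ.memLp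
    have h1 : ∫ x in Ω, (p.fst + q.fst) x * fderiv ℝ φ x (EuclideanSpace.single i 1) =
        (∫ x in Ω, p.fst x * fderiv ℝ φ x (EuclideanSpace.single i 1)) +
          ∫ x in Ω, q.fst x * fderiv ℝ φ x (EuclideanSpace.single i 1) := by
      refine Eq.trans ?_ (integral_add a1 a2)
      refine integral_congr_ae ?_
      filter_upwards [Lp.coeFn_add p.fst q.fst] with x hx
      rw [hx]
      simp [add_mul]
    have h2 : ∫ x in Ω, (p.snd + q.snd) x i * φ x =
        (∫ x in Ω, p.snd x i * φ x) + ∫ x in Ω, q.snd x i * φ x := by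
      refine Eq.trans ?_ (integral_add b1 b2)
      refine integral_congr_ae ?_
      filter_upwards [Lp.coeFn_add p.snd q.snd] with x hx
      rw [hx]
      simp [add_mul]
    have e1 := hp φ hφ i
    have e2 := hq φ hφ i
    simp only [WithLp.add_fst, WithLp.add_snd]
    rw [h1, h2, e1, e2]
    ring
  smul_mem' := by
    intro c p hp φ hφ i
    have h1 : ∫ x in Ω, (c • p.fst) x * fderiv ℝ φ x (EuclideanSpace.single i 1) =
        c * ∫ x in Ω, p.fst x * fderiv ℝ φ x (EuclideanSpace.single i 1) := by
      rw [← integral_const_mul]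
      refine integral_congr_ae ?_
      filter_upwards [Lp.coeFn_smul c p.fst] with x hx
      rw [hx]
      simp [mul_assoc]
    have h2 : ∫ x in Ω, (c • p.snd) x i * φ x = c * ∫ x in Ω, p.snd x i * φ x := by
      rw [← integral_const_mul]
      refine integral_congr_ae ?_
      filter_upwards [Lp.coeFn_smul c p.snd] with x hx
      rw [hx]
      simp [mul_assoc]
    have e1 := hp φ hφ i
    simp only [WithLp.smul_fst, WithLp.smul_snd]
    rw [h1, h2, e1]
    ring

/-- The function underlying an element of `H¹(Ω)`. -/
def fnOf {Ω : Set (E d)} (v : H1 Ω) : Lp ℝ 2 (vol Ω) := v.1.fst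

/-- The weak gradient of an element of `H¹(Ω)`. -/
def grad {Ω : Set (E d)} (v : H1 Ω) : Lp (E d) 2 (vol Ω) := v.1.snd

/-- The graph of the restriction map `φ|_Ω ↦ φ|_{∂Ω}`, `φ ∈ C_c^∞(ℝ^d)`, in
`H¹(Ω) × L²(∂Ω)`. -/
def smoothTraceGraph (Ω : Set (E d)) : Submodule ℝ (H1 Ω × Lp ℝ 2 (surf Ω)) where
  carrier := {p | ∃ φ : E d → ℝ, ContDiff ℝ ∞ φ ∧ HasCompactSupport φ ∧
    fnOf p.1 =ᵐ[vol Ω] φ ∧ p.2 =ᵐ[surf Ω] φ}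
  zero_mem' := ⟨0, contDiff_const, HasCompactSupport.zero, Lp.coeFn_zero _ _ _,
    Lp.coeFn_zero _ _ _⟩
  add_mem' := by
    rintro p q ⟨φ, h1, h2, h3, h4⟩ ⟨ψ, k1, k2, k3, k4⟩
    exact ⟨φ + ψ, h1.add k1, h2.add k2, (Lp.coeFn_add (fnOf p.1) (fnOf q.1)).trans (h3.add k3),
      (Lp.coeFn_add p.2 q.2).trans (h4.add k4)⟩
  smul_mem' := by
    rintro c p ⟨φ, h1, h2, h3, h4⟩
    refine ⟨c • φ, h1.const_smul c, ?_, (Lp.coeFn_smul c (fnOf p.1)).trans (h3.const_smul c),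
      (Lp.coeFn_smul c p.2).trans (h4.const_smul c)⟩
    exact h2.smul_left (f := fun _ => c)

/-- `τ ∈ L²(∂Ω)` is the trace of `v ∈ H¹(Ω)`: the trace operator is the closure of the restriction
map for smooth functions. On a bounded Lipschitz domain every `v` has exactly one trace. -/
def IsTrace (Ω : Set (E d)) (v : H1 Ω) (τ : Lp ℝ 2 (surf Ω)) : Prop :=
  (v, τ) ∈ (smoothTraceGraph Ω).topologicalClosure

open Classical in
/-- The trace `tr(v) ∈ L²(∂Ω)`. -/
def trace {Ω : Set (E d)} (v : H1 Ω) : Lp ℝ 2 (surf Ω) :=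
  if h : ∃ τ, IsTrace Ω v τ then h.choose else 0

/-- `tr(v) = h` a.e. on `Γ ⊆ ∂Ω`. -/
def TraceEqOn {Ω : Set (E d)} (v : H1 Ω) (Γ : Set (E d)) (h : E d → ℝ) : Prop :=
  ∃ τ, IsTrace Ω v τ ∧ τ =ᵐ[(surf Ω).restrict Γ] h

/-- For `Γ ⊆ ∂Ω`, the space of all `v ∈ H¹(Ω)` with `tr(v) = 0` a.e. on `Γ`. -/
def H1Zero (Ω Γ : Set (E d)) : Submodule ℝ (H1 Ω) where
  carrier := {v | TraceEqOn v Γ 0}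
  zero_mem' := ⟨0, Submodule.zero_mem _, ae_restrict_of_ae (Lp.coeFn_zero _ _ _)⟩
  add_mem' := by
    rintro v w ⟨τ, h1, h2⟩ ⟨ρ, k1, k2⟩
    refine ⟨τ + ρ, Submodule.add_mem _ h1 k1, ?_⟩
    filter_upwards [ae_restrict_of_ae (Lp.coeFn_add τ ρ), h2, k2] with x hx h2 k2
    rw [hx, Pi.add_apply, h2, k2]
    simp
  smul_mem' := by
    rintro c v ⟨τ, h1, h2⟩
    refine ⟨c • τ, Submodule.smul_mem _ c h1, ?_⟩
    filter_upwards [ae_restrict_of_ae (Lp.coeFn_smul c τ), h2] with x hx h2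
    rw [hx, Pi.smul_apply, h2]
    simp

/-- `H^{1/2}(Γ)`: the range of `v ↦ tr(v)|_Γ` on `H¹(Ω)` with the norm
`τ ↦ inf {‖v‖_{H¹(Ω)} | tr(v)|_Γ = τ}`, i.e. `H¹(Ω)` modulo the kernel of `tr(·)|_Γ` with the
quotient norm. -/
abbrev HHalf (Ω Γ : Set (E d)) : Type := H1 Ω ⧸ H1Zero Ω Γ

/-- `H^{-1/2}(Γ)`, the topological dual of `H^{1/2}(Γ)`. -/
abbrev HMinusHalf (Ω Γ : Set (E d)) : Type := HHalf Ω Γ →L[ℝ] ℝ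

/-- The duality pairing `⟨g, tr(v)⟩_Γ` for `g ∈ H^{-1/2}(Γ)` and `v ∈ H¹(Ω)`. -/
def pairing {Ω Γ : Set (E d)} (g : HMinusHalf Ω Γ) (v : H1 Ω) : ℝ :=
  g ((H1Zero Ω Γ).mkQ v)

/-- `H(div; Ω)`; the weak divergence is determined by the field. -/
structure HDiv (Ω : Set (E d)) where
  field : Lp (E d) 2 (vol Ω)
  div : Lp ℝ 2 (vol Ω)
  isWeakDiv : IsWeakDiv Ω field div

/-- The normal trace `tr(y)·n ∈ H^{-1/2}(∂Ω)` of `y ∈ H(div; Ω)`, applied to `tr(v)`: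
`⟨y·n, v⟩_{∂Ω} = (∇v, y)_Ω + (v, div y)_Ω`. -/
def HDiv.normalPairing {Ω : Set (E d)} (y : HDiv Ω) (v : H1 Ω) : ℝ :=
  inner ℝ (grad v) y.field + inner ℝ (fnOf v) y.div

namespace Body

variable (B : Body d)

/-- `L^∞(Γ_I)`. -/
abbrev LInfI : Type := Lp ℝ ⊤ ((surf B.Ω).restrict B.ΓI)

/-- `(η, tr(v))_{Γ_I}` for `η ∈ L^∞(Γ_I)`. -/
def innerI (η : B.LInfI) (v : H1 B.Ω) : ℝ :=
  ∫ x in B.ΓI, η x * trace v x ∂(surf B.Ω)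

/-- `‖tr(v)‖_{1,Γ_I}`. -/
def normI (v : H1 B.Ω) : ℝ := ∫ x in B.ΓI, |trace v x| ∂(surf B.Ω)

/-- `η ∈ L^∞(Γ_I)` is an extension of the normal trace of `y`:
`(η, v)_{Γ_I} = ⟨y·n, v⟩_{∂Ω}` for all `v ∈ H¹_D(Ω) ∩ H¹_N(Ω)`. -/
def IsNormalExtension (y : HDiv B.Ω) (η : B.LInfI) : Prop :=
  ∀ v : H1 B.Ω, v ∈ H1Zero B.Ω B.ΓD → v ∈ H1Zero B.Ω B.ΓN →
    B.innerI η v = y.normalPairing v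

/-- The space of those `y ∈ H(div; Ω)` whose normal trace has an extension in `L^∞(Γ_I)`. -/
def HDivI : Type := {y : HDiv B.Ω // ∃ η : B.LInfI, B.IsNormalExtension y η}

variable {B}

/-- The extension of the normal trace to `L^∞(Γ_I)`; it is unique. -/
def HDivI.normalTrace (y : B.HDivI) : B.LInfI := y.2.choose

end Body

/-! ### The primal and the dual problem -/

/-- The data: amount of insulating material `m > 0`, heat source density `f ∈ L²(Ω)`, heat flux
`g ∈ H^{-1/2}(Γ_N)`, and boundary temperature `u_D` on `Γ_D` with a trace lift in `H¹(Ω)`. -/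
structure Data (B : Body d) where
  m : ℝ
  m_pos : 0 < m
  f : Lp ℝ 2 (vol B.Ω)
  g : HMinusHalf B.Ω B.ΓN
  uD : Lp ℝ 2 ((surf B.Ω).restrict B.ΓD)
  lift : H1 B.Ω
  lift_trace : TraceEqOn lift B.ΓD uD

open Classical in
/-- The convex indicator: `0` if the condition holds, `+∞` otherwise. -/
def convexIndicator (p : Prop) : EReal := if p then 0 else ⊤

namespace Data

variable {B : Body d} (P : Data B)

/-- The primal energy functional `I : H¹(Ω) → ℝ ∪ {+∞}`. -/
def primal (v : H1 B.Ω) : EReal :=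
  ((1 / 2 * ‖grad v‖ ^ 2 + 1 / (2 * P.m) * B.normI v ^ 2 - inner ℝ P.f (fnOf v)
      - pairing P.g v : ℝ) : EReal)
    + convexIndicator (TraceEqOn v B.ΓD P.uD)

/-- The set `K = dom(I)` of admissible primal functions. -/
def K : Set (H1 B.Ω) := {v | P.primal v ≠ ⊤}

/-- The dual energy functional `D`, with values in `ℝ ∪ {-∞}`. -/
def dual (y : B.HDivI) : EReal :=
  ((-(1 / 2) * ‖y.1.field‖ ^ 2 - P.m / 2 * ‖y.normalTrace‖ ^ 2
      + y.1.normalPairing P.lift - B.innerI y.normalTrace P.lift - pairing P.g P.lift : ℝ) : EReal)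
    - convexIndicator (y.1.div = -P.f)
    - convexIndicator (∀ v : H1 B.Ω, v ∈ H1Zero B.Ω B.ΓI → v ∈ H1Zero B.Ω B.ΓD →
        y.1.normalPairing v = pairing P.g v)

/-- The set `K^* = dom(-D)` of admissible dual fields. -/
def KStar : Set B.HDivI := {y | -P.dual y ≠ ⊤}

/-- Primal solutions: minimizers of `I`. -/
def IsPrimalSolution (u : H1 B.Ω) : Prop := u ∈ P.K ∧ ∀ v, P.primal u ≤ P.primal v

/-- Dual solutions: maximizers of `D`. -/
def IsDualSolution (z : B.HDivI) : Prop := z ∈ P.KStar ∧ ∀ y, P.dual y ≤ P.dual z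

/-- The primal-dual gap estimator `η²_gap(v, y) = I(v) - D(y)`. -/
def gapSq (v : H1 B.Ω) (y : B.HDivI) : EReal := P.primal v - P.dual y

/-- The optimal strong convexity measure `ρ²_I(v) = I(v) - I(u)` at a primal solution `u`. -/
def rhoPrimalSq (u v : H1 B.Ω) : EReal := P.primal v - P.primal u

/-- The optimal strong convexity measure `ρ²_{-D}(y) = -D(y) + D(z)` at the dual solution `z`. -/
def rhoDualSq (z y : B.HDivI) : EReal := -P.dual y + P.dual z

/-- The primal-dual total error `ρ²_tot(v, y) = ρ²_I(v) + ρ²_{-D}(y)`. -/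
def rhoTotSq (u : H1 B.Ω) (z : B.HDivI) (v : H1 B.Ω) (y : B.HDivI) : EReal :=
  P.rhoPrimalSq u v + P.rhoDualSq z y

/-- `m/2 ‖η‖²_{∞,Γ_I} + (η, v)_{Γ_I} + 1/(2m) ‖v‖²_{1,Γ_I}`. -/
def boundaryGap (η : B.LInfI) (v : H1 B.Ω) : ℝ :=
  P.m / 2 * ‖η‖ ^ 2 + B.innerI η v + 1 / (2 * P.m) * B.normI v ^ 2

end Data

end Insulation

end

noncomputable section

namespace Insulation

variable {d : ℕ}

open Filter Topology

/-! ### Weak limits in `H¹(Ω)` -/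

/-! Everything reduces to one identity: for `v ∈ K` and `y ∈ K^*` the gap `I(v) - D(y)` equals `½‖∇v
- y‖² + b(y·n, v)`. It is a completion of the square once the normal trace of `y` is known on `w = v
- û_D`, namely `⟨y·n, w⟩_{∂Ω} = (y·n, w)_{Γ_I} + ⟨g, w⟩` (`Body.normalPairing_eq`,
`Data.primalReal_sub_dualReal`). With strong duality `I(u) = D(z)` and `∇u = z`, the formulas for
`ρ_I²` and `ρ_{-D}²` are this identity at `(v, z)` and at `(u, y)`.

Integration by parts. Admissibility of `y` only gives this formula for `w` vanishing on `Γ_D ∪ Γ_N`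
or on `Γ_I ∪ Γ_D`, whereas here `w` vanishes on `Γ_D` alone. If the trace of `w` vanishes near the
interfaces between the parts, a smooth function separating `Γ_I` from `Γ_N` splits `w` into two
admissible pieces (`Body.normalPairing_eq_of_vanishing`). In general, the interfaces lie in finitely
many affine subspaces of codimension two (`Body.exists_ridges`), which have cut-offs with gradients
bounded in `L²` (`IsRidge.exists_cutoff`). After truncation, `w` is a weak `H¹`-limit of functions
of the first kind, and both sides of the formula are continuous functionals
(`eq_of_eq_near_ridges`).

Strong duality. Minimality of `u` bounds the negative first variation of the smooth part of `I` by
`‖u‖_{1,Γ_I}/m` times the directional derivative of the `L¹(Γ_I)`-norm at `u`. Hahn–Banach and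
`L¹`–`L^∞` duality turn this into a multiplier `η` with `‖η‖_∞ ≤ ‖u‖_1/m` and `(η, u) = -‖u‖_1²/m`
(`Data.exists_multiplier`). Then `∇u` is dual admissible with normal trace `η` and has no positive
gap (`Data.exists_dualReal_ge`). Since `b ≥ 0`, the gap at `(u, z)` vanishes and `∇u = z`.

Traces and normal traces are selected by choice, so their uniqueness is needed: for traces it
follows from a local trace inequality in Lipschitz charts, for normal traces from test functions
supported near `Γ_I`. Existence of a trace is never needed beyond what `TraceEqOn` supplies. -/

/-- A bounded sequence in a Hilbert space converges weakly along an ultrafilter. -/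
theorem exists_weak_limit {H : Type*} [NormedAddCommGroup H] [InnerProductSpace ℝ H]
    [CompleteSpace H] (x : ℕ → H) {R : ℝ} (hx : ∀ k, ‖x k‖ ≤ R) :
    ∃ y : H, ‖y‖ ≤ R ∧ ∃ 𝒰 : Filter ℕ, 𝒰.NeBot ∧ 𝒰 ≤ atTop ∧
      ∀ a, Tendsto (fun k => inner ℝ (x k) a) 𝒰 (𝓝 (inner ℝ y a)) := by
  let F : ℕ → WeakDual ℝ H := fun k => StrongDual.toWeakDual (InnerProductSpace.toDual ℝ H (x k))
  -- An ultrafilter finer than `atTop` replaces the extraction of a subsequence, so Banach–Alaoglu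
  -- applies without separability.
  let U : Ultrafilter ℕ := Ultrafilter.of atTop
  have hK := WeakDual.isCompact_closedBall (𝕜 := ℝ) (0 : StrongDual ℝ H) R
  have hmem : ∀ k, F k ∈ WeakDual.toStrongDual ⁻¹' Metric.closedBall (0 : StrongDual ℝ H) R := by
    intro k
    simp only [mem_preimage, mem_closedBall_zero_iff]
    have : WeakDual.toStrongDual (F k) = InnerProductSpace.toDual ℝ H (x k) := rfl
    rw [this, LinearIsometryEquiv.norm_map]
    exact hx k
  obtain ⟨L, hL, hUL⟩ := isCompact_iff_ultrafilter_le_nhds.1 hK (U.map F)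
    (le_principal_iff.2 (Ultrafilter.mem_map.2 (Filter.univ_mem' hmem)))
  refine ⟨(InnerProductSpace.toDual ℝ H).symm (WeakDual.toStrongDual L), ?_, U, inferInstance,
    Ultrafilter.of_le _, fun a => ?_⟩
  · rw [LinearIsometryEquiv.norm_map]
    simpa using hL
  · have h1 : Tendsto F U (𝓝 L) := hUL
    have h2 := ((WeakDual.eval_continuous (𝕜 := ℝ) (E := H) a).tendsto L).comp h1
    rw [InnerProductSpace.toDual_symm_apply]
    exact h2

/-- The field `φ e_i` for a test function `φ`. -/
lemma IsTest.memLp_single {Ω : Set (E d)} {φ : E d → ℝ} (h : IsTest Ω φ) (i : Fin d) :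
    MemLp (fun x => φ x • (EuclideanSpace.single i (1 : ℝ) : E d)) 2 (vol Ω) :=
  ((LinearMap.toSpanSingleton ℝ (E d) (EuclideanSpace.single i 1)).toContinuousLinearMap).comp_memLp'
    h.memLp

lemma inner_toLp {α F : Type*} [MeasurableSpace α] {μ : Measure α} [NormedAddCommGroup F]
    [InnerProductSpace ℝ F] (G : Lp F 2 μ) {f : α → F} (hf : MemLp f 2 μ) :
    inner ℝ G (hf.toLp f) = ∫ x, inner ℝ (G x) (f x) ∂μ := by
  rw [L2.inner_def]
  refine integral_congr_ae ?_
  filter_upwards [hf.coeFn_toLp] with x hx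
  rw [hx]

lemma isWeakGradient_iff {Ω : Set (E d)} (v : Lp ℝ 2 (vol Ω)) (G : Lp (E d) 2 (vol Ω)) :
    IsWeakGradient Ω v G ↔ ∀ φ : E d → ℝ, ∀ hφ : IsTest Ω φ, ∀ i : Fin d,
      inner ℝ v ((hφ.memLp_fderiv (EuclideanSpace.single i 1)).toLp _) =
        - inner ℝ G ((hφ.memLp_single i).toLp _) := by
  unfold IsWeakGradient
  refine forall_congr' fun φ => forall_congr' fun hφ => forall_congr' fun i => ?_
  rw [inner_toLp, inner_toLp]
  simp only [inner_smul_right, EuclideanSpace.inner_single_right, mul_comm]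
  simp [mul_comm]

/-- A bounded sequence in `H¹(Ω)` converging in `L²(Ω)` converges weakly along a filter. -/
theorem exists_weak_limit_H1 {Ω : Set (E d)} (v : ℕ → H1 Ω) {R : ℝ} (hR : ∀ k, ‖grad (v k)‖ ≤ R)
    {f : Lp ℝ 2 (vol Ω)} (hf : Tendsto (fun k => fnOf (v k)) atTop (𝓝 f)) :
    ∃ w : H1 Ω, fnOf w = f ∧ ‖grad w‖ ≤ R ∧ ∃ 𝒰 : Filter ℕ, 𝒰.NeBot ∧ 𝒰 ≤ atTop ∧
      ∀ Λ : H1 Ω →L[ℝ] ℝ, Tendsto (fun k => Λ (v k)) 𝒰 (𝓝 (Λ w)) := by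
  obtain ⟨G, hG, 𝒰, hne, hle, hlim⟩ := exists_weak_limit (fun k => grad (v k)) hR
  -- The defining identity pairs `v` and its gradient with fixed `L²` functions, so it survives weak
  -- limits.
  have hw : IsWeakGradient Ω f G := by
    rw [isWeakGradient_iff]
    intro φ hφ i
    have h1 := (hf.mono_left hle).inner
      (tendsto_const_nhds (x := ((hφ.memLp_fderiv (EuclideanSpace.single i 1)).toLp _)))
      (𝕜 := ℝ)
    have h2 := (hlim ((hφ.memLp_single i).toLp _)).neg
    refine tendsto_nhds_unique h1 (h2.congr fun k => ?_)
    exact ((isWeakGradient_iff _ _).1 (v k).2 φ hφ i).symm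
  refine ⟨⟨WithLp.toLp 2 (f, G), hw⟩, rfl, hG, 𝒰, hne, hle, fun Λ => ?_⟩
  -- Extending to the ambient product Hilbert space and applying Riesz there avoids proving that `H1
  -- Ω` is complete.
  obtain ⟨Λ', hΛ', -⟩ := exists_extension_norm_eq (H1 Ω) Λ
  let a := (InnerProductSpace.toDual ℝ _).symm Λ'
  have key : ∀ x : H1 Ω, Λ x = inner ℝ (fnOf x) a.fst + inner ℝ (grad x) a.snd := by
    intro x
    rw [← hΛ', ← InnerProductSpace.toDual_symm_apply (𝕜 := ℝ), real_inner_comm]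
    rfl
  simp_rw [key]
  exact ((hf.mono_left hle).inner tendsto_const_nhds).add (hlim _)

/-- A closed subspace is weakly closed: a point outside the closed graph would be strictly separated
from it by a continuous functional, which passes to the limit. -/
theorem isTrace_of_tendsto {Ω : Set (E d)} {v : ℕ → H1 Ω} {τ : ℕ → Lp ℝ 2 (surf Ω)}
    (h : ∀ k, IsTrace Ω (v k) (τ k)) {𝒰 : Filter ℕ} [𝒰.NeBot] {w : H1 Ω} {ρ : Lp ℝ 2 (surf Ω)}
    (hw : ∀ Λ : H1 Ω →L[ℝ] ℝ, Tendsto (fun k => Λ (v k)) 𝒰 (𝓝 (Λ w)))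
    (hρ : Tendsto τ 𝒰 (𝓝 ρ)) : IsTrace Ω w ρ := by
  by_contra hcon
  obtain ⟨f, s, hfs, hsf⟩ := geometric_hahn_banach_closed_point
    (smoothTraceGraph Ω).topologicalClosure.convex
    (smoothTraceGraph Ω).isClosed_topologicalClosure hcon
  have h1 : Tendsto (fun k => f (v k, τ k)) 𝒰 (𝓝 (f (w, ρ))) := by
    have e : ∀ x : H1 Ω × Lp ℝ 2 (surf Ω),
        f x = f.comp (ContinuousLinearMap.inl ℝ _ _) x.1 +
          f.comp (ContinuousLinearMap.inr ℝ _ _) x.2 := by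
      intro x
      simp [← map_add]
    simp_rw [e]
    exact (hw _).add (((f.comp (ContinuousLinearMap.inr ℝ _ _)).continuous.tendsto _).comp hρ)
  have h2 := le_of_tendsto h1 (Eventually.of_forall fun k => (hfs _ (h k)).le)
  linarith

/-! ### Uniqueness of weak gradients -/

lemma ae_eq_zero_of_test {Ω : Set (E d)} (hΩ : IsOpen Ω) {q : E d → ℝ} (hq : MemLp q 2 (vol Ω))
    (h : ∀ φ, IsTest Ω φ → ∫ x in Ω, q x * φ x = 0) : q =ᵐ[vol Ω] 0 := by
  have hloc : LocallyIntegrableOn q Ω volume := by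
    rw [locallyIntegrableOn_iff hΩ.isLocallyClosed]
    intro K hK hKc
    have : IsFiniteMeasure ((vol Ω).restrict K) := ⟨by
      rw [Measure.restrict_apply_univ]
      exact (Measure.restrict_le_self K).trans_lt hKc.measure_lt_top⟩
    have := ((hq.restrict K).integrable one_le_two)
    rwa [Measure.restrict_restrict_of_subset hK] at this
  have := hΩ.ae_eq_zero_of_integral_contDiff_smul_eq_zero hloc (fun g hg hgc hgs => by
    have h1 := h g ⟨hg, hgc, hgs⟩
    rw [← h1, ← setIntegral_eq_integral_of_forall_compl_eq_zero (s := Ω)]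
    · simp [mul_comm]
    · intro x hx
      have : g x = 0 := image_eq_zero_of_notMem_tsupport fun h' => hx (hgs h')
      simp [this])
  exact (ae_restrict_iff' hΩ.measurableSet).2 this

theorem IsWeakGradient.unique {Ω : Set (E d)} (hΩ : IsOpen Ω) {v : Lp ℝ 2 (vol Ω)}
    {G G' : Lp (E d) 2 (vol Ω)} (h : IsWeakGradient Ω v G) (h' : IsWeakGradient Ω v G') :
    G = G' := by
  rw [← sub_eq_zero]
  have key : ∀ i : Fin d, (fun x => (G - G') x i) =ᵐ[vol Ω] 0 := by
    intro i
    refine ae_eq_zero_of_test hΩ (memLp_coord _ i) fun φ hφ => ?_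
    have e1 := h φ hφ i
    have e2 := h' φ hφ i
    have b1 := (memLp_coord G i).integrable_mul hφ.memLp
    have b2 := (memLp_coord G' i).integrable_mul hφ.memLp
    have : ∫ x in Ω, (G - G') x i * φ x =
        (∫ x in Ω, G x i * φ x) - ∫ x in Ω, G' x i * φ x := by
      refine Eq.trans ?_ (integral_sub b1 b2)
      refine integral_congr_ae ?_
      filter_upwards [Lp.coeFn_sub G G'] with x hx
      rw [hx]
      simp [sub_mul]
    rw [this]
    linarith
  refine Lp.ext ?_
  filter_upwards [ae_all_iff.2 key, Lp.coeFn_zero (E d) 2 (vol Ω)] with x hx h0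
  rw [h0]
  ext i
  simpa using hx i

/-- Consequently, identities in `H1 Ω` may be checked almost everywhere on the functions alone,
ignoring the gradient component. -/
theorem fnOf_injective {Ω : Set (E d)} (hΩ : IsOpen Ω) : Function.Injective (fnOf (Ω := Ω)) := by
  intro v w h
  have h2 : grad v = grad w := by
    refine IsWeakGradient.unique hΩ v.2 ?_
    have := w.2
    change IsWeakGradient Ω (fnOf w) (grad w) at this
    rw [← h] at this
    exact this
  apply Subtype.ext
  apply WithLp.ofLp_injective
  exact Prod.ext h h2

/-! ### Smooth functions as elements of `H¹(Ω)` and smooth multipliers -/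

lemma gradient_apply_coord (φ : E d → ℝ) (x : E d) (i : Fin d) :
    gradient φ x i = fderiv ℝ φ x (EuclideanSpace.single i 1) := by
  rw [← inner_gradient_left, EuclideanSpace.inner_single_right]
  simp

lemma norm_gradient_eq (φ : E d → ℝ) (x : E d) : ‖gradient φ x‖ = ‖fderiv ℝ φ x‖ := by
  rw [gradient, LinearIsometryEquiv.norm_map]

lemma continuous_gradient {φ : E d → ℝ} (h : ContDiff ℝ ∞ φ) : Continuous (gradient φ) :=
  (LinearIsometryEquiv.continuous _).comp (h.continuous_fderiv (by simp))

lemma hasCompactSupport_gradient {φ : E d → ℝ} (hc : HasCompactSupport φ) :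
    HasCompactSupport (gradient φ) :=
  (hc.fderiv ℝ).comp_left (map_zero _)

lemma memLp_gradient {φ : E d → ℝ} (h : ContDiff ℝ ∞ φ) (hc : HasCompactSupport φ)
    (μ : Measure (E d)) [IsFiniteMeasureOnCompacts μ] : MemLp (gradient φ) 2 μ :=
  (continuous_gradient h).memLp_of_hasCompactSupport (hasCompactSupport_gradient hc)

/-- The test function is supported in `Ω`, so both integrals extend to the whole space, where
integration by parts has no boundary term. -/
lemma isWeakGradient_smooth {Ω : Set (E d)} {φ : E d → ℝ} (h : ContDiff ℝ ∞ φ)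
    {v : Lp ℝ 2 (vol Ω)} {G : Lp (E d) 2 (vol Ω)}
    (hv : v =ᵐ[vol Ω] φ) (hG : G =ᵐ[vol Ω] gradient φ) : IsWeakGradient Ω v G := by
  intro ζ hζ i
  have e1 : ∫ x in Ω, v x * fderiv ℝ ζ x (EuclideanSpace.single i 1) =
      ∫ x, φ x * fderiv ℝ ζ x (EuclideanSpace.single i 1) := by
    rw [← setIntegral_eq_integral_of_forall_compl_eq_zero (μ := volume) (s := Ω) (f := fun x =>
      φ x * fderiv ℝ ζ x (EuclideanSpace.single i 1))]
    · refine integral_congr_ae ?_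
      filter_upwards [hv] with x hx
      rw [hx]
    · intro x hx
      have : fderiv ℝ ζ x = 0 :=
        image_eq_zero_of_notMem_tsupport fun h' => hx (hζ.2.2 (tsupport_fderiv_subset ℝ h'))
      simp [this]
  have e2 : ∫ x in Ω, G x i * ζ x =
      ∫ x, fderiv ℝ φ x (EuclideanSpace.single i 1) * ζ x := by
    rw [← setIntegral_eq_integral_of_forall_compl_eq_zero (μ := volume) (s := Ω) (f := fun x =>
      fderiv ℝ φ x (EuclideanSpace.single i 1) * ζ x)]
    · refine integral_congr_ae ?_
      filter_upwards [hG] with x hx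
      rw [hx, gradient_apply_coord]
    · intro x hx
      have : ζ x = 0 := image_eq_zero_of_notMem_tsupport fun h' => hx (hζ.2.2 h')
      simp [this]
  rw [e1, e2]
  have c1 : Continuous fun x => fderiv ℝ φ x (EuclideanSpace.single i 1) :=
    (h.continuous_fderiv (by simp)).clm_apply continuous_const
  have c2 : Continuous fun x => fderiv ℝ ζ x (EuclideanSpace.single i 1) :=
    (hζ.1.continuous_fderiv (by simp)).clm_apply continuous_const
  refine integral_mul_fderiv_eq_neg_fderiv_mul_of_integrable ?_ ?_ ?_
    (fun x _ => h.differentiable (by simp) x) (fun x _ => hζ.1.differentiable (by simp) x)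
  · exact (c1.mul hζ.1.continuous).integrable_of_hasCompactSupport hζ.2.1.mul_left
  · exact (h.continuous.mul c2).integrable_of_hasCompactSupport
      (hζ.2.1.fderiv_apply (𝕜 := ℝ) _).mul_left
  · exact (h.continuous.mul hζ.1.continuous).integrable_of_hasCompactSupport hζ.2.1.mul_left

/-- The element of `H¹(Ω)` given by a function in `C_c^∞(ℝ^d)`. -/
def ofSmooth (Ω : Set (E d)) {φ : E d → ℝ} (h : ContDiff ℝ ∞ φ) (hc : HasCompactSupport φ) :
    H1 Ω :=
  ⟨WithLp.toLp 2 (((h.continuous.memLp_of_hasCompactSupport hc).restrict Ω).toLp φ,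
      ((memLp_gradient h hc volume).restrict Ω).toLp (gradient φ)),
    isWeakGradient_smooth h
      ((h.continuous.memLp_of_hasCompactSupport hc).restrict Ω).coeFn_toLp
      ((memLp_gradient h hc volume).restrict Ω).coeFn_toLp⟩

lemma fnOf_ofSmooth (Ω : Set (E d)) {φ : E d → ℝ} (h : ContDiff ℝ ∞ φ)
    (hc : HasCompactSupport φ) : fnOf (ofSmooth Ω h hc) =ᵐ[vol Ω] φ :=
  ((h.continuous.memLp_of_hasCompactSupport hc).restrict Ω).coeFn_toLp

lemma grad_ofSmooth (Ω : Set (E d)) {φ : E d → ℝ} (h : ContDiff ℝ ∞ φ)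
    (hc : HasCompactSupport φ) : grad (ofSmooth Ω h hc) =ᵐ[vol Ω] gradient φ :=
  ((memLp_gradient h hc volume).restrict Ω).coeFn_toLp

lemma eq_ofSmooth {Ω : Set (E d)} (hΩ : IsOpen Ω) {φ : E d → ℝ} (h : ContDiff ℝ ∞ φ)
    (hc : HasCompactSupport φ) {v : H1 Ω} (hv : fnOf v =ᵐ[vol Ω] φ) : v = ofSmooth Ω h hc :=
  fnOf_injective hΩ (Lp.ext (hv.trans (fnOf_ofSmooth Ω h hc).symm))

/-! ### Multiplication operators on `L²`, `H¹(Ω)` and traces -/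

/-- Multiplication of `L²` by a bounded function. -/
def mulLp {α F : Type*} [MeasurableSpace α] {μ : Measure α} [NormedAddCommGroup F]
    [NormedSpace ℝ F] {ψ : α → ℝ} (h : MemLp ψ ⊤ μ) : Lp F 2 μ →L[ℝ] Lp F 2 μ :=
  (ContinuousLinearMap.lsmul ℝ ℝ).holderL μ ⊤ 2 2 (h.toLp ψ)

lemma coeFn_mulLp {α F : Type*} [MeasurableSpace α] {μ : Measure α} [NormedAddCommGroup F]
    [NormedSpace ℝ F] {ψ : α → ℝ} (h : MemLp ψ ⊤ μ) (f : Lp F 2 μ) :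
    mulLp h f =ᵐ[μ] fun x => ψ x • f x := by
  refine (ContinuousLinearMap.coeFn_holder (r := 2) (ContinuousLinearMap.lsmul ℝ ℝ)
    (h.toLp ψ) f).trans ?_
  filter_upwards [h.coeFn_toLp] with x hx
  rw [hx]
  rfl

/-- Multiplication of `L²` by a bounded vector field. -/
def fieldMulLp {α F : Type*} [MeasurableSpace α] {μ : Measure α} [NormedAddCommGroup F]
    [NormedSpace ℝ F] {Y : α → F} (h : MemLp Y ⊤ μ) : Lp ℝ 2 μ →L[ℝ] Lp F 2 μ :=
  (ContinuousLinearMap.lsmul ℝ ℝ).flip.holderL μ ⊤ 2 2 (h.toLp Y)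

lemma coeFn_fieldMulLp {α F : Type*} [MeasurableSpace α] {μ : Measure α} [NormedAddCommGroup F]
    [NormedSpace ℝ F] {Y : α → F} (h : MemLp Y ⊤ μ) (f : Lp ℝ 2 μ) :
    fieldMulLp h f =ᵐ[μ] fun x => f x • Y x := by
  refine (ContinuousLinearMap.coeFn_holder (r := 2) (ContinuousLinearMap.lsmul ℝ ℝ).flip
    (h.toLp Y) f).trans ?_
  filter_upwards [h.coeFn_toLp] with x hx
  rw [hx]
  rfl

lemma memLp_top_of_continuous {F : Type*} [NormedAddCommGroup F] {ψ : E d → F}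
    (h : Continuous ψ) {S : Set (E d)} (hS : Bornology.IsBounded S) (hm : MeasurableSet S)
    (μ : Measure (E d)) : MemLp ψ ⊤ (μ.restrict S) := by
  obtain ⟨C, hC⟩ := hS.isCompact_closure.exists_bound_of_continuousOn h.continuousOn
  exact memLp_top_of_bound h.aestronglyMeasurable C
    ((ae_restrict_iff' hm).2 (ae_of_all _ fun x hx => hC x (subset_closure hx)))

lemma IsWeakGradient.mul {Ω : Set (E d)} {ψ : E d → ℝ} (hψ : ContDiff ℝ ∞ ψ)
    {v v' : Lp ℝ 2 (vol Ω)} {G G' : Lp (E d) 2 (vol Ω)} (h : IsWeakGradient Ω v G)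
    (hv : v' =ᵐ[vol Ω] fun x => ψ x * v x)
    (hG : G' =ᵐ[vol Ω] fun x => ψ x • G x + v x • gradient ψ x) : IsWeakGradient Ω v' G' := by
  intro φ hφ i
  have hψφ : IsTest Ω fun x => ψ x * φ x :=
    ⟨hψ.mul hφ.1, hφ.2.1.mul_left, (tsupport_mul_subset_right).trans hφ.2.2⟩
  have hd : ∀ x, fderiv ℝ (fun x => ψ x * φ x) x (EuclideanSpace.single i 1) =
      ψ x * fderiv ℝ φ x (EuclideanSpace.single i 1) + φ x * gradient ψ x i := by
    intro x
    rw [fderiv_fun_mul (hψ.differentiable (by simp) x) (hφ.1.differentiable (by simp) x),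
      gradient_apply_coord]
    simp
  have key := h _ hψφ i
  have t2 : MemLp (fun x => φ x * gradient ψ x i) 2 (vol Ω) := by
    refine (Continuous.memLp_of_hasCompactSupport ?_ hφ.2.1.mul_right).restrict _
    exact hφ.1.continuous.mul
      ((EuclideanSpace.proj (𝕜 := ℝ) i : E d →L[ℝ] ℝ).continuous.comp (continuous_gradient hψ))
  have t1 : MemLp (fun x => ψ x * fderiv ℝ φ x (EuclideanSpace.single i 1)) 2 (vol Ω) := by
    refine (Continuous.memLp_of_hasCompactSupport ?_ ?_).restrict _
    · exact hψ.continuous.mul ((hφ.1.continuous_fderiv (by simp)).clm_apply continuous_const)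
    · exact (hφ.2.1.fderiv_apply (𝕜 := ℝ) _).mul_left
  have i1 := (Lp.memLp v).integrable_mul t1
  have i2 := (Lp.memLp v).integrable_mul t2
  have i3 := (memLp_coord G i).integrable_mul hψφ.memLp
  have e1 : ∫ x in Ω, v x * fderiv ℝ (fun x => ψ x * φ x) x (EuclideanSpace.single i 1) =
      (∫ x in Ω, v x * (ψ x * fderiv ℝ φ x (EuclideanSpace.single i 1))) +
        ∫ x in Ω, v x * (φ x * gradient ψ x i) := by
    refine Eq.trans ?_ (integral_add i1 i2)
    refine integral_congr_ae (ae_of_all _ fun x => ?_)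
    simp only [hd]
    ring
  have e2 : ∫ x in Ω, v' x * fderiv ℝ φ x (EuclideanSpace.single i 1) =
      ∫ x in Ω, v x * (ψ x * fderiv ℝ φ x (EuclideanSpace.single i 1)) := by
    refine integral_congr_ae ?_
    filter_upwards [hv] with x hx
    rw [hx]
    ring
  have e3 : ∫ x in Ω, G' x i * φ x = (∫ x in Ω, G x i * (ψ x * φ x)) +
      ∫ x in Ω, v x * (φ x * gradient ψ x i) := by
    refine Eq.trans ?_ (integral_add i3 i2)
    refine integral_congr_ae ?_
    filter_upwards [hG] with x hx
    rw [hx]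
    simp only [PiLp.add_apply, PiLp.smul_apply, smul_eq_mul]
    ring
  rw [e2, e3]
  linarith

/-- Multiplication by a smooth function as a bounded operator on `H¹(Ω)`. -/
theorem exists_mulSmooth {Ω : Set (E d)} (hΩ : IsOpen Ω) (hb : Bornology.IsBounded Ω)
    {ψ : E d → ℝ} (hψ : ContDiff ℝ ∞ ψ) :
    ∃ M : H1 Ω →L[ℝ] H1 Ω, (∀ v, fnOf (M v) =ᵐ[vol Ω] fun x => ψ x * fnOf v x) ∧
      ∀ v, grad (M v) =ᵐ[vol Ω] fun x => ψ x • grad v x + fnOf v x • gradient ψ x := by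
  have m1 : MemLp ψ ⊤ (vol Ω) :=
    memLp_top_of_continuous hψ.continuous hb hΩ.measurableSet volume
  have m2 : MemLp (gradient ψ) ⊤ (vol Ω) :=
    memLp_top_of_continuous (continuous_gradient hψ) hb hΩ.measurableSet volume
  let A : WithLp 2 (Lp ℝ 2 (vol Ω) × Lp (E d) 2 (vol Ω)) →L[ℝ] Lp ℝ 2 (vol Ω) :=
    (mulLp m1).comp (WithLp.fstL 2 ℝ _ _)
  let B : WithLp 2 (Lp ℝ 2 (vol Ω) × Lp (E d) 2 (vol Ω)) →L[ℝ] Lp (E d) 2 (vol Ω) :=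
    (mulLp m1).comp (WithLp.sndL 2 ℝ _ _) + (fieldMulLp m2).comp (WithLp.fstL 2 ℝ _ _)
  let T := (WithLp.prodContinuousLinearEquiv 2 ℝ (Lp ℝ 2 (vol Ω))
    (Lp (E d) 2 (vol Ω))).symm.toContinuousLinearMap.comp (A.prod B)
  have hA : ∀ p, (T p).fst =ᵐ[vol Ω] fun x => ψ x * p.fst x := fun p => coeFn_mulLp m1 p.fst
  have hB : ∀ p, (T p).snd =ᵐ[vol Ω] fun x => ψ x • p.snd x + p.fst x • gradient ψ x := by
    intro p
    have : (T p).snd = mulLp m1 p.snd + fieldMulLp m2 p.fst := rfl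
    rw [this]
    filter_upwards [Lp.coeFn_add (mulLp m1 p.snd) (fieldMulLp m2 p.fst), coeFn_mulLp m1 p.snd,
      coeFn_fieldMulLp m2 p.fst] with x h1 h2 h3
    rw [h1, Pi.add_apply, h2, h3]
  have hT : ∀ p ∈ H1 Ω, T p ∈ H1 Ω := fun p hp => IsWeakGradient.mul hψ hp (hA p) (hB p)
  exact ⟨T.restrict hT, fun v => hA v.1, fun v => hB v.1⟩

lemma measurableSet_frontier' (Ω : Set (E d)) : MeasurableSet (frontier Ω) :=
  isClosed_frontier.measurableSet

/-- The trace of a product with a smooth function. -/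
theorem exists_mul_isTrace {Ω : Set (E d)} (hΩ : IsOpen Ω) (hb : Bornology.IsBounded Ω)
    {ψ : E d → ℝ} (hψ : ContDiff ℝ ∞ ψ) {v : H1 Ω} {τ : Lp ℝ 2 (surf Ω)} (h : IsTrace Ω v τ) :
    ∃ (w : H1 Ω) (ρ : Lp ℝ 2 (surf Ω)), IsTrace Ω w ρ ∧
      (fnOf w =ᵐ[vol Ω] fun x => ψ x * fnOf v x) ∧
      (grad w =ᵐ[vol Ω] fun x => ψ x • grad v x + fnOf v x • gradient ψ x) ∧
      (ρ =ᵐ[surf Ω] fun x => ψ x * τ x) := by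
  obtain ⟨M, hM1, hM2⟩ := exists_mulSmooth hΩ hb hψ
  have hbf : Bornology.IsBounded (frontier Ω) := hb.closure.subset frontier_subset_closure
  have m : MemLp ψ ⊤ (surf Ω) :=
    memLp_top_of_continuous hψ.continuous hbf (measurableSet_frontier' Ω) _
  refine ⟨M v, mulLp m τ, ?_, hM1 v, hM2 v, coeFn_mulLp m τ⟩
  -- Multiplication is continuous on both factors and maps the graph of smooth restrictions into
  -- itself, hence also its closure.
  refine map_mem_closure (f := Prod.map M (mulLp m)) (by fun_prop) h ?_
  rintro ⟨p, σ⟩ ⟨φ, h1, h2, h3, h4⟩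
  refine ⟨fun x => ψ x * φ x, hψ.mul h1, h2.mul_left, ?_, ?_⟩
  · filter_upwards [hM1 p, h3] with x hx h3
    simp only [Prod.map_apply, hx] at h3 ⊢
    rw [h3]
  · filter_upwards [coeFn_mulLp m σ, h4] with x hx h4
    simp only [Prod.map_apply, hx] at h4 ⊢
    rw [h4, smul_eq_mul]

/-! ### Dominated convergence in `L²` and truncation -/

theorem tendsto_Lp_two_of_dominated {α : Type*} [MeasurableSpace α] {μ : Measure α}
    {f : ℕ → Lp ℝ 2 μ} {g : Lp ℝ 2 μ} (hb : ∀ n, ∀ᵐ x ∂μ, |f n x| ≤ |g x|)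
    (hl : ∀ᵐ x ∂μ, Tendsto (fun n => f n x) atTop (𝓝 (g x))) : Tendsto f atTop (𝓝 g) := by
  rw [Lp.tendsto_Lp_iff_tendsto_eLpNorm']
  have h1 : Tendsto (fun n => ∫⁻ x, ‖(f n : α → ℝ) x - g x‖ₑ ^ (2 : ℝ) ∂μ) atTop (𝓝 0) := by
    have : (∫⁻ _ : α, (0 : ENNReal) ∂μ) = 0 := by simp
    rw [← this]
    refine tendsto_lintegral_of_dominated_convergence' (fun x => (2 * ‖g x‖ₑ) ^ (2 : ℝ))
      (fun n => ?_) (fun n => ?_) ?_ ?_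
    · exact (((Lp.aestronglyMeasurable (f n)).sub (Lp.aestronglyMeasurable g)).enorm).pow_const _
    · filter_upwards [hb n] with x hx
      refine ENNReal.rpow_le_rpow ?_ (by norm_num)
      have : ‖(f n : α → ℝ) x‖ₑ ≤ ‖g x‖ₑ := enorm_le_iff_norm_le.2 hx
      calc _ ≤ ‖(f n : α → ℝ) x‖ₑ + ‖g x‖ₑ := enorm_sub_le
        _ ≤ _ := by rw [two_mul]; gcongr
    · simp_rw [ENNReal.mul_rpow_of_nonneg _ _ (by norm_num : (0 : ℝ) ≤ 2)]
      rw [lintegral_const_mul' _ _ (by simp)]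
      have := (Lp.memLp g).eLpNorm_lt_top
      rw [eLpNorm_lt_top_iff_lintegral_rpow_enorm_lt_top (by simp) (by simp)] at this
      refine ENNReal.mul_ne_top (by simp) ?_
      simpa using this.ne
    · filter_upwards [hl] with x hx
      have h2 : Tendsto (fun n => ‖(f n : α → ℝ) x - g x‖ₑ) atTop (𝓝 0) := by
        have := (hx.sub (tendsto_const_nhds (x := g x))).enorm
        simpa using this
      have := (ENNReal.continuous_rpow_const (y := 2)).tendsto 0 |>.comp h2
      simpa [Function.comp_def] using this
  have h2 := (ENNReal.continuous_rpow_const (y := (1 / 2 : ℝ))).tendsto 0 |>.comp h1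
  have h3 : (0 : ENNReal) ^ (1 / 2 : ℝ) = 0 := by simp
  rw [h3] at h2
  refine h2.congr fun n => ?_
  rw [eLpNorm_eq_lintegral_rpow_enorm_toReal (by simp) (by simp)]
  simp

/-- The smooth truncation `s ↦ M arctan (s / M)`. -/
def trunc (M s : ℝ) : ℝ := M * Real.arctan (s / M)

lemma trunc_zero (M : ℝ) : trunc M 0 = 0 := by simp [trunc]

lemma contDiff_trunc (M : ℝ) : ContDiff ℝ ∞ (trunc M) := by
  unfold trunc
  exact contDiff_const.mul (Real.contDiff_arctan.comp (contDiff_id.div_const M))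

lemma hasDerivAt_trunc {M : ℝ} (hM : 0 < M) (s : ℝ) :
    HasDerivAt (trunc M) (1 / (1 + (s / M) ^ 2)) s := by
  have := (((hasDerivAt_id s).div_const M).arctan).const_mul M
  convert! this using 1
  simp only [id]
  field_simp

lemma abs_deriv_trunc_le {M : ℝ} (hM : 0 < M) (s : ℝ) : |deriv (trunc M) s| ≤ 1 := by
  rw [(hasDerivAt_trunc hM s).deriv, abs_of_pos (by positivity),
    div_le_one (by positivity)]
  nlinarith [sq_nonneg (s / M)]

lemma lipschitzWith_trunc {M : ℝ} (hM : 0 < M) : LipschitzWith 1 (trunc M) :=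
  lipschitzWith_of_nnnorm_deriv_le ((contDiff_trunc M).differentiable (by simp)) fun s => by
    rw [← NNReal.coe_le_coe, coe_nnnorm]
    exact abs_deriv_trunc_le hM s

lemma abs_trunc_le_abs {M : ℝ} (hM : 0 < M) (s : ℝ) : |trunc M s| ≤ |s| := by
  have := (lipschitzWith_trunc hM).dist_le_mul s 0
  simpa [trunc_zero, Real.dist_eq] using this

lemma abs_trunc_le {M : ℝ} (hM : 0 < M) (s : ℝ) : |trunc M s| ≤ M * 2 := by
  unfold trunc
  rw [abs_mul, abs_of_pos hM]
  gcongr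
  have h1 := Real.arctan_lt_pi_div_two (s / M)
  have h2 := Real.neg_pi_div_two_lt_arctan (s / M)
  -- The crude factor `2` bounds `π / 2`.
  have h3 := Real.pi_le_four
  rw [abs_le]
  constructor <;> linarith

/-- For `s ≠ 0` the truncation is `s` times the difference quotient of `arctan` between `0` and `s /
(n + 1)`, and `arctan` has slope `1` at `0`. -/
lemma tendsto_trunc (s : ℝ) : Tendsto (fun n : ℕ => trunc (n + 1) s) atTop (𝓝 s) := by
  have h0 : HasDerivAt Real.arctan 1 0 := by simpa using Real.hasDerivAt_arctan 0
  have h1 := (hasDerivAt_iff_tendsto_slope_zero.1 h0)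
  rcases eq_or_ne s 0 with rfl | hs
  · simp [trunc_zero]
  have h2 : Tendsto (fun n : ℕ => s / ((n : ℝ) + 1)) atTop (𝓝[≠] 0) := by
    refine tendsto_nhdsWithin_iff.2 ⟨?_, Eventually.of_forall fun n => ?_⟩
    · exact tendsto_const_nhds.div_atTop (tendsto_natCast_atTop_atTop.atTop_add tendsto_const_nhds)
    · have : (n : ℝ) + 1 ≠ 0 := by positivity
      exact div_ne_zero hs this
  have h3 := (h1.comp h2).const_mul s
  rw [mul_one] at h3
  refine h3.congr fun n => ?_
  have : (n : ℝ) + 1 ≠ 0 := by positivity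
  simp only [Function.comp_apply, zero_add, Real.arctan_zero, sub_zero, smul_eq_mul, trunc]
  field_simp

/-- The classical chain rule with a factor of modulus at most one. Only smooth functions are
treated; general ones are reached by weak limits. -/
lemma norm_grad_ofSmooth_comp_trunc_le (Ω : Set (E d)) {φ : E d → ℝ} (h : ContDiff ℝ ∞ φ)
    (hc : HasCompactSupport φ) {M : ℝ} (hM : 0 < M) :
    ‖grad (ofSmooth Ω ((contDiff_trunc M).comp h) (hc.comp_left (trunc_zero M)))‖ ≤
      ‖grad (ofSmooth Ω h hc)‖ := by
  refine Lp.norm_le_norm_of_ae_le ?_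
  filter_upwards [grad_ofSmooth Ω h hc, grad_ofSmooth Ω ((contDiff_trunc M).comp h)
    (hc.comp_left (trunc_zero M))] with x h1 h2
  rw [h1, h2, norm_gradient_eq, norm_gradient_eq]
  have h3 : HasFDerivAt (trunc M ∘ φ) (deriv (trunc M) (φ x) • fderiv ℝ φ x) x :=
    (((contDiff_trunc M).differentiable (by simp) (φ x)).hasDerivAt).comp_hasFDerivAt x
      (h.differentiable (by simp) x).hasFDerivAt
  rw [h3.fderiv, norm_smul]
  calc _ ≤ 1 * ‖fderiv ℝ φ x‖ := by
        gcongr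
        exact abs_deriv_trunc_le hM _
    _ = _ := one_mul _

/-- Smooth truncations of a function with a trace; the gradients are bounded independently of the
truncation level. -/
theorem exists_trunc {Ω : Set (E d)} (hΩ : IsOpen Ω) {v : H1 Ω} {τ : Lp ℝ 2 (surf Ω)}
    (h : IsTrace Ω v τ) : ∃ R : ℝ, ∀ M : ℝ, 0 < M → ∃ (w : H1 Ω) (ρ : Lp ℝ 2 (surf Ω)),
      IsTrace Ω w ρ ∧ ‖grad w‖ ≤ R ∧ (fnOf w =ᵐ[vol Ω] fun x => trunc M (fnOf v x)) ∧
      (ρ =ᵐ[surf Ω] fun x => trunc M (τ x)) := by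
  obtain ⟨p, hp, hlim⟩ := mem_closure_iff_seq_limit.1 h
  choose φ h1 h2 h3 h4 using hp
  have hp1 : Tendsto (fun k => (p k).1) atTop (𝓝 v) := (continuous_fst.tendsto _).comp hlim
  have hp2 : Tendsto (fun k => (p k).2) atTop (𝓝 τ) := (continuous_snd.tendsto _).comp hlim
  have hfn : Tendsto (fun k => fnOf (p k).1) atTop (𝓝 (fnOf v)) :=
    (((WithLp.fstL 2 ℝ _ _).continuous.comp continuous_subtype_val).tendsto v).comp hp1
  have hgr : Tendsto (fun k => grad (p k).1) atTop (𝓝 (grad v)) :=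
    (((WithLp.sndL 2 ℝ _ _).continuous.comp continuous_subtype_val).tendsto v).comp hp1
  -- The bound comes from the smooth approximants of `v` and is fixed before `M`, hence uniform in
  -- the truncation level.
  obtain ⟨R, hR⟩ := hgr.norm.bddAbove_range
  refine ⟨R, fun M hM => ?_⟩
  have hL := lipschitzWith_trunc hM
  let q : ℕ → H1 Ω := fun k => ofSmooth Ω ((contDiff_trunc M).comp (h1 k))
    ((h2 k).comp_left (trunc_zero M))
  have hq : ∀ k, ‖grad (q k)‖ ≤ R := by
    intro k
    refine (norm_grad_ofSmooth_comp_trunc_le Ω (h1 k) (h2 k) hM).trans ?_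
    rw [← eq_ofSmooth hΩ (h1 k) (h2 k) (h3 k)]
    exact hR ⟨k, rfl⟩
  have hq1 : ∀ k, fnOf (q k) = hL.compLp (trunc_zero M) (fnOf (p k).1) := by
    intro k
    refine Lp.ext ?_
    filter_upwards [fnOf_ofSmooth Ω ((contDiff_trunc M).comp (h1 k))
      ((h2 k).comp_left (trunc_zero M)), hL.coeFn_compLp (trunc_zero M) (fnOf (p k).1), h3 k]
      with x e1 e2 e3
    rw [e1, e2, Function.comp_apply, Function.comp_apply, e3]
  have hq2 : Tendsto (fun k => fnOf (q k)) atTop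
      (𝓝 (hL.compLp (trunc_zero M) (fnOf v))) := by
    simp_rw [hq1]
    exact ((hL.continuous_compLp (trunc_zero M)).tendsto _).comp hfn
  -- Strong convergence of the truncated gradients is not needed: functions and traces converge in
  -- `L²` because `trunc M` is Lipschitz, and the gradients are bounded.
  obtain ⟨w, hw1, hw2, 𝒰, hne, hle, hw3⟩ := exists_weak_limit_H1 q hq hq2
  refine ⟨w, hL.compLp (trunc_zero M) τ, ?_, hw2, ?_, hL.coeFn_compLp _ _⟩
  · refine isTrace_of_tendsto (v := q) (τ := fun k => hL.compLp (trunc_zero M) (p k).2)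
      (fun k => ?_) hw3 ?_
    · refine Submodule.le_topologicalClosure _ ⟨trunc M ∘ φ k, (contDiff_trunc M).comp (h1 k),
        (h2 k).comp_left (trunc_zero M), fnOf_ofSmooth Ω ((contDiff_trunc M).comp (h1 k))
          ((h2 k).comp_left (trunc_zero M)), ?_⟩
      filter_upwards [hL.coeFn_compLp (trunc_zero M) (p k).2, h4 k] with x e1 e2
      rw [e1, Function.comp_apply, Function.comp_apply, e2]
    · exact (((hL.continuous_compLp (trunc_zero M)).tendsto _).comp hp2).mono_left hle
  · rw [hw1]
    exact hL.coeFn_compLp _ _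

/-! ### Uniqueness of traces -/

/-- The hyperplane orthogonal to `e`. -/
abbrev hyp (e : E d) : Submodule ℝ (E d) := (Submodule.span ℝ {e})ᗮ

/-- Orthogonal projection onto the hyperplane orthogonal to `e`. -/
abbrev proj (e : E d) : E d →L[ℝ] hyp e := (hyp e).orthogonalProjectionOnto

lemma inner_hyp {e : E d} (h : hyp e) : inner ℝ e (h : E d) = 0 :=
  Submodule.mem_orthogonal_singleton_iff_inner_right.1 h.2

lemma inner_hyp_add {e : E d} (he : ‖e‖ = 1) (h : hyp e) (s : ℝ) :
    inner ℝ e ((h : E d) + s • e) = s := by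
  rw [inner_add_right, inner_hyp, inner_smul_right, real_inner_self_eq_norm_sq, he]
  simp

lemma proj_hyp_add {e : E d} (h : hyp e) (s : ℝ) : proj e ((h : E d) + s • e) = h := by
  rw [map_add, map_smul, Submodule.orthogonalProjectionOnto_mem_subspace_eq_self,
    Submodule.orthogonalProjectionOnto_orthogonalComplement_singleton_eq_zero]
  simp

lemma proj_add_inner {e : E d} (he : ‖e‖ = 1) (x : E d) :
    (proj e x : E d) + inner ℝ e x • e = x := by
  rw [Submodule.orthogonalProjectionOnto_orthogonal]
  simp [Submodule.starProjection_unit_singleton ℝ he]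

/-- The decomposition `ℝ^d = e^⊥ ⊕ ℝ e`. -/
def hypProd (e : E d) (he : ‖e‖ = 1) : (hyp e × ℝ) ≃L[ℝ] E d :=
  ContinuousLinearEquiv.equivOfInverse
    ((hyp e).subtypeL.comp (ContinuousLinearMap.fst ℝ (hyp e) ℝ) +
      (ContinuousLinearMap.toSpanSingleton ℝ e).comp (ContinuousLinearMap.snd ℝ (hyp e) ℝ))
    ((proj e).prod (innerSL ℝ e))
    (fun p => Prod.ext (proj_hyp_add p.1 p.2) (inner_hyp_add he p.1 p.2))
    (fun x => proj_add_inner he x)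

lemma finrank_hyp {e : E d} (he : ‖e‖ = 1) : Module.finrank ℝ (hyp e) = d - 1 := by
  have h0 : e ≠ 0 := by
    rintro rfl
    simp at he
  have h1 := Submodule.finrank_add_finrank_orthogonal (Submodule.span ℝ {e})
  rw [finrank_span_singleton h0, finrank_euclideanSpace_fin] at h1
  change 1 + Module.finrank ℝ (hyp e) = d at h1
  omega

lemma isAddHaarMeasure_hyp {e : E d} (he : ‖e‖ = 1) :
    (Measure.euclideanHausdorffMeasure (d - 1) : Measure (hyp e)).IsAddHaarMeasure := by
  rw [← finrank_hyp he]
  infer_instance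

/-! ### Lipschitz charts and the local trace inequality -/

/-- The coordinates `(h, t) ↦ h + (γ(h) + t) e` preserve Lebesgue measure up to a constant. -/
lemma exists_map_shear {e : E d} (he : ‖e‖ = 1) {γ : hyp e → ℝ} (hγ : Continuous γ) :
    ∃ c : ENNReal, c ≠ ⊤ ∧ MeasurePreserving
      (fun p : hyp e × ℝ => (p.1 : E d) + (γ p.1 + p.2) • e)
      ((Measure.euclideanHausdorffMeasure (d - 1) : Measure (hyp e)).prod volume)
      (c • (volume : Measure (E d))) := by
  have hH := isAddHaarMeasure_hyp he
  set ν : Measure (hyp e) := Measure.euclideanHausdorffMeasure (d - 1) with hν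
  have h1 := (hypProd e he).isAddHaarMeasure_map (ν.prod volume)
  have h2 := Measure.isAddLeftInvariant_eq_smul (Measure.map (hypProd e he) (ν.prod volume))
    (volume : Measure (E d))
  -- The image of a Haar measure under a linear isomorphism is Haar, hence a multiple of Lebesgue
  -- measure. Only finiteness of the factor matters.
  have m1 : MeasurePreserving (hypProd e he) (ν.prod volume)
      ((Measure.addHaarScalarFactor (Measure.map (hypProd e he) (ν.prod volume))
        (volume : Measure (E d)) : ENNReal) • (volume : Measure (E d))) :=
    ⟨(hypProd e he).continuous.measurable, h2⟩
  -- The shear translates each fibre, so it preserves the product measure whatever `γ` is.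
  have m2 : MeasurePreserving (fun p : hyp e × ℝ => (id p.1, γ p.1 + p.2))
      (ν.prod volume) (ν.prod volume) := by
    refine (MeasurePreserving.id ν).skew_product (g := fun h t => γ h + t) ?_
      (ae_of_all _ fun h => ?_)
    · exact (by fun_prop : Continuous fun p : hyp e × ℝ => γ p.1 + p.2).measurable
    · exact map_add_left_eq_self volume (γ h)
  exact ⟨_, ENNReal.coe_ne_top, m1.comp m2⟩

/-- Average `F 0 = F t - ∫₀ᵗ F'` over `t ∈ (0, r)`. -/
lemma enorm_le_lintegral_of_contDiff {F F' : ℝ → ℝ} (hF : ∀ t, HasDerivAt F (F' t) t)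
    (hF' : Continuous F') (r : ℝ) :
    ‖F 0‖ₑ * ENNReal.ofReal r ≤
      (∫⁻ t in Ioo 0 r, ‖F t‖ₑ) + (∫⁻ t in Ioo 0 r, ‖F' t‖ₑ) * ENNReal.ofReal r := by
  have hvol : volume (Ioo 0 r) = ENNReal.ofReal r := by rw [Real.volume_Ioo, sub_zero]
  have hcF : Continuous F := continuous_iff_continuousAt.2 fun t => (hF t).continuousAt
  have hpt : ∀ t ∈ Ioo 0 r, ‖F 0‖ₑ ≤ ‖F t‖ₑ + ∫⁻ s in Ioo 0 r, ‖F' s‖ₑ := by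
    intro t ht
    have h1 := intervalIntegral.integral_eq_sub_of_hasDerivAt (a := 0) (b := t)
      (fun s _ => hF s) (hF'.intervalIntegrable _ _)
    have h2 : F 0 = F t - ∫ s in (0 : ℝ)..t, F' s := by rw [h1]; ring
    rw [h2]
    refine enorm_sub_le.trans ?_
    gcongr
    rw [intervalIntegral.integral_of_le ht.1.le]
    refine (enorm_integral_le_lintegral_enorm _).trans ?_
    exact lintegral_mono_set fun s hs => ⟨hs.1, hs.2.trans_lt ht.2⟩
  calc ‖F 0‖ₑ * ENNReal.ofReal r = ∫⁻ _ in Ioo 0 r, ‖F 0‖ₑ := by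
        rw [setLIntegral_const, hvol]
    _ ≤ ∫⁻ t in Ioo 0 r, (‖F t‖ₑ + ∫⁻ s in Ioo 0 r, ‖F' s‖ₑ) :=
        setLIntegral_mono' measurableSet_Ioo hpt
    _ = _ := by
        rw [lintegral_add_left hcF.measurable.enorm, setLIntegral_const, hvol]

/-- The Hausdorff measure on the graph of a Lipschitz function is dominated by the push forward of
the measure on the base. -/
lemma exists_restrict_graph_le {e : E d} {L : NNReal} {γ : hyp e → ℝ} (he : ‖e‖ = 1)
    (hγ : LipschitzWith L γ) (B : Set (hyp e)) :
    ∃ C : ENNReal, C ≠ ⊤ ∧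
      (Measure.euclideanHausdorffMeasure (d - 1)).restrict
          ((fun h : hyp e => (h : E d) + γ h • e) '' B) ≤
        C • ((Measure.euclideanHausdorffMeasure (d - 1)).restrict B).map
          (fun h : hyp e => (h : E d) + γ h • e) := by
  set G : hyp e → E d := fun h => (h : E d) + γ h • e with hG
  have hGl : LipschitzWith (1 + L) G := by
    refine LipschitzWith.of_dist_le_mul fun a b => ?_
    rw [dist_eq_norm]
    have h1 : G a - G b = ((a - b : hyp e) : E d) + (γ a - γ b) • e := by
      simp only [hG, Submodule.coe_sub, sub_smul]
      abel
    have h2 := hγ.dist_le_mul a b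
    rw [h1]
    refine (norm_add_le _ _).trans ?_
    rw [norm_smul, he, mul_one, NNReal.coe_add, NNReal.coe_one, add_mul, one_mul, dist_eq_norm]
    rw [Real.dist_eq, dist_eq_norm] at h2
    exact add_le_add le_rfl h2
  -- A `(1 + L)`-Lipschitz map enlarges `(d-1)`-dimensional Hausdorff measure by at most this power.
  refine ⟨((1 + L : NNReal) : ENNReal) ^ ((d - 1 : ℕ) : ℝ),
    ENNReal.rpow_ne_top_of_nonneg (by positivity) (by simp), ?_⟩
  refine Measure.le_iff.2 fun A hA => ?_
  rw [Measure.restrict_apply hA, Measure.smul_apply, Measure.map_apply hGl.continuous.measurable hA,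
    Measure.restrict_apply (hGl.continuous.measurable hA)]
  have hsub : A ∩ G '' B ⊆ G '' (G ⁻¹' A ∩ B) := by
    rintro _ ⟨hx, h, hh, rfl⟩
    exact ⟨h, ⟨hx, hh⟩, rfl⟩
  refine (measure_mono hsub).trans ?_
  have := (hGl.lipschitzOnWith (s := G ⁻¹' A ∩ B)).hausdorffMeasure_image_le
    (d := ((d - 1 : ℕ) : ℝ)) (by positivity)
  rw [Measure.euclideanHausdorffMeasure_def, Measure.euclideanHausdorffMeasure_def,
    Measure.smul_apply, Measure.smul_apply]
  simp only [ENNReal.smul_def, smul_eq_mul]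
  calc _ ≤ _ := mul_le_mul_right this _
    _ = _ := by ring

/-- The fundamental theorem of calculus in direction `e`, integrated over a graph. -/
lemma lintegral_graph_le {e : E d} (he : ‖e‖ = 1) {γ : hyp e → ℝ} (hγ : Continuous γ)
    {Ω : Set (E d)} (hΩ : IsOpen Ω) {c : ENNReal}
    (hmp : MeasurePreserving (fun p : hyp e × ℝ => (p.1 : E d) + (γ p.1 + p.2) • e)
      ((Measure.euclideanHausdorffMeasure (d - 1) : Measure (hyp e)).prod volume)
      (c • (volume : Measure (E d)))) {x₀ : hyp e} {r : ℝ}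
    (hmem : ∀ h ∈ Metric.ball x₀ r, ∀ t ∈ Ioo 0 r, (h : E d) + (γ h + t) • e ∈ Ω)
    {φ : E d → ℝ} (hφ : ContDiff ℝ ∞ φ) :
    (∫⁻ h in Metric.ball x₀ r, ‖φ ((h : E d) + γ h • e)‖ₑ
        ∂(Measure.euclideanHausdorffMeasure (d - 1))) * ENNReal.ofReal r ≤
      c * (1 + ENNReal.ofReal r) *
        ((∫⁻ x in Ω, ‖φ x‖ₑ) + ∫⁻ x in Ω, ‖fderiv ℝ φ x‖ₑ) := by
  have hH := isAddHaarMeasure_hyp he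
  have hφc := hφ.continuous
  have hdc : Continuous (fderiv ℝ φ) := hφ.continuous_fderiv (by simp)
  set ν : Measure (hyp e) := Measure.euclideanHausdorffMeasure (d - 1) with hν
  set B : Set (hyp e) := Metric.ball x₀ r with hB
  set G : hyp e → E d := fun h => (h : E d) + γ h • e with hG
  set Ψ : hyp e × ℝ → E d := fun p => (p.1 : E d) + (γ p.1 + p.2) • e with hΨ
  have hΨc : Continuous Ψ := by fun_prop
  -- This is the integrand of the one-dimensional estimate on a fibre. Tonelli collects the fibres
  -- into a slab that the shear carries into `Ω`.
  set f : E d → ENNReal := fun x => ‖φ x‖ₑ + ENNReal.ofReal r * ‖fderiv ℝ φ x‖ₑ with hf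
  have hfm : Measurable f :=
    hφc.measurable.enorm.add ((hdc.measurable.enorm).const_mul _)
  have step : ∀ h ∈ B, ‖φ (G h)‖ₑ * ENNReal.ofReal r ≤ ∫⁻ t in Ioo 0 r, f (Ψ (h, t)) := by
    intro h _
    have hF : ∀ t, HasDerivAt (fun t => φ (Ψ (h, t))) (fderiv ℝ φ (Ψ (h, t)) e) t := by
      intro t
      have h1 : HasDerivAt (fun t => Ψ (h, t)) e t := by
        have h2 : HasDerivAt (fun t : ℝ => (h : E d) + (γ h + t) • e) ((1 : ℝ) • e) t :=
          (((hasDerivAt_id t).const_add (γ h)).smul_const e).const_add _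
        rwa [one_smul] at h2
      exact ((hφ.differentiable (by simp) (Ψ (h, t))).hasFDerivAt).comp_hasDerivAt t h1
    have hΨt : Continuous fun t : ℝ => Ψ (h, t) := by fun_prop
    have hF' : Continuous fun t => fderiv ℝ φ (Ψ (h, t)) e :=
      (hdc.comp hΨt).clm_apply continuous_const
    have h3 := enorm_le_lintegral_of_contDiff hF hF' r
    have h4 : φ (Ψ (h, 0)) = φ (G h) := by simp [hΨ, hG]
    rw [h4] at h3
    refine h3.trans ?_
    rw [mul_comm, ← lintegral_const_mul' _ _ ENNReal.ofReal_ne_top,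
      ← lintegral_add_left (f := fun t => ‖φ (Ψ (h, t))‖ₑ) (hφc.comp hΨt).measurable.enorm]
    refine lintegral_mono fun t => ?_
    simp only [hf]
    gcongr
    rw [enorm_le_iff_norm_le]
    simpa [he] using (fderiv ℝ φ (Ψ (h, t))).le_opNorm e
  have hset : B ×ˢ Ioo 0 r ⊆ Ψ ⁻¹' Ω := fun p hp => hmem p.1 hp.1 p.2 hp.2
  calc (∫⁻ h in B, ‖φ (G h)‖ₑ ∂ν) * ENNReal.ofReal r
      = ∫⁻ h in B, ‖φ (G h)‖ₑ * ENNReal.ofReal r ∂ν :=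
        (lintegral_mul_const' _ _ ENNReal.ofReal_ne_top).symm
    _ ≤ ∫⁻ h in B, (∫⁻ t in Ioo 0 r, f (Ψ (h, t))) ∂ν :=
        setLIntegral_mono' Metric.isOpen_ball.measurableSet step
    _ = ∫⁻ p in B ×ˢ Ioo 0 r, f (Ψ p) ∂(ν.prod volume) := by
        rw [← Measure.prod_restrict, lintegral_prod]
        exact (hfm.comp hΨc.measurable).aemeasurable
    _ ≤ ∫⁻ p in Ψ ⁻¹' Ω, f (Ψ p) ∂(ν.prod volume) := lintegral_mono_set hset
    _ = ∫⁻ x in Ω, f x ∂(c • (volume : Measure (E d))) :=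
        hmp.setLIntegral_comp_preimage hΩ.measurableSet hfm
    _ = c * ((∫⁻ x in Ω, ‖φ x‖ₑ) + ENNReal.ofReal r * ∫⁻ x in Ω, ‖fderiv ℝ φ x‖ₑ) := by
        rw [Measure.restrict_smul, lintegral_smul_measure, smul_eq_mul,
          lintegral_add_left hφc.measurable.enorm,
          lintegral_const_mul' _ _ ENNReal.ofReal_ne_top]
    _ ≤ _ := by
        rw [mul_assoc]
        gcongr
        rw [add_mul, one_mul, mul_add]
        calc _ ≤ (∫⁻ x in Ω, ‖φ x‖ₑ) + (∫⁻ x in Ω, ‖fderiv ℝ φ x‖ₑ) +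
              (ENNReal.ofReal r * (∫⁻ x in Ω, ‖φ x‖ₑ) +
                ENNReal.ofReal r * ∫⁻ x in Ω, ‖fderiv ℝ φ x‖ₑ) := by
              exact add_le_add le_self_add le_add_self
          _ = _ := rfl

/-- In a Lipschitz chart the boundary points lie on the graph. -/
lemma graph_proj_eq {Ω : Set (E d)} (hΩ : IsOpen Ω) {e : E d} (he : ‖e‖ = 1) {γ : hyp e → ℝ}
    (hγ : Continuous γ) {U : Set (E d)} (hU : IsOpen U)
    (hUΩ : ∀ y ∈ U, y ∈ Ω ↔ γ (proj e y) < inner ℝ e y) {y : E d} (hyU : y ∈ U)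
    (hy : y ∈ frontier Ω) : (proj e y : E d) + γ (proj e y) • e = y := by
  have hle : inner ℝ e y ≤ γ (proj e y) := by
    by_contra hlt
    have : y ∈ Ω := (hUΩ y hyU).2 (not_le.1 hlt)
    rw [hΩ.frontier_eq] at hy
    exact hy.2 this
  have hge : γ (proj e y) ≤ inner ℝ e y := by
    by_contra hlt
    rw [not_le] at hlt
    have hopen : IsOpen {x | inner ℝ e x < γ (proj e x)} :=
      isOpen_lt (by fun_prop) (hγ.comp (proj e).continuous)
    have hycl : y ∈ closure Ω := frontier_subset_closure hy
    obtain ⟨x, ⟨hxU', hx1⟩, hx2⟩ := mem_closure_iff.1 hycl _ (hU.inter hopen) ⟨hyU, hlt⟩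
    have := (hUΩ x hxU').1 hx2
    exact absurd this (not_lt.2 (le_of_lt hx1))
  rw [le_antisymm hge hle]
  exact proj_add_inner he y

/-- The local trace inequality. -/
theorem exists_local_trace_inequality {Ω : Set (E d)} (hΩ : IsOpen Ω)
    (hL : HasLipschitzBoundary Ω) {x₀ : E d} (hx₀ : x₀ ∈ frontier Ω) :
    ∃ V : Set (E d), IsOpen V ∧ x₀ ∈ V ∧ surf Ω V < ⊤ ∧ ∃ C : ENNReal, C ≠ ⊤ ∧
      ∀ φ : E d → ℝ, ContDiff ℝ ∞ φ → ∫⁻ x in V, ‖φ x‖ₑ ∂(surf Ω) ≤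
        C * ((∫⁻ x in Ω, ‖φ x‖ₑ) + ∫⁻ x in Ω, ‖fderiv ℝ φ x‖ₑ) := by
  obtain ⟨e, L, γ, U, he, hγ, hU, hxU, hUΩ⟩ := hL x₀ hx₀
  have hH := isAddHaarMeasure_hyp he
  set G : hyp e → E d := fun h => (h : E d) + γ h • e with hG
  set Ψ : hyp e × ℝ → E d := fun p => (p.1 : E d) + (γ p.1 + p.2) • e with hΨ
  have hγc := hγ.continuous
  have hGc : Continuous G := by fun_prop
  have hΨc : Continuous Ψ := by fun_prop
  have hgraph : ∀ y ∈ U, y ∈ frontier Ω → G (proj e y) = y := fun y hyU hy =>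
    graph_proj_eq hΩ he hγc hU hUΩ hyU hy
  have hΨ0 : Ψ (proj e x₀, 0) = x₀ := by
    have := hgraph x₀ hxU hx₀
    simpa [hΨ, hG] using this
  have hnhds : Ψ ⁻¹' U ∈ 𝓝 (proj e x₀, (0 : ℝ)) :=
    hΨc.continuousAt.preimage_mem_nhds (by rw [hΨ0]; exact hU.mem_nhds hxU)
  obtain ⟨r, hr, hball⟩ := Metric.mem_nhds_iff.1 hnhds
  set B : Set (hyp e) := Metric.ball (proj e x₀) r with hB
  have hmem : ∀ h ∈ B, ∀ t ∈ Ioo 0 r, Ψ (h, t) ∈ Ω := by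
    intro h hh t ht
    have h1 : Ψ (h, t) ∈ U := hball (by
      rw [← ball_prod_same]
      refine ⟨hh, ?_⟩
      rw [Metric.mem_ball, Real.dist_eq, sub_zero, abs_of_pos ht.1]
      exact ht.2)
    refine (hUΩ _ h1).2 ?_
    have e1 : proj e (Ψ (h, t)) = h := proj_hyp_add _ _
    have e2 : inner ℝ e (Ψ (h, t)) = γ h + t := inner_hyp_add he _ _
    change γ (proj e (Ψ (h, t))) < _
    rw [e1, e2]
    linarith [ht.1]
  -- Restricting to points that project into `B` places the boundary inside `V` on the graph over
  -- `B`.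
  set V : Set (E d) := U ∩ proj e ⁻¹' B with hV
  have hVo : IsOpen V := hU.inter (Metric.isOpen_ball.preimage (proj e).continuous)
  have hVsub : V ∩ frontier Ω ⊆ G '' B := fun y hy => ⟨proj e y, hy.1.2, hgraph y hy.1.1 hy.2⟩
  obtain ⟨C, hC, hCle⟩ := exists_restrict_graph_le he hγ B
  obtain ⟨c, hc, hmp⟩ := exists_map_shear he hγc
  set ν : Measure (hyp e) := Measure.euclideanHausdorffMeasure (d - 1) with hν
  have hsurf : (surf Ω).restrict V ≤ C • (ν.restrict B).map G := by
    rw [Measure.restrict_restrict hVo.measurableSet]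
    exact (Measure.restrict_mono hVsub le_rfl).trans hCle
  have hνB : ν B < ⊤ := measure_ball_lt_top
  have hfin : surf Ω V < ⊤ := by
    have h1 : (surf Ω).restrict V univ ≤ (C • (ν.restrict B).map G) univ :=
      Measure.le_iff'.1 hsurf univ
    rw [Measure.restrict_apply_univ, Measure.smul_apply,
      Measure.map_apply hGc.measurable MeasurableSet.univ, preimage_univ,
      Measure.restrict_apply_univ, smul_eq_mul] at h1
    exact h1.trans_lt (ENNReal.mul_lt_top hC.lt_top hνB)
  have hxV : x₀ ∈ V :=
    mem_inter hxU (mem_preimage.2 (Metric.mem_ball_self (x := proj e x₀) hr))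
  -- `C` compares surface and base measure, `c` is the Jacobian of the shear, and `r⁻¹` undoes the
  -- averaging over height `r`.
  refine ⟨V, hVo, hxV, hfin, C * (ENNReal.ofReal r)⁻¹ * c *
    (1 + ENNReal.ofReal r), ?_, fun φ hφ => ?_⟩
  · have : (ENNReal.ofReal r)⁻¹ ≠ ⊤ := by
      simpa using hr
    finiteness
  have hφc := hφ.continuous
  have hr0 : ENNReal.ofReal r ≠ 0 := by simpa using hr
  have hintg := lintegral_graph_le he hγc hΩ hmp hmem hφ
  calc ∫⁻ x in V, ‖φ x‖ₑ ∂(surf Ω) ≤ ∫⁻ x, ‖φ x‖ₑ ∂(C • (ν.restrict B).map G) :=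
        lintegral_mono' hsurf le_rfl
    _ = C * ∫⁻ h in B, ‖φ (G h)‖ₑ ∂ν := by
        rw [lintegral_smul_measure, smul_eq_mul, lintegral_map hφc.measurable.enorm hGc.measurable]
    _ = C * (ENNReal.ofReal r)⁻¹ * ((∫⁻ h in B, ‖φ (G h)‖ₑ ∂ν) * ENNReal.ofReal r) := by
        rw [mul_comm (∫⁻ h in B, ‖φ (G h)‖ₑ ∂ν), ← mul_assoc, mul_assoc C,
          ENNReal.inv_mul_cancel hr0 ENNReal.ofReal_ne_top, mul_one]
    _ ≤ C * (ENNReal.ofReal r)⁻¹ * (c * (1 + ENNReal.ofReal r) *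
          ((∫⁻ x in Ω, ‖φ x‖ₑ) + ∫⁻ x in Ω, ‖fderiv ℝ φ x‖ₑ)) := by gcongr
    _ = _ := by ring

/-- The boundary is compact and each chart carries finite surface measure. Finiteness gives the
embeddings of `L²(∂Ω)` into `L¹` and of `L^∞` into `L²`. -/
theorem isFiniteMeasure_surf {Ω : Set (E d)} (hΩ : IsOpen Ω) (hb : Bornology.IsBounded Ω)
    (hL : HasLipschitzBoundary Ω) : IsFiniteMeasure (surf Ω) := by
  have hc : IsCompact (frontier Ω) :=
    hb.isCompact_closure.of_isClosed_subset isClosed_frontier frontier_subset_closure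
  have h := hc.measure_lt_top_of_nhdsWithin (μ := surf Ω) fun x hx => by
    obtain ⟨V, hV, hxV, hfin, -⟩ := exists_local_trace_inequality hΩ hL hx
    exact ⟨V, mem_nhdsWithin_of_mem_nhds (hV.mem_nhds hxV), hfin⟩
  refine ⟨?_⟩
  rwa [Measure.restrict_apply_self, ← Measure.restrict_apply_univ] at h

/-- The trace operator is closable. -/
theorem eq_zero_of_isTrace_zero {Ω : Set (E d)} (hΩ : IsOpen Ω) (hb : Bornology.IsBounded Ω)
    (hL : HasLipschitzBoundary Ω) {τ : Lp ℝ 2 (surf Ω)} (h : IsTrace Ω 0 τ) : τ = 0 := by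
  have := isFiniteMeasure_surf hΩ hb hL
  have hvf : IsFiniteMeasure (vol Ω) := ⟨by
    rw [Measure.restrict_apply_univ]
    exact hb.measure_lt_top⟩
  obtain ⟨p, hp, hlim⟩ := mem_closure_iff_seq_limit.1 h
  choose φ h1 h2 h3 h4 using hp
  have hp1 : Tendsto (fun k => (p k).1) atTop (𝓝 0) := (continuous_fst.tendsto _).comp hlim
  have hp2 : Tendsto (fun k => (p k).2) atTop (𝓝 τ) := (continuous_snd.tendsto _).comp hlim
  have hfn : Tendsto (fun k => fnOf (p k).1) atTop (𝓝 0) :=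
    (((WithLp.fstL 2 ℝ _ _).continuous.comp continuous_subtype_val).tendsto (0 : H1 Ω)).comp hp1
  have hgr : Tendsto (fun k => grad (p k).1) atTop (𝓝 0) :=
    (((WithLp.sndL 2 ℝ _ _).continuous.comp continuous_subtype_val).tendsto (0 : H1 Ω)).comp hp1
  -- `L²` convergence on a finite measure space implies convergence of the integrals of `‖·‖ₑ`
  have gen : ∀ {F : Type} [NormedAddCommGroup F] (μ : Measure (E d)) [IsFiniteMeasure μ]
      (f : ℕ → Lp F 2 μ) (g : Lp F 2 μ), Tendsto f atTop (𝓝 g) →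
      Tendsto (fun k => ∫⁻ x, ‖f k x - g x‖ₑ ∂μ) atTop (𝓝 0) := by
    intro F _ μ _ f g hfg
    rw [Lp.tendsto_Lp_iff_tendsto_eLpNorm'] at hfg
    have hK : μ univ ^ (1 / (1 : ENNReal).toReal - 1 / (2 : ENNReal).toReal) ≠ ⊤ :=
      ENNReal.rpow_ne_top_of_nonneg (by norm_num) (measure_ne_top μ _)
    have h5 := ENNReal.Tendsto.mul_const hfg (Or.inr hK)
    rw [zero_mul] at h5
    refine tendsto_of_tendsto_of_tendsto_of_le_of_le tendsto_const_nhds h5 (fun _ => zero_le)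
      fun k => ?_
    have h6 := eLpNorm_le_eLpNorm_mul_rpow_measure_univ (p := 1) (q := 2) one_le_two
      ((Lp.aestronglyMeasurable (f k)).sub (Lp.aestronglyMeasurable g))
    rwa [eLpNorm_one_eq_lintegral_enorm] at h6
  have g1 : Tendsto (fun k => ∫⁻ x in Ω, ‖φ k x‖ₑ) atTop (𝓝 0) := by
    refine (gen (vol Ω) _ _ hfn).congr fun k => lintegral_congr_ae ?_
    filter_upwards [h3 k, Lp.coeFn_zero ℝ 2 (vol Ω)] with x e1 e2
    rw [e1, e2]
    simp
  have g2 : Tendsto (fun k => ∫⁻ x in Ω, ‖fderiv ℝ (φ k) x‖ₑ) atTop (𝓝 0) := by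
    refine (gen (vol Ω) _ _ hgr).congr fun k => lintegral_congr_ae ?_
    have := grad_ofSmooth Ω (h1 k) (h2 k)
    rw [← eq_ofSmooth hΩ (h1 k) (h2 k) (h3 k)] at this
    filter_upwards [this, Lp.coeFn_zero (E d) 2 (vol Ω)] with x e1 e2
    rw [e1, e2, Pi.zero_apply, sub_zero, ← ofReal_norm, norm_gradient_eq,
      ofReal_norm]
  have g3 := gen (surf Ω) _ _ hp2
  -- Vanishing almost everywhere is a local property, so the constants of the trace inequality need
  -- not be uniform over the boundary.
  have hzero : surf Ω {x | x ∈ frontier Ω ∧ τ x ≠ 0} = 0 := by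
    refine measure_null_of_locally_null _ ?_
    rintro x ⟨hx, -⟩
    obtain ⟨V, hV, hxV, -, C, hC, hCle⟩ := exists_local_trace_inequality hΩ hL hx
    refine ⟨V ∩ {x | τ x ≠ 0}, ?_, ?_⟩
    · refine mem_nhdsWithin.2 ⟨V, hV, hxV, ?_⟩
      rintro y ⟨hy1, -, hy2⟩
      exact ⟨hy1, hy2⟩
    have hτ0 : ∫⁻ x in V, ‖τ x‖ₑ ∂(surf Ω) = 0 := by
      have hbound : ∀ k, ∫⁻ x in V, ‖τ x‖ₑ ∂(surf Ω) ≤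
          C * ((∫⁻ x in Ω, ‖φ k x‖ₑ) + ∫⁻ x in Ω, ‖fderiv ℝ (φ k) x‖ₑ) +
            ∫⁻ x, ‖(p k).2 x - τ x‖ₑ ∂(surf Ω) := by
        intro k
        have : ∀ᵐ x ∂((surf Ω).restrict V), ‖τ x‖ₑ ≤ ‖φ k x‖ₑ + ‖(p k).2 x - τ x‖ₑ := by
          filter_upwards [ae_restrict_of_ae (h4 k)] with x hx
          rw [hx]
          calc ‖τ x‖ₑ = ‖φ k x - (φ k x - τ x)‖ₑ := by ring_nf
            _ ≤ _ := enorm_sub_le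
        refine (lintegral_mono_ae this).trans ?_
        rw [lintegral_add_left (h1 k).continuous.measurable.enorm]
        exact add_le_add (hCle _ (h1 k)) (setLIntegral_le_lintegral _ _)
      have hlim0 := (ENNReal.Tendsto.const_mul (g1.add g2) (Or.inr hC)).add g3
      simp only [add_zero, mul_zero] at hlim0
      exact le_antisymm (ge_of_tendsto' hlim0 hbound) zero_le
    rw [lintegral_eq_zero_iff' (Lp.aestronglyMeasurable τ).restrict.enorm] at hτ0
    have := ae_iff.1 hτ0
    rw [Measure.restrict_apply₀' hV.measurableSet.nullMeasurableSet] at this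
    refine measure_mono_null ?_ this
    rintro y ⟨hy1, hy2⟩
    exact ⟨by simpa using hy2, hy1⟩
  refine Lp.ext ?_
  filter_upwards [Lp.coeFn_zero ℝ 2 (surf Ω), measure_eq_zero_iff_ae_notMem.1 hzero,
    ae_restrict_mem (measurableSet_frontier' Ω)] with x e1 e2 e3
  rw [e1]
  by_contra hne
  exact e2 ⟨e3, hne⟩

theorem IsTrace.unique {Ω : Set (E d)} (hΩ : IsOpen Ω) (hb : Bornology.IsBounded Ω)
    (hL : HasLipschitzBoundary Ω) {v : H1 Ω} {τ ρ : Lp ℝ 2 (surf Ω)} (h : IsTrace Ω v τ)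
    (h' : IsTrace Ω v ρ) : τ = ρ := by
  rw [← sub_eq_zero]
  refine eq_zero_of_isTrace_zero hΩ hb hL ?_
  have := Submodule.sub_mem _ h h'
  simpa [IsTrace] using this

theorem IsTrace.trace_eq {Ω : Set (E d)} (hΩ : IsOpen Ω) (hb : Bornology.IsBounded Ω)
    (hL : HasLipschitzBoundary Ω) {v : H1 Ω} {τ : Lp ℝ 2 (surf Ω)} (h : IsTrace Ω v τ) :
    trace v = τ := by
  have hex : ∃ τ, IsTrace Ω v τ := ⟨τ, h⟩
  unfold trace
  rw [dif_pos hex]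
  exact IsTrace.unique hΩ hb hL hex.choose_spec h

/-! ### Sets of codimension two -/

/-- An affine subspace of codimension two, given as the common zero set of two coordinates with
respect to an orthonormal basis. -/
def IsRidge (F : Set (E d)) : Prop :=
  ∃ (b : OrthonormalBasis (Fin d) ℝ (E d)) (i j : Fin d) (c : E d), i ≠ j ∧
    F = {x | inner ℝ (b i) (x - c) = 0 ∧ inner ℝ (b j) (x - c) = 0}

lemma card_univ_sdiff_pair {i j : Fin d} (h : i ≠ j) :
    (Finset.univ \ {i, j} : Finset (Fin d)).card = d - 2 := by
  rw [Finset.card_sdiff_of_subset (Finset.subset_univ _), Finset.card_pair h, Finset.card_univ,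
    Fintype.card_fin]

lemma two_le_of_ne {i j : Fin d} (h : i ≠ j) : 2 ≤ d := by
  have := i.2
  have := j.2
  have : (i : ℕ) ≠ j := fun h' => h (Fin.ext h')
  omega

theorem IsRidge.euclideanHausdorffMeasure_eq_zero {F : Set (E d)} (hF : IsRidge F) :
    Measure.euclideanHausdorffMeasure (d - 1) F = 0 := by
  obtain ⟨b, i, j, c, hij, rfl⟩ := hF
  have hd := two_le_of_ne hij
  let N : Submodule ℝ (E d) :=
    Submodule.span ℝ ((Finset.univ \ {i, j} : Finset (Fin d)).image b : Finset (E d))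
  have hN : Module.finrank ℝ N ≤ d - 2 := by
    refine (finrank_span_finset_le_card _).trans (Finset.card_image_le.trans ?_)
    rw [card_univ_sdiff_pair hij]
  have hsub : {x | inner ℝ (b i) (x - c) = 0 ∧ inner ℝ (b j) (x - c) = 0} ⊆
      (fun n : N => c + (n : E d)) '' univ := by
    rintro x ⟨h1, h2⟩
    have hx : x - c ∈ N := by
      rw [← b.sum_repr' (x - c)]
      refine Submodule.sum_mem _ fun l _ => ?_
      by_cases hl : l = i ∨ l = j
      · rcases hl with rfl | rfl
        · rw [h1, zero_smul]; exact Submodule.zero_mem _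
        · rw [h2, zero_smul]; exact Submodule.zero_mem _
      · refine Submodule.smul_mem _ _ (Submodule.subset_span ?_)
        rw [Finset.coe_image]
        refine ⟨l, ?_, rfl⟩
        simpa using hl
    exact ⟨⟨x - c, hx⟩, mem_univ _, by simp⟩
  have hiso : Isometry fun n : N => c + (n : E d) :=
    (isometry_add_left c).comp isometry_subtype_coe
  have hdim : dimH {x | inner ℝ (b i) (x - c) = 0 ∧ inner ℝ (b j) (x - c) = 0} <
      ((d - 1 : ℕ) : NNReal) := by
    refine (dimH_mono hsub).trans_lt ?_
    rw [hiso.dimH_image, Real.dimH_univ_eq_finrank]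
    have : Module.finrank ℝ N < d - 1 := by omega
    exact_mod_cast this
  have h0 := hausdorffMeasure_of_dimH_lt hdim
  rw [NNReal.coe_natCast] at h0
  rw [Measure.euclideanHausdorffMeasure_def, Measure.smul_apply, h0, smul_zero]

lemma IsRidge.surf_eq_zero {F : Set (E d)} (hF : IsRidge F) (Ω : Set (E d)) : surf Ω F = 0 :=
  le_antisymm ((Measure.restrict_le_self F).trans hF.euclideanHausdorffMeasure_eq_zero.le) zero_le

/-- The volume of a neighbourhood of a set of codimension two. -/
lemma exists_volume_slab_le (b : OrthonormalBasis (Fin d) ℝ (E d)) {i j : Fin d} (hij : i ≠ j)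
    (c : E d) {Ω : Set (E d)} (hb : Bornology.IsBounded Ω) :
    ∃ C : ENNReal, C ≠ ⊤ ∧ ∀ t : ℝ, 0 < t →
      volume ({x | |inner ℝ (b i) (x - c)| ≤ t ∧ |inner ℝ (b j) (x - c)| ≤ t} ∩ Ω) ≤
        C * ENNReal.ofReal t ^ 2 := by
  obtain ⟨R, hR⟩ := hb.subset_closedBall c
  -- In the coordinates of `b` the set lies in a box with two sides `2t` and `d - 2` sides `2R`.
  refine ⟨4 * ENNReal.ofReal (2 * R) ^ (d - 2), by finiteness, fun t ht => ?_⟩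
  let T : E d → Fin d → ℝ := fun x => WithLp.ofLp (b.repr x)
  have hT : MeasurePreserving T volume volume :=
    (PiLp.volume_preserving_ofLp (Fin d)).comp b.measurePreserving_repr
  let r : Fin d → ℝ := fun l => if l = i ∨ l = j then t else R
  let Q : Set (Fin d → ℝ) :=
    univ.pi fun l => Icc (inner ℝ (b l) c - r l) (inner ℝ (b l) c + r l)
  have hQ : MeasurableSet Q := MeasurableSet.univ_pi fun l => measurableSet_Icc
  have hsub : {x | |inner ℝ (b i) (x - c)| ≤ t ∧ |inner ℝ (b j) (x - c)| ≤ t} ∩ Ω ⊆ T ⁻¹' Q := by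
    rintro x ⟨⟨h1, h2⟩, hx⟩ l -
    have key : |inner ℝ (b l) (x - c)| ≤ r l := by
      by_cases hl : l = i ∨ l = j
      · simp only [r, if_pos hl]
        rcases hl with rfl | rfl
        · exact h1
        · exact h2
      · simp only [r, if_neg hl]
        have h3 := abs_real_inner_le_norm (b l) (x - c)
        rw [b.norm_eq_one, one_mul] at h3
        have h4 := hR hx
        rw [Metric.mem_closedBall, dist_eq_norm] at h4
        exact h3.trans h4
    have e : T x l = inner ℝ (b l) x := b.repr_apply_apply x l
    rw [inner_sub_right, abs_le] at key
    rw [e]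
    constructor <;> linarith [key.1, key.2]
  refine (measure_mono hsub).trans ?_
  rw [hT.measure_preimage hQ.nullMeasurableSet, volume_pi, Measure.pi_pi]
  have hv : ∀ l, volume (Icc (inner ℝ (b l) c - r l) (inner ℝ (b l) c + r l)) =
      if l = i ∨ l = j then ENNReal.ofReal (2 * t) else ENNReal.ofReal (2 * R) := by
    intro l
    rw [Real.volume_Icc]
    by_cases hl : l = i ∨ l = j
    · simp only [r, if_pos hl]
      congr 1
      ring
    · simp only [r, if_neg hl]
      congr 1
      ring
  simp_rw [hv]
  rw [Finset.prod_ite, Finset.prod_const, Finset.prod_const]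
  have c1 : (Finset.univ.filter fun l => l = i ∨ l = j).card = 2 := by
    rw [← Finset.card_pair hij]
    congr 1
    ext l
    simp
  have c2 : (Finset.univ.filter fun l => ¬(l = i ∨ l = j)).card = d - 2 := by
    rw [← card_univ_sdiff_pair hij]
    congr 1
    ext l
    simp
  rw [c1, c2, ENNReal.ofReal_mul (by norm_num : (0 : ℝ) ≤ 2), mul_pow]
  have : ENNReal.ofReal 2 ^ 2 = 4 := by
    rw [← ENNReal.ofReal_pow (by norm_num)]
    norm_num
  rw [this]
  exact le_of_eq (by ring)

/-- Cut-off functions vanishing near a set of codimension two, bounded in `H¹`. -/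
theorem IsRidge.exists_cutoff {F : Set (E d)} (hF : IsRidge F) {Ω : Set (E d)}
    (hb : Bornology.IsBounded Ω) :
    ∃ (R : ℝ) (χ : ℕ → E d → ℝ), (∀ n, ContDiff ℝ ∞ (χ n)) ∧ (∀ n x, |χ n x| ≤ 1) ∧
      (∀ n, ∃ O, IsOpen O ∧ F ⊆ O ∧ ∀ x ∈ O, χ n x = 0) ∧
      (∀ x, x ∉ F → Tendsto (fun n => χ n x) atTop (𝓝 1)) ∧
      ∀ n, eLpNorm (gradient (χ n)) 2 (vol Ω) ≤ ENNReal.ofReal R := by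
  obtain ⟨b, i, j, c, hij, rfl⟩ := hF
  obtain ⟨C, hC, hvol⟩ := exists_volume_slab_le b hij c hb
  -- The bump is rescaled to width `t` in the two normal directions: its gradient is `O(1/t)` on a
  -- slab of volume `O(t²)`, so the `L²` norm stays bounded. It need not tend to zero, since weak
  -- convergence suffices later.
  let β : ContDiffBump (0 : ℝ × ℝ) := ⟨1, 2, one_pos, one_lt_two⟩
  let P : E d →L[ℝ] ℝ × ℝ := (innerSL ℝ (b i)).prod (innerSL ℝ (b j))
  have hP : ∀ x, P x = (inner ℝ (b i) x, inner ℝ (b j) x) := fun x => rfl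
  have hβs : ContDiff ℝ ∞ β := β.contDiff
  have hβd : Continuous (fderiv ℝ β) := hβs.continuous_fderiv (by simp)
  obtain ⟨K, hK⟩ := hβd.bounded_above_of_compact_support (β.hasCompactSupport.fderiv ℝ)
  have hK0 : 0 ≤ K := (norm_nonneg _).trans (hK 0)
  let t : ℕ → ℝ := fun n => 1 / ((n : ℝ) + 1)
  have ht : ∀ n, 0 < t n := fun n => by positivity
  have htl : Tendsto t atTop (𝓝 0) := tendsto_one_div_add_atTop_nhds_zero_nat
  let A : ℕ → E d → ℝ × ℝ := fun n x => (t n)⁻¹ • P (x - c)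
  let χ : ℕ → E d → ℝ := fun n x => 1 - β (A n x)
  have hA : ∀ n, ContDiff ℝ ∞ (A n) := fun n =>
    (P.contDiff.comp (contDiff_id.sub contDiff_const)).const_smul _
  have hAnorm : ∀ n x, ‖A n x‖ = (t n)⁻¹ * ‖P (x - c)‖ := by
    intro n x
    rw [norm_smul, Real.norm_of_nonneg (inv_nonneg.2 (ht n).le)]
  have hχ : ∀ n, ContDiff ℝ ∞ (χ n) := fun n => contDiff_const.sub (hβs.comp (hA n))
  have hPF : ∀ x, P (x - c) = 0 ↔ inner ℝ (b i) (x - c) = 0 ∧ inner ℝ (b j) (x - c) = 0 := by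
    intro x
    rw [hP, Prod.mk_eq_zero]
  have hder : ∀ n x, fderiv ℝ (χ n) x = -((fderiv ℝ β (A n x)).comp ((t n)⁻¹ • P)) := by
    intro n x
    have h1 : HasFDerivAt (A n) ((t n)⁻¹ • P) x := by
      have : HasFDerivAt (fun x => P (x - c)) P x :=
        (P.hasFDerivAt.comp x ((hasFDerivAt_id x).sub_const c))
      exact this.const_smul (t n)⁻¹
    have h2 : HasFDerivAt β (fderiv ℝ β (A n x)) (A n x) :=
      (hβs.differentiable (by simp) _).hasFDerivAt
    exact ((h2.comp x h1).const_sub 1).fderiv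
  -- The gradient is at most `K‖P‖/t` on the slab of half-width `2t`, whose volume is at most
  -- `4Ct²`; the powers of `t` cancel.
  refine ⟨(ENNReal.ofReal (K * ‖P‖) * (C * 4) ^ (1 / 2 : ℝ)).toReal, χ, hχ, ?_, ?_, ?_, ?_⟩
  · intro n x
    have h1 := β.nonneg' (A n x)
    have h2 : β (A n x) ≤ 1 := β.le_one
    simp only [χ]
    rw [abs_le]
    constructor <;> linarith
  · intro n
    refine ⟨{x | ‖A n x‖ < 1}, isOpen_lt (hA n).continuous.norm continuous_const, ?_, ?_⟩
    · intro x hx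
      change ‖A n x‖ < 1
      rw [hAnorm, (hPF x).2 hx]
      simp
    · intro x hx
      have : β (A n x) = 1 := β.one_of_mem_closedBall (by
        rw [mem_closedBall_zero_iff]
        exact le_of_lt hx)
      simp [χ, this]
  · intro x hx
    have hpos : 0 < ‖P (x - c)‖ := norm_pos_iff.2 fun h => hx ((hPF x).1 h)
    have hev : ∀ᶠ n in atTop, t n < ‖P (x - c)‖ / 2 :=
      htl.eventually (gt_mem_nhds (half_pos hpos))
    refine tendsto_const_nhds.congr' ?_
    filter_upwards [hev] with n hn
    have : β (A n x) = 0 := β.zero_of_le_dist (by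
      rw [dist_zero_right, hAnorm, inv_mul_eq_div, le_div_iff₀ (ht n)]
      change 2 * t n ≤ _
      linarith)
    simp [χ, this]
  · intro n
    let S : Set (E d) :=
      {x | |inner ℝ (b i) (x - c)| ≤ 2 * t n ∧ |inner ℝ (b j) (x - c)| ≤ 2 * t n}
    have hS : MeasurableSet S := by
      have h1 : ∀ l, IsClosed {x | |inner ℝ (b l) (x - c)| ≤ 2 * t n} := fun l =>
        isClosed_le (by fun_prop) continuous_const
      exact ((h1 i).inter (h1 j)).measurableSet
    have hpt : ∀ x, ‖gradient (χ n) x‖ₑ ≤ ‖S.indicator (fun _ => K * ‖P‖ * (t n)⁻¹) x‖ₑ := by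
      intro x
      rw [enorm_le_iff_norm_le, norm_gradient_eq, hder, norm_neg]
      by_cases hx : x ∈ S
      · rw [indicator_of_mem hx, Real.norm_of_nonneg (by have := ht n; positivity)]
        refine (ContinuousLinearMap.opNorm_comp_le _ _).trans ?_
        rw [norm_smul, Real.norm_of_nonneg (inv_nonneg.2 (ht n).le)]
        calc _ ≤ K * ((t n)⁻¹ * ‖P‖) := by
              have := ht n
              gcongr
              exact hK _
          _ = _ := by ring
      · have hz : fderiv ℝ β (A n x) = 0 := by
          refine image_eq_zero_of_notMem_tsupport fun hmem => hx ?_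
          have h1 := tsupport_fderiv_subset ℝ hmem
          rw [β.tsupport_eq, mem_closedBall_zero_iff, hAnorm, inv_mul_eq_div,
            div_le_iff₀ (ht n)] at h1
          change _ ≤ 2 * t n at h1
          rw [hP, Prod.norm_def, max_le_iff] at h1
          exact h1
        rw [hz]
        simp
    refine (eLpNorm_mono_enorm hpt).trans ?_
    rw [eLpNorm_indicator_const hS (by simp) (by simp), Measure.restrict_apply hS,
      ENNReal.ofReal_toReal (ENNReal.mul_ne_top ENNReal.ofReal_ne_top
        (ENNReal.rpow_ne_top_of_nonneg (by norm_num) (by finiteness)))]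
    have h2t : 0 < 2 * t n := by have := ht n; positivity
    have h3 : volume (S ∩ Ω) ^ (1 / (2 : ENNReal).toReal) ≤
        (C * 4) ^ (1 / 2 : ℝ) * ENNReal.ofReal (t n) := by
      have h4 : volume (S ∩ Ω) ≤ (C * 4) * ENNReal.ofReal (t n) ^ (2 : ℝ) := by
        refine (hvol _ h2t).trans (le_of_eq ?_)
        rw [ENNReal.ofReal_mul (by norm_num), mul_pow, mul_assoc, ENNReal.rpow_two]
        congr 2
        rw [← ENNReal.ofReal_pow (by norm_num)]
        norm_num
      have h5 : (1 / (2 : ENNReal).toReal) = (1 / 2 : ℝ) := by simp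
      rw [h5]
      refine (ENNReal.rpow_le_rpow h4 (by norm_num)).trans (le_of_eq ?_)
      rw [ENNReal.mul_rpow_of_nonneg _ _ (by norm_num), ← ENNReal.rpow_mul]
      norm_num
    have h6 : ‖K * ‖P‖ * (t n)⁻¹‖ₑ = ENNReal.ofReal (K * ‖P‖) * (ENNReal.ofReal (t n))⁻¹ := by
      rw [← ofReal_norm, Real.norm_of_nonneg (by have := ht n; positivity),
        ENNReal.ofReal_mul (by positivity), ENNReal.ofReal_inv_of_pos (ht n)]
    rw [h6]
    have h7 : ENNReal.ofReal (t n) ≠ 0 := by simpa using ht n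
    calc _ ≤ ENNReal.ofReal (K * ‖P‖) * (ENNReal.ofReal (t n))⁻¹ *
          ((C * 4) ^ (1 / 2 : ℝ) * ENNReal.ofReal (t n)) := by gcongr
      _ = ENNReal.ofReal (K * ‖P‖) * (C * 4) ^ (1 / 2 : ℝ) *
          ((ENNReal.ofReal (t n))⁻¹ * ENNReal.ofReal (t n)) := by ring
      _ = _ := by rw [ENNReal.inv_mul_cancel h7 ENNReal.ofReal_ne_top, mul_one]

/-! ### The interfaces between the boundary parts -/

/-- A subspace of codimension at least two is annihilated by two members of an orthonormal
basis. -/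
lemma exists_orthonormalBasis_of_finrank_le {W : Submodule ℝ (E d)}
    (hW : Module.finrank ℝ W + 2 ≤ d) :
    ∃ (b : OrthonormalBasis (Fin d) ℝ (E d)) (i j : Fin d), i ≠ j ∧
      ∀ x ∈ W, inner ℝ (b i) x = 0 ∧ inner ℝ (b j) x = 0 := by
  have h1 := Submodule.finrank_add_finrank_orthogonal W
  rw [finrank_euclideanSpace_fin] at h1
  let a := stdOrthonormalBasis ℝ Wᗮ
  have h2 : 2 ≤ Module.finrank ℝ Wᗮ := by omega
  let p : Fin (Module.finrank ℝ Wᗮ) := ⟨0, by omega⟩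
  let q : Fin (Module.finrank ℝ Wᗮ) := ⟨1, by omega⟩
  have hpq : p ≠ q := by simp [p, q]
  let i : Fin d := ⟨0, by omega⟩
  let j : Fin d := ⟨1, by omega⟩
  have hij : i ≠ j := by simp [i, j]
  -- Two orthonormal vectors of `Wᗮ` are placed at the indices `i` and `j`; the remaining values are
  -- irrelevant and are replaced by the extension.
  let v : Fin d → E d := fun l => if l = i then (a p : E d) else (a q : E d)
  have hvi : v i = a p := if_pos rfl
  have hvj : v j = a q := if_neg hij.symm
  have ho : Orthonormal ℝ (fun l => (a l : E d)) :=
    a.orthonormal.comp_linearIsometry Wᗮ.subtypeₗᵢ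
  have hv : Orthonormal ℝ (({i, j} : Set (Fin d)).domRestrict v) := by
    constructor
    · rintro ⟨l, hl⟩
      change ‖v l‖ = 1
      rcases hl with rfl | rfl
      · rw [hvi]; exact ho.1 p
      · rw [hvj]; exact ho.1 q
    · rintro ⟨l, hl⟩ ⟨l', hl'⟩ hne
      change inner ℝ (v l) (v l') = 0
      have hne' : l ≠ l' := fun h => hne (Subtype.ext h)
      rcases hl with rfl | rfl <;> rcases hl' with rfl | rfl
      · exact absurd rfl hne'
      · rw [hvi, hvj]; exact ho.2 hpq
      · rw [hvi, hvj]; exact ho.2 hpq.symm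
      · exact absurd rfl hne'
  obtain ⟨b, hb⟩ := hv.exists_orthonormalBasis_extension_of_card_eq (by simp)
  refine ⟨b, i, j, hij, fun x hx => ?_⟩
  rw [hb i (by simp), hb j (by simp), hvi, hvj]
  exact ⟨(Submodule.mem_orthogonal' W _).1 (a p).2 x hx,
    (Submodule.mem_orthogonal' W _).1 (a q).2 x hx⟩

/-- A face of positive codimension of a `(d-1)`-simplex lies in an affine subspace of codimension
two. -/
lemma exists_isRidge_face (hd : 2 ≤ d) (s : Affine.Simplex ℝ (E d) (d - 1)) (k : Fin (d - 1 + 1)) :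
    ∃ F : Set (E d), IsRidge F ∧ ∀ w : Fin (d - 1 + 1) → ℝ, ∑ l, w l = 1 → w k = 0 →
      Finset.univ.affineCombination ℝ s.points w ∈ F := by
  -- `l₀` serves as base vertex of the face opposite `k`, whose direction is then spanned by `d - 2`
  -- differences of vertices.
  obtain ⟨l₀, hl₀⟩ : ∃ l₀, l₀ ≠ k := by
    by_cases h : k = ⟨0, by omega⟩
    · exact ⟨⟨1, by omega⟩, by rw [h]; simp⟩
    · exact ⟨⟨0, by omega⟩, fun h' => h h'.symm⟩
  let W : Submodule ℝ (E d) := Submodule.span ℝ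
    (((Finset.univ \ {k, l₀} : Finset (Fin (d - 1 + 1))).image
      fun l => s.points l - s.points l₀ : Finset (E d)) : Set (E d))
  have hW : Module.finrank ℝ W ≤ d - 2 := by
    refine (finrank_span_finset_le_card _).trans (Finset.card_image_le.trans ?_)
    rw [Finset.card_sdiff_of_subset (Finset.subset_univ _), Finset.card_pair hl₀.symm,
      Finset.card_univ, Fintype.card_fin]
    omega
  obtain ⟨b, i, j, hij, hbW⟩ := exists_orthonormalBasis_of_finrank_le (W := W) (by omega)
  refine ⟨_, ⟨b, i, j, s.points l₀, hij, rfl⟩, fun w hw hk => hbW _ ?_⟩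
  rw [Finset.affineCombination_eq_linear_combination _ _ _ hw]
  have : ∑ l, w l • s.points l - s.points l₀ = ∑ l, w l • (s.points l - s.points l₀) := by
    simp_rw [smul_sub]
    rw [Finset.sum_sub_distrib, ← Finset.sum_smul, hw, one_smul]
  rw [this]
  refine Submodule.sum_mem _ fun l _ => ?_
  by_cases h1 : l = k
  · rw [h1, hk, zero_smul]; exact Submodule.zero_mem _
  by_cases h2 : l = l₀
  · rw [h2, sub_self, smul_zero]; exact Submodule.zero_mem _
  refine Submodule.smul_mem _ _ (Submodule.subset_span ?_)
  rw [Finset.coe_image]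
  exact ⟨l, by simp [h1, h2], rfl⟩

/-- The part of the boundary outside `Γ_I ∪ Γ_D ∪ Γ_N` has codimension two. -/
theorem Body.exists_ridges (B : Body d) :
    ∃ S : Set (Set (E d)), S.Finite ∧ (∀ F ∈ S, IsRidge F) ∧
      frontier B.Ω \ (B.ΓI ∪ B.ΓD ∪ B.ΓN) ⊆ ⋃₀ S := by
  obtain ⟨S, hS, hfr, hpart⟩ := B.sides
  -- A point of a side with all barycentric coordinates positive belongs to one of the parts, so an
  -- interface point has a vanishing coordinate.
  have hcase : ∀ x ∈ frontier B.Ω \ (B.ΓI ∪ B.ΓD ∪ B.ΓN), ∃ s ∈ S, ∃ w : Fin (d - 1 + 1) → ℝ,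
      ∑ l, w l = 1 ∧ (∃ k, w k = 0) ∧ Finset.univ.affineCombination ℝ s.points w = x := by
    rintro x ⟨hx, hxn⟩
    rw [hfr] at hx
    simp only [mem_iUnion] at hx
    obtain ⟨s, hs, hx⟩ := hx
    rw [Affine.Simplex.convexHull_eq_closedInterior] at hx
    obtain ⟨w, hw1, hw2, hw3⟩ := hx
    refine ⟨s, hs, w, hw1, ?_, hw3⟩
    by_contra hcon
    push Not at hcon
    have hin : x ∈ s.setInterior (Ioi 0) :=
      ⟨w, hw1, fun i => lt_of_le_of_ne (hw2 i).1 (hcon i).symm, hw3⟩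
    rcases hpart s hs with h | h | h
    · exact hxn (Or.inl (Or.inl (h hin)))
    · exact hxn (Or.inl (Or.inr (h hin)))
    · exact hxn (Or.inr (h hin))
  by_cases hd : 2 ≤ d
  · choose F hF1 hF2 using fun s k => exists_isRidge_face hd s k
    refine ⟨(fun p : Affine.Simplex ℝ (E d) (d - 1) × Fin (d - 1 + 1) => F p.1 p.2) ''
      (S ×ˢ univ), (hS.prod finite_univ).image _, ?_, ?_⟩
    · rintro _ ⟨p, -, rfl⟩
      exact hF1 _ _
    · intro x hx
      obtain ⟨s, hs, w, hw1, ⟨k, hk⟩, rfl⟩ := hcase x hx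
      exact ⟨F s k, ⟨(s, k), ⟨hs, mem_univ _⟩, rfl⟩, hF2 s k w hw1 hk⟩
  -- For `d ≤ 1` the sides are single points whose only barycentric coordinate is `1`, so no
  -- interface exists.
  · refine ⟨∅, finite_empty, by simp, fun x hx => ?_⟩
    obtain ⟨s, hs, w, hw1, ⟨k, hk⟩, -⟩ := hcase x hx
    have : Subsingleton (Fin (d - 1 + 1)) := by
      have : d - 1 + 1 = 1 := by omega
      rw [this]
      infer_instance
    rw [Finset.sum_eq_single k (fun l _ h => absurd (Subsingleton.elim l k) h) (by simp), hk] at hw1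
    exact absurd hw1 (by norm_num)

/-! ### Continuous functionals on `H¹(Ω)` -/

/-- The embedding `H¹(Ω) → L²(Ω)`. -/
def fnOfL (Ω : Set (E d)) : H1 Ω →L[ℝ] Lp ℝ 2 (vol Ω) :=
  (WithLp.fstL 2 ℝ _ _).comp (H1 Ω).subtypeL

/-- The gradient as a bounded operator. -/
def gradL (Ω : Set (E d)) : H1 Ω →L[ℝ] Lp (E d) 2 (vol Ω) :=
  (WithLp.sndL 2 ℝ _ _).comp (H1 Ω).subtypeL

lemma fnOf_eq {Ω : Set (E d)} (v : H1 Ω) : fnOf v = fnOfL Ω v := rfl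

lemma grad_eq {Ω : Set (E d)} (v : H1 Ω) : grad v = gradL Ω v := rfl

/-- The normal trace as a continuous functional on `H¹(Ω)`. -/
def HDiv.normalL {Ω : Set (E d)} (y : HDiv Ω) : H1 Ω →L[ℝ] ℝ :=
  (innerSL ℝ y.field).comp (gradL Ω) + (innerSL ℝ y.div).comp (fnOfL Ω)

lemma HDiv.normalL_apply {Ω : Set (E d)} (y : HDiv Ω) (v : H1 Ω) :
    y.normalL v = y.normalPairing v := by
  rw [HDiv.normalPairing, real_inner_comm, real_inner_comm y.div]
  rfl

/-- The pairing with `g ∈ H^{-1/2}(Γ)` as a continuous functional on `H¹(Ω)`. -/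
def pairingL {Ω Γ : Set (E d)} (g : HMinusHalf Ω Γ) : H1 Ω →L[ℝ] ℝ :=
  g.comp (H1Zero Ω Γ).mkQL

lemma pairingL_apply {Ω Γ : Set (E d)} (g : HMinusHalf Ω Γ) (v : H1 Ω) :
    pairingL g v = pairing g v := rfl

lemma pairing_eq_zero {Ω Γ : Set (E d)} (g : HMinusHalf Ω Γ) {v : H1 Ω} (hv : v ∈ H1Zero Ω Γ) :
    pairing g v = 0 := by
  rw [pairing, Submodule.mkQ_apply, (Submodule.Quotient.mk_eq_zero _).2 hv, map_zero]

lemma mem_H1Zero_of_isTrace {Ω Γ : Set (E d)} (hΓ : MeasurableSet Γ) {v : H1 Ω}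
    {τ : Lp ℝ 2 (surf Ω)} (h : IsTrace Ω v τ) (h0 : ∀ᵐ x ∂(surf Ω), x ∈ Γ → τ x = 0) :
    v ∈ H1Zero Ω Γ :=
  ⟨τ, h, (ae_restrict_iff' hΓ).2 h0⟩

/-! ### Approximation by functions whose trace vanishes near the interfaces -/

/-- The `L²` limit identifies the weak `H¹` limit, so bounded gradients are enough to carry the
identity to `w`. -/
lemma eq_of_bounded_approx {Ω : Set (E d)} (hΩ : IsOpen Ω) (Λ : H1 Ω →L[ℝ] ℝ)
    (κ : Lp ℝ 2 (surf Ω) →L[ℝ] ℝ) {w : H1 Ω} {τ : Lp ℝ 2 (surf Ω)} {v : ℕ → H1 Ω}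
    {ρ : ℕ → Lp ℝ 2 (surf Ω)} (h : ∀ n, Λ (v n) = κ (ρ n)) {R : ℝ} (hR : ∀ n, ‖grad (v n)‖ ≤ R)
    (hv : Tendsto (fun n => fnOf (v n)) atTop (𝓝 (fnOf w))) (hρ : Tendsto ρ atTop (𝓝 τ)) :
    Λ w = κ τ := by
  obtain ⟨w', hw1, -, 𝒰, hne, hle, hlim⟩ := exists_weak_limit_H1 v hR hv
  obtain rfl := fnOf_injective hΩ hw1
  refine tendsto_nhds_unique (hlim Λ) ?_
  simp_rw [h]
  exact ((κ.continuous.tendsto τ).comp hρ).mono_left hle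

/-- Finite `(d-1)`-dimensional measure forces zero `d`-dimensional measure. -/
lemma IsRidge.volume_eq_zero {F : Set (E d)} (hF : IsRidge F) : volume F = 0 := by
  obtain ⟨b, i, j, c, hij, -⟩ := id hF
  have hd := two_le_of_ne hij
  rw [← EuclideanSpace.euclideanHausdorffMeasure_eq_volume]
  refine (Measure.euclideanHausdorffMeasure_zero_or_top (show d - 1 < d by omega) F).resolve_right ?_
  rw [hF.euclideanHausdorffMeasure_eq_zero]
  exact ENNReal.zero_ne_top

/-- The term `v ∇χ` is controlled only through an `L^∞` bound on `v`, because `∇χ` is bounded merely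
in `L²`; this is why truncation must precede the cut-offs. -/
lemma norm_grad_mul_le {Ω : Set (E d)} {v w : H1 Ω} {χ : E d → ℝ} (hχ : ContDiff ℝ ∞ χ)
    (h1 : ∀ x, |χ x| ≤ 1) {M R : ℝ} (hR : 0 ≤ R)
    (hM : ∀ᵐ x ∂(vol Ω), |fnOf v x| ≤ M) (hg : eLpNorm (gradient χ) 2 (vol Ω) ≤ ENNReal.ofReal R)
    (hw : grad w =ᵐ[vol Ω] fun x => χ x • grad v x + fnOf v x • gradient χ x) :
    ‖grad w‖ ≤ ‖grad v‖ + |M| * R := by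
  have m1 : AEStronglyMeasurable (fun x => χ x • grad v x) (vol Ω) :=
    hχ.continuous.aestronglyMeasurable.smul (Lp.aestronglyMeasurable _)
  have m2 : AEStronglyMeasurable (fun x => fnOf v x • gradient χ x) (vol Ω) :=
    (Lp.aestronglyMeasurable (fnOf v)).smul (continuous_gradient hχ).aestronglyMeasurable
  have e1 : eLpNorm (fun x => χ x • grad v x) 2 (vol Ω) ≤ eLpNorm (grad v) 2 (vol Ω) := by
    refine eLpNorm_mono fun x => ?_
    rw [norm_smul]
    exact mul_le_of_le_one_left (norm_nonneg _) (h1 x)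
  have e2 : eLpNorm (fun x => fnOf v x • gradient χ x) 2 (vol Ω) ≤
      ENNReal.ofReal |M| * ENNReal.ofReal R := by
    refine (eLpNorm_le_mul_eLpNorm_of_ae_le_mul (g := gradient χ) (c := |M|) ?_ 2).trans
      (by gcongr)
    filter_upwards [hM] with x hx
    rw [norm_smul]
    exact mul_le_mul_of_nonneg_right (hx.trans (le_abs_self M)) (norm_nonneg _)
  have e3 : eLpNorm (grad w) 2 (vol Ω) ≤
      eLpNorm (grad v) 2 (vol Ω) + ENNReal.ofReal |M| * ENNReal.ofReal R := by
    rw [eLpNorm_congr_ae hw]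
    exact (eLpNorm_add_le m1 m2 one_le_two).trans (add_le_add e1 e2)
  rw [Lp.norm_def, Lp.norm_def]
  refine (ENNReal.toReal_mono ?_ e3).trans (le_of_eq ?_)
  · exact ENNReal.add_ne_top.2 ⟨Lp.eLpNorm_ne_top _, by finiteness⟩
  · rw [ENNReal.toReal_add (Lp.eLpNorm_ne_top _) (by finiteness), ENNReal.toReal_mul,
      ENNReal.toReal_ofReal (abs_nonneg _), ENNReal.toReal_ofReal hR]

/-- An identity between a functional of `v` and a functional of its trace extends from functions
whose trace vanishes near `Z` to all functions, if `Z` has codimension two. -/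
theorem eq_of_eq_near_ridges {Ω : Set (E d)} (hΩ : IsOpen Ω) (hb : Bornology.IsBounded Ω)
    (Γ Z : Set (E d)) (Λ : H1 Ω →L[ℝ] ℝ) (κ : Lp ℝ 2 (surf Ω) →L[ℝ] ℝ)
    (hbase : ∀ (w : H1 Ω) (τ : Lp ℝ 2 (surf Ω)) (V : Set (E d)), IsTrace Ω w τ →
      (∀ᵐ x ∂(surf Ω), x ∈ Γ → τ x = 0) → IsOpen V → Z ⊆ V →
      (∀ᵐ x ∂(surf Ω), x ∈ V → τ x = 0) → Λ w = κ τ)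
    {S : Set (Set (E d))} (hS : S.Finite) (hridge : ∀ F ∈ S, IsRidge F) (hZ : Z ⊆ ⋃₀ S)
    {w : H1 Ω} {τ : Lp ℝ 2 (surf Ω)} (hw : IsTrace Ω w τ)
    (h0 : ∀ᵐ x ∂(surf Ω), x ∈ Γ → τ x = 0) : Λ w = κ τ := by
  -- Bounded functions, by induction on the number of ridges. Each cut-off moves one ridge from `S`
  -- into the open set `V` where the trace already vanishes, and when `S` is empty `hbase` applies.
  have hbdd : ∀ (w : H1 Ω) (τ : Lp ℝ 2 (surf Ω)) (M : ℝ) (V : Set (E d)), IsTrace Ω w τ →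
      (∀ᵐ x ∂(vol Ω), |fnOf w x| ≤ M) → (∀ᵐ x ∂(surf Ω), x ∈ Γ → τ x = 0) → IsOpen V →
      Z ⊆ V ∪ ⋃₀ S → (∀ᵐ x ∂(surf Ω), x ∈ V → τ x = 0) → Λ w = κ τ := by
    clear hZ
    induction S, hS using Set.Finite.induction_on with
    | empty =>
      intro w τ M V h1 _ h3 h4 h5 h6
      exact hbase w τ V h1 h3 h4 (by simpa using h5) h6
    | @insert F S _ _ ih =>
      intro w τ M V h1 h2 h3 h4 h5 h6
      have hF : IsRidge F := hridge F (mem_insert _ _)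
      obtain ⟨R, χ, c1, c2, c3, c4, c5⟩ := hF.exists_cutoff hb
      choose O o1 o2 o3 using c3
      choose v ρ t1 t2 t3 t4 using fun n => exists_mul_isTrace hΩ hb (c1 n) h1
      have c5' : ∀ n, eLpNorm (gradient (χ n)) 2 (vol Ω) ≤ ENNReal.ofReal (max R 0) := fun n =>
        (c5 n).trans (ENNReal.ofReal_le_ofReal (le_max_left _ _))
      refine eq_of_bounded_approx hΩ Λ κ (v := v) (ρ := ρ) (R := ‖grad w‖ + |M| * max R 0)
        (fun n => ?_) (fun n => ?_) ?_ ?_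
      · refine ih (fun F' hF' => hridge F' (mem_insert_of_mem _ hF')) (v n) (ρ n) M (V ∪ O n)
          (t1 n) ?_ ?_ (h4.union (o1 n)) ?_ ?_
        · filter_upwards [h2, t2 n] with x e1 e2
          rw [e2, abs_mul]
          exact (mul_le_of_le_one_left (abs_nonneg _) (c2 n x)).trans e1
        · filter_upwards [h3, t4 n] with x e1 e2 hx
          rw [e2, e1 hx, mul_zero]
        · intro x hx
          rcases h5 hx with h | h
          · exact Or.inl (Or.inl h)
          · rw [sUnion_insert] at h
            rcases h with h | h
            · exact Or.inl (Or.inr (o2 n h))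
            · exact Or.inr h
        · filter_upwards [h6, t4 n] with x e1 e2 hx
          rcases hx with hx | hx
          · rw [e2, e1 hx, mul_zero]
          · rw [e2, o3 n x hx, zero_mul]
      · exact norm_grad_mul_le (c1 n) (c2 n) (le_max_right _ _) h2 (c5' n) (t3 n)
      · refine tendsto_Lp_two_of_dominated (fun n => ?_) ?_
        · filter_upwards [t2 n] with x e2
          rw [e2, abs_mul]
          exact mul_le_of_le_one_left (abs_nonneg _) (c2 n x)
        · have hnull : vol Ω F = 0 :=
            le_antisymm ((Measure.restrict_le_self F).trans hF.volume_eq_zero.le) zero_le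
          filter_upwards [ae_all_iff.2 t2, measure_eq_zero_iff_ae_notMem.1 hnull] with x e2 hx
          simp_rw [e2]
          simpa using (c4 x hx).mul_const (fnOf w x)
      · refine tendsto_Lp_two_of_dominated (fun n => ?_) ?_
        · filter_upwards [t4 n] with x e2
          rw [e2, abs_mul]
          exact mul_le_of_le_one_left (abs_nonneg _) (c2 n x)
        · filter_upwards [ae_all_iff.2 t4, measure_eq_zero_iff_ae_notMem.1 (hF.surf_eq_zero Ω)]
            with x e2 hx
          simp_rw [e2]
          simpa using (c4 x hx).mul_const (τ x)
  -- Unbounded functions are approximated by truncations, which keep the zero trace on `Γ` because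
  -- `trunc M 0 = 0`. The induction starts with `V = ∅`.
  obtain ⟨R, hR⟩ := exists_trunc hΩ hw
  choose v ρ t1 t2 t3 t4 using fun n : ℕ => hR ((n : ℝ) + 1) (by positivity)
  have hpos : ∀ n : ℕ, (0 : ℝ) < n + 1 := fun n => by positivity
  refine eq_of_bounded_approx hΩ Λ κ (v := v) (ρ := ρ) (R := R) (fun n => ?_) t2 ?_ ?_
  · refine hbdd (v n) (ρ n) (((n : ℝ) + 1) * 2) ∅ (t1 n) ?_ ?_ isOpen_empty
      (by simpa using hZ) (ae_of_all _ fun x hx => absurd hx (notMem_empty x))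
    · filter_upwards [t3 n] with x e
      rw [e]
      exact abs_trunc_le (hpos n) _
    · filter_upwards [t4 n, h0] with x e e0 hx
      rw [e, e0 hx, trunc_zero]
  · refine tendsto_Lp_two_of_dominated (fun n => ?_) ?_
    · filter_upwards [t3 n] with x e
      rw [e]
      exact abs_trunc_le_abs (hpos n) _
    · filter_upwards [ae_all_iff.2 t3] with x e
      simp_rw [e]
      exact tendsto_trunc _
  · refine tendsto_Lp_two_of_dominated (fun n => ?_) ?_
    · filter_upwards [t4 n] with x e
      rw [e]
      exact abs_trunc_le_abs (hpos n) _
    · filter_upwards [ae_all_iff.2 t4] with x e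
      simp_rw [e]
      exact tendsto_trunc _

/-! ### Integration by parts with mixed boundary conditions -/

namespace Body

variable (B : Body d)

lemma measurableSet_of_relOpen {Ω Γ : Set (E d)}
    (h : ∃ U : Set (E d), IsOpen U ∧ Γ = U ∩ frontier Ω) : MeasurableSet Γ := by
  obtain ⟨U, hU, rfl⟩ := h
  exact hU.measurableSet.inter (measurableSet_frontier' Ω)

lemma measurableSet_I : MeasurableSet B.ΓI := measurableSet_of_relOpen B.openI

lemma measurableSet_D : MeasurableSet B.ΓD := measurableSet_of_relOpen B.openD

lemma measurableSet_N : MeasurableSet B.ΓN := measurableSet_of_relOpen B.openN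

instance : IsFiniteMeasure (surf B.Ω) := isFiniteMeasure_surf B.isOpen B.isBounded B.lipschitz

variable {B}

lemma trace_eq {v : H1 B.Ω} {τ : Lp ℝ 2 (surf B.Ω)} (h : IsTrace B.Ω v τ) : trace v = τ :=
  h.trace_eq B.isOpen B.isBounded B.lipschitz

lemma traceEqOn_iff {v : H1 B.Ω} {τ : Lp ℝ 2 (surf B.Ω)} (h : IsTrace B.Ω v τ) {Γ : Set (E d)}
    {k : E d → ℝ} : TraceEqOn v Γ k ↔ τ =ᵐ[(surf B.Ω).restrict Γ] k := by
  refine ⟨?_, fun h' => ⟨τ, h, h'⟩⟩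
  rintro ⟨ρ, h1, h2⟩
  rwa [h.unique B.isOpen B.isBounded B.lipschitz h1]

lemma memLp_indicator (η : B.LInfI) : MemLp (B.ΓI.indicator η) 2 (surf B.Ω) :=
  (memLp_indicator_iff_restrict B.measurableSet_I).2 ((Lp.memLp η).mono_exponent le_top)

/-- The extension by zero of `η ∈ L^∞(Γ_I)` to `∂Ω`. -/
def extendI (η : B.LInfI) : Lp ℝ 2 (surf B.Ω) := (memLp_indicator η).toLp _

/-- The boundary term becomes a continuous functional of the trace in `L²(∂Ω)`, the form required
for passing to limits. -/
lemma innerI_eq (η : B.LInfI) {v : H1 B.Ω} {τ : Lp ℝ 2 (surf B.Ω)} (h : IsTrace B.Ω v τ) :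
    B.innerI η v = inner ℝ (extendI η) τ := by
  rw [innerI, trace_eq h, real_inner_comm, extendI, inner_toLp,
    ← integral_indicator B.measurableSet_I]
  refine integral_congr_ae (ae_of_all _ fun x => ?_)
  by_cases hx : x ∈ B.ΓI
  · simp [hx]
  · simp [hx]

lemma ae_of_mem_H1Zero {Γ : Set (E d)} (hΓ : MeasurableSet Γ) {v : H1 B.Ω} (hv : v ∈ H1Zero B.Ω Γ)
    {τ : Lp ℝ 2 (surf B.Ω)} (h : IsTrace B.Ω v τ) : ∀ᵐ x ∂(surf B.Ω), x ∈ Γ → τ x = 0 :=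
  (ae_restrict_iff' hΓ).1 ((traceEqOn_iff h).1 hv)

lemma innerI_eq_zero (η : B.LInfI) {v : H1 B.Ω} (hv : v ∈ H1Zero B.Ω B.ΓI) :
    B.innerI η v = 0 := by
  obtain ⟨τ, h1, h2⟩ := hv
  rw [innerI, trace_eq h1]
  refine integral_eq_zero_of_ae ?_
  filter_upwards [h2] with x hx
  rw [hx]
  simp

variable (B) in
/-- A relatively closed part of the boundary away from the interfaces. -/
lemma isClosed_sdiff {Γ₁ Γ₂ Γ₃ V : Set (E d)}
    (h₂ : ∃ U : Set (E d), IsOpen U ∧ Γ₂ = U ∩ frontier B.Ω)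
    (h₃ : ∃ U : Set (E d), IsOpen U ∧ Γ₃ = U ∩ frontier B.Ω)
    (h₁ : Γ₁ ⊆ frontier B.Ω) (h₁₂ : Disjoint Γ₁ Γ₂) (h₁₃ : Disjoint Γ₁ Γ₃) (hV : IsOpen V)
    (hZ : frontier B.Ω \ (Γ₁ ∪ Γ₂ ∪ Γ₃) ⊆ V) : IsClosed (Γ₁ \ V) := by
  obtain ⟨U₂, o₂, e₂⟩ := h₂
  obtain ⟨U₃, o₃, e₃⟩ := h₃
  have : Γ₁ \ V = frontier B.Ω ∩ (Vᶜ ∩ (U₂ᶜ ∩ U₃ᶜ)) := by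
    ext x
    constructor
    · rintro ⟨hx, hxV⟩
      refine ⟨h₁ hx, hxV, fun h => ?_, fun h => ?_⟩
      · exact disjoint_left.1 h₁₂ hx (by rw [e₂]; exact ⟨h, h₁ hx⟩)
      · exact disjoint_left.1 h₁₃ hx (by rw [e₃]; exact ⟨h, h₁ hx⟩)
    · rintro ⟨hx, hxV, hx2, hx3⟩
      refine ⟨?_, hxV⟩
      by_contra hn
      refine hxV (hZ ⟨hx, ?_⟩)
      rintro ((h | h) | h)
      · exact hn h
      · rw [e₂] at h; exact hx2 h.1
      · rw [e₃] at h; exact hx3 h.1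
  rw [this]
  exact isClosed_frontier.inter
    (hV.isClosed_compl.inter (o₂.isClosed_compl.inter o₃.isClosed_compl))

lemma subset_frontier {Ω Γ : Set (E d)} (h : ∃ U : Set (E d), IsOpen U ∧ Γ = U ∩ frontier Ω) :
    Γ ⊆ frontier Ω := by
  obtain ⟨U, -, rfl⟩ := h
  exact inter_subset_right

/-- Outside `V` the parts `Γ_I` and `Γ_N` are disjoint closed sets, so a smooth `ψ` can be `0` on
one and `1` on the other. Then `ψw` is a test function for the normal extension and `(1 - ψ)w` for
the Neumann condition. -/
theorem normalPairing_eq_of_vanishing {y : HDiv B.Ω} {η : B.LInfI} (hη : B.IsNormalExtension y η)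
    {g : HMinusHalf B.Ω B.ΓN}
    (hg : ∀ v : H1 B.Ω, v ∈ H1Zero B.Ω B.ΓI → v ∈ H1Zero B.Ω B.ΓD →
      y.normalPairing v = pairing g v)
    {w : H1 B.Ω} {τ : Lp ℝ 2 (surf B.Ω)} {V : Set (E d)} (hw : IsTrace B.Ω w τ)
    (h0 : ∀ᵐ x ∂(surf B.Ω), x ∈ B.ΓD → τ x = 0) (hV : IsOpen V)
    (hZ : frontier B.Ω \ (B.ΓI ∪ B.ΓD ∪ B.ΓN) ⊆ V)
    (hτ : ∀ᵐ x ∂(surf B.Ω), x ∈ V → τ x = 0) :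
    y.normalPairing w = inner ℝ (extendI η) τ + pairing g w := by
  have cI : IsClosed (B.ΓI \ V) := B.isClosed_sdiff B.openD B.openN (subset_frontier B.openI)
    B.disjointID B.disjointIN hV hZ
  have cN : IsClosed (B.ΓN \ V) := B.isClosed_sdiff B.openD B.openI (subset_frontier B.openN)
    B.disjointDN.symm B.disjointIN.symm hV (by
      intro x hx
      refine hZ ⟨hx.1, fun h => hx.2 ?_⟩
      rcases h with (h | h) | h
      · exact Or.inr h
      · exact Or.inl (Or.inr h)
      · exact Or.inl (Or.inl h))
  obtain ⟨ψ, hψN, hψI, -⟩ := exists_contMDiffMap_zero_one_of_isClosed (n := ⊤)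
    (modelWithCornersSelf ℝ (E d)) cN cI
    (B.disjointIN.symm.mono sdiff_subset sdiff_subset)
  have hψ : ContDiff ℝ ∞ ψ := ψ.contMDiff.contDiff
  obtain ⟨w₁, ρ₁, t1, t2, -, t4⟩ := exists_mul_isTrace B.isOpen B.isBounded hψ hw
  obtain ⟨w₂, ρ₂, s1, s2, -, s4⟩ := exists_mul_isTrace B.isOpen B.isBounded
    (contDiff_const.sub hψ : ContDiff ℝ ∞ fun x => 1 - ψ x) hw
  have hsum : w = w₁ + w₂ := by
    refine fnOf_injective B.isOpen (Lp.ext ?_)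
    filter_upwards [t2, s2, Lp.coeFn_add (fnOf w₁) (fnOf w₂)] with x e1 e2 e3
    have : fnOf (w₁ + w₂) = fnOf w₁ + fnOf w₂ := rfl
    rw [this, e3, Pi.add_apply, e1, e2]
    ring
  have hτsum : τ = ρ₁ + ρ₂ := by
    refine Lp.ext ?_
    filter_upwards [t4, s4, Lp.coeFn_add ρ₁ ρ₂] with x e1 e2 e3
    rw [e3, Pi.add_apply, e1, e2]
    ring
  have m1D : w₁ ∈ H1Zero B.Ω B.ΓD := mem_H1Zero_of_isTrace B.measurableSet_D t1 (by
    filter_upwards [t4, h0] with x e e0 hx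
    rw [e, e0 hx, mul_zero])
  have m2D : w₂ ∈ H1Zero B.Ω B.ΓD := mem_H1Zero_of_isTrace B.measurableSet_D s1 (by
    filter_upwards [s4, h0] with x e e0 hx
    rw [e, e0 hx, mul_zero])
  have m1N : w₁ ∈ H1Zero B.Ω B.ΓN := mem_H1Zero_of_isTrace B.measurableSet_N t1 (by
    filter_upwards [t4, hτ] with x e e0 hx
    by_cases hxV : x ∈ V
    · rw [e, e0 hxV, mul_zero]
    · rw [e, hψN ⟨hx, hxV⟩]
      simp)
  have m2I : w₂ ∈ H1Zero B.Ω B.ΓI := mem_H1Zero_of_isTrace B.measurableSet_I s1 (by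
    filter_upwards [s4, hτ] with x e e0 hx
    by_cases hxV : x ∈ V
    · rw [e, e0 hxV, mul_zero]
    · rw [e, hψI ⟨hx, hxV⟩]
      simp)
  have e1 := hη w₁ m1D m1N
  have e2 := hg w₂ m2I m2D
  have e3 := pairing_eq_zero g m1N
  have e4 := innerI_eq_zero η m2I
  rw [innerI_eq η s1] at e4
  rw [innerI_eq η t1] at e1
  rw [hτsum, inner_add_right, ← HDiv.normalL_apply, ← pairingL_apply, hsum, map_add, map_add,
    HDiv.normalL_apply, HDiv.normalL_apply, pairingL_apply, pairingL_apply]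
  linarith

/-- The normal trace of an admissible dual field on functions vanishing on `Γ_D`. -/
theorem normalPairing_eq {y : HDiv B.Ω} {η : B.LInfI} (hη : B.IsNormalExtension y η)
    {g : HMinusHalf B.Ω B.ΓN}
    (hg : ∀ v : H1 B.Ω, v ∈ H1Zero B.Ω B.ΓI → v ∈ H1Zero B.Ω B.ΓD →
      y.normalPairing v = pairing g v)
    {w : H1 B.Ω} (hw : w ∈ H1Zero B.Ω B.ΓD) :
    y.normalPairing w = B.innerI η w + pairing g w := by
  obtain ⟨S, hS, hridge, hZ⟩ := B.exists_ridges
  obtain ⟨τ, hτ, hτ0⟩ := id hw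
  -- The normal trace and `g` depend continuously on `w` in `H¹`, the `η` term on its trace in `L²`;
  -- the identity is sorted accordingly.
  have key := eq_of_eq_near_ridges B.isOpen B.isBounded B.ΓD _ (y.normalL - pairingL g)
    (innerSL ℝ (extendI η)) (fun w' τ' V h1 h2 h3 h4 h5 => by
      have := normalPairing_eq_of_vanishing hη hg h1 h2 h3 h4 h5
      rw [sub_apply, HDiv.normalL_apply, pairingL_apply, this]
      simp) hS hridge hZ hτ (ae_of_mem_H1Zero B.measurableSet_D hw hτ)
  rw [sub_apply, HDiv.normalL_apply, pairingL_apply, innerSL_apply_apply] at key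
  rw [innerI_eq η hτ]
  linarith

end Body

/-! ### A Hahn–Banach extension with prescribed value -/

/-- A functional below the directional derivative of `C p` at `u` on a subspace extends to a
subgradient of `C p` at `u`. -/
theorem exists_extension_subgradient {X : Type*} [AddCommGroup X] [Module ℝ X] (p : Seminorm ℝ X)
    (u : X) {C : ℝ} (hC : 0 ≤ C) (V : Submodule ℝ X) (f : V →ₗ[ℝ] ℝ)
    (hf : ∀ x : V, ∀ t : ℝ, 0 < t → f x ≤ C * ((p (u + t • (x : X)) - p u) / t)) :
    ∃ g : X →ₗ[ℝ] ℝ, (∀ x : V, g x = f x) ∧ (∀ x, |g x| ≤ C * p x) ∧ g u = C * p u := by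
  let Q : X → Ioi (0 : ℝ) → ℝ := fun x t => (p (u + (t : ℝ) • x) - p u) / t
  -- By convexity this infimum is the one-sided directional derivative of `p` at `u`; it is the
  -- sublinear majorant for Hahn–Banach.
  let q : X → ℝ := fun x => ⨅ t : Ioi (0 : ℝ), Q x t
  have : Nonempty (Ioi (0 : ℝ)) := ⟨⟨1, mem_Ioi.2 one_pos⟩⟩
  have hlow : ∀ x t, -p x ≤ Q x t := by
    intro x t
    have ht : (0 : ℝ) < t := t.2
    rw [le_div_iff₀ ht]
    have h1 := map_sub_le_add p (u + (t : ℝ) • x) ((t : ℝ) • x)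
    rw [add_sub_cancel_right, map_smul_eq_mul, Real.norm_of_nonneg ht.le] at h1
    linarith
  have hbdd : ∀ x, BddBelow (range (Q x)) := fun x => ⟨-p x, by rintro _ ⟨t, rfl⟩; exact hlow x t⟩
  have hle : ∀ x t, q x ≤ Q x t := fun x t => ciInf_le (hbdd x) t
  have hqp : ∀ x, q x ≤ p x := by
    intro x
    refine (hle x ⟨1, mem_Ioi.2 one_pos⟩).trans ?_
    have h1 := map_add_le_add p u x
    simp only [Q, one_smul, div_one]
    linarith
  -- This gives the lower bound for `g u`: stepping by `-u` with `t = 1` reaches the origin.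
  have hneg : q (-u) ≤ -p u := by
    refine (hle (-u) ⟨1, mem_Ioi.2 one_pos⟩).trans (le_of_eq ?_)
    simp [Q]
  have hhom : ∀ c : ℝ, 0 < c → ∀ x, q (c • x) = c * q x := by
    have key : ∀ c : ℝ, 0 < c → ∀ x, c * q x ≤ q (c • x) := by
      intro c hc x
      refine le_ciInf fun t => ?_
      have ht : (0 : ℝ) < t := t.2
      have h1 := hle x ⟨t * c, mul_pos ht hc⟩
      calc c * q x ≤ c * Q x ⟨t * c, mul_pos ht hc⟩ := by gcongr
        _ = Q (c • x) t := by
          simp only [Q, smul_smul]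
          field_simp
    intro c hc x
    refine le_antisymm ?_ (key c hc x)
    have h1 := key c⁻¹ (inv_pos.2 hc) (c • x)
    rw [smul_smul, inv_mul_cancel₀ hc.ne', one_smul, inv_mul_le_iff₀ hc] at h1
    exact h1
  have hadd : ∀ x y, q (x + y) ≤ q x + q y := by
    intro x y
    have key : ∀ s t : Ioi (0 : ℝ), q (x + y) ≤ Q x s + Q y t := by
      intro s t
      have hs : (0 : ℝ) < s := s.2
      have ht : (0 : ℝ) < t := t.2
      -- This choice gives `r / s + r / t = 1`, so `u + r(x + y)` is a convex combination of `u + s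
      -- x` and `u + t y`.
      let r : ℝ := s * t / (s + t)
      have hr : 0 < r := by positivity
      refine (hle (x + y) ⟨r, hr⟩).trans ?_
      simp only [Q]
      have e : u + r • (x + y) =
          (r / s) • (u + (s : ℝ) • x) + (r / t) • (u + (t : ℝ) • y) := by
        have h1 : r / s + r / t = 1 := by
          simp only [r]
          field_simp
          ring
        have h2 : r / s * s = r := by field_simp
        have h3 : r / t * t = r := by field_simp
        rw [smul_add, smul_add, smul_add, smul_smul, smul_smul, h2, h3]
        have : u = (r / s) • u + (r / t) • u := by rw [← add_smul, h1, one_smul]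
        nth_rewrite 1 [this]
        abel
      have h4 := map_add_le_add p ((r / s) • (u + (s : ℝ) • x)) ((r / t) • (u + (t : ℝ) • y))
      rw [← e, map_smul_eq_mul, map_smul_eq_mul, Real.norm_of_nonneg (by positivity),
        Real.norm_of_nonneg (by positivity)] at h4
      have h1 : 1 / r = 1 / s + 1 / t := by
        simp only [r]
        field_simp
        ring
      calc (p (u + r • (x + y)) - p u) / r
          ≤ (r / s * p (u + (s : ℝ) • x) + r / t * p (u + (t : ℝ) • y) - p u) / r := by gcongr
        _ = p (u + (s : ℝ) • x) / s + p (u + (t : ℝ) • y) / t - p u * (1 / r) := by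
            field_simp
        _ = _ := by
            rw [h1]
            ring
    have h5 : ∀ t, q (x + y) - Q y t ≤ q x := fun t =>
      le_ciInf fun s => by linarith [key s t]
    have h6 : q (x + y) - q x ≤ q y := le_ciInf fun t => by linarith [h5 t]
    linarith
  obtain ⟨g, hg1, hg2⟩ := exists_extension_of_le_sublinear ⟨V, f⟩ (fun x => C * q x)
    (fun c hc x => by simp only [hhom c hc x]; ring)
    (fun x y => by
      have := mul_le_mul_of_nonneg_left (hadd x y) hC
      linarith)
    (fun x => by
      change f x ≤ C * ⨅ t, Q x t
      rw [Real.mul_iInf_of_nonneg hC]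
      exact le_ciInf fun t => hf x t t.2)
  refine ⟨g, hg1, fun x => abs_le.2 ⟨?_, ?_⟩, ?_⟩
  · have h1 := hg2 (-x)
    have h2 := mul_le_mul_of_nonneg_left (hqp (-x)) hC
    rw [map_neg_eq_map] at h2
    rw [map_neg] at h1
    linarith
  · exact (hg2 x).trans (mul_le_mul_of_nonneg_left (hqp x) hC)
  · have h1 := hg2 (-u)
    rw [map_neg] at h1
    have h2 := mul_le_mul_of_nonneg_left hneg hC
    have h3 := (hg2 u).trans (mul_le_mul_of_nonneg_left (hqp u) hC)
    linarith

/-! ### `L¹(Γ_I)` and its dual -/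

namespace Body

variable (B : Body d)

lemma integrable_I (τ : Lp ℝ 2 (surf B.Ω)) : Integrable τ ((surf B.Ω).restrict B.ΓI) :=
  ((Lp.memLp τ).integrable one_le_two).restrict

/-- The seminorm `τ ↦ ‖τ‖_{1,Γ_I}` on `L²(∂Ω)`. -/
def seminormI : Seminorm ℝ (Lp ℝ 2 (surf B.Ω)) :=
  Seminorm.of (fun τ => ∫ x in B.ΓI, |τ x| ∂(surf B.Ω))
    (fun τ ρ => by
      rw [← integral_add (B.integrable_I τ).abs (B.integrable_I ρ).abs]
      refine integral_mono_ae (B.integrable_I _).abs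
        ((B.integrable_I τ).abs.add (B.integrable_I ρ).abs) ?_
      filter_upwards [ae_restrict_of_ae (Lp.coeFn_add τ ρ)] with x hx
      rw [hx]
      exact abs_add_le _ _)
    (fun c τ => by
      rw [← integral_const_mul]
      refine integral_congr_ae ?_
      filter_upwards [ae_restrict_of_ae (Lp.coeFn_smul c τ)] with x hx
      rw [hx, Pi.smul_apply, smul_eq_mul, abs_mul, Real.norm_eq_abs])

lemma seminormI_apply (τ : Lp ℝ 2 (surf B.Ω)) :
    B.seminormI τ = ∫ x in B.ΓI, |τ x| ∂(surf B.Ω) := rfl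

variable {B}

lemma normI_eq {v : H1 B.Ω} {τ : Lp ℝ 2 (surf B.Ω)} (h : IsTrace B.Ω v τ) :
    B.normI v = B.seminormI τ := by
  rw [normI, trace_eq h, seminormI_apply]

lemma ae_norm_le (η : B.LInfI) : ∀ᵐ x ∂((surf B.Ω).restrict B.ΓI), |η x| ≤ ‖η‖ := by
  have h := ae_le_eLpNormEssSup (f := η) (μ := (surf B.Ω).restrict B.ΓI)
  filter_upwards [h] with x hx
  rw [Lp.norm_def, eLpNorm_exponent_top]
  have h2 : eLpNormEssSup η ((surf B.Ω).restrict B.ΓI) ≠ ⊤ := by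
    rw [← eLpNorm_exponent_top]
    exact Lp.eLpNorm_ne_top η
  have := ENNReal.toReal_mono h2 hx
  rwa [toReal_enorm, Real.norm_eq_abs] at this

lemma inner_extendI (η : B.LInfI) (τ : Lp ℝ 2 (surf B.Ω)) :
    inner ℝ (extendI η) τ = ∫ x in B.ΓI, η x * τ x ∂(surf B.Ω) := by
  rw [real_inner_comm, extendI, inner_toLp, ← integral_indicator B.measurableSet_I]
  refine integral_congr_ae (ae_of_all _ fun x => ?_)
  by_cases hx : x ∈ B.ΓI
  · simp [hx]
  · simp [hx]

lemma abs_inner_extendI_le (η : B.LInfI) (τ : Lp ℝ 2 (surf B.Ω)) :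
    |inner ℝ (extendI η) τ| ≤ ‖η‖ * B.seminormI τ := by
  rw [inner_extendI, seminormI_apply, ← integral_const_mul, ← Real.norm_eq_abs]
  refine norm_integral_le_of_norm_le ((B.integrable_I τ).abs.const_mul _) ?_
  filter_upwards [ae_norm_le η] with x hx
  rw [norm_mul]
  exact mul_le_mul_of_nonneg_right hx (abs_nonneg _)

variable (B) in
lemma exists_seminormI_le : ∃ K : ℝ, ∀ τ, B.seminormI τ ≤ K * ‖τ‖ := by
  let μ := surf B.Ω
  have hone : MemLp (fun _ : E d => (1 : ℝ)) 2 μ := memLp_const 1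
  refine ⟨‖hone.toLp _‖, fun τ => ?_⟩
  have h1 : B.seminormI τ ≤ ∫ x, |τ x| ∂μ := by
    rw [seminormI_apply]
    exact setIntegral_le_integral ((Lp.memLp τ).integrable one_le_two).abs
      (ae_of_all _ fun x => abs_nonneg _)
  have h2 : ∫ x, |τ x| ∂μ = inner ℝ ((Lp.memLp τ).abs.toLp _) (hone.toLp _) := by
    rw [inner_toLp]
    refine integral_congr_ae ?_
    filter_upwards [(Lp.memLp τ).abs.coeFn_toLp] with x hx
    rw [hx]
    simp
  have h3 : ‖(Lp.memLp τ).abs.toLp _‖ ≤ ‖τ‖ := by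
    refine Lp.norm_le_norm_of_ae_le ?_
    filter_upwards [(Lp.memLp τ).abs.coeFn_toLp] with x hx
    rw [hx]
    simp
  calc _ ≤ _ := h1
    _ ≤ ‖(Lp.memLp τ).abs.toLp _‖ * ‖hone.toLp _‖ := by
        rw [h2]
        exact real_inner_le_norm _ _
    _ ≤ _ := by
        rw [mul_comm]
        gcongr

/-- A functional bounded by the `L¹(Γ_I)`-seminorm is represented by an element of
`L^∞(Γ_I)`. -/
theorem exists_LInf_of_le_seminormI (g : Lp ℝ 2 (surf B.Ω) →ₗ[ℝ] ℝ) {C : ℝ} (hC : 0 ≤ C)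
    (hg : ∀ τ, |g τ| ≤ C * B.seminormI τ) :
    ∃ η : B.LInfI, ‖η‖ ≤ C ∧ ∀ τ, g τ = inner ℝ (extendI η) τ := by
  let μ := surf B.Ω
  have hmI := B.measurableSet_I
  obtain ⟨K, hCS⟩ := B.exists_seminormI_le
  let G : Lp ℝ 2 μ →L[ℝ] ℝ := g.mkContinuous (C * K) fun τ => by
    rw [Real.norm_eq_abs, mul_assoc]
    exact (hg τ).trans (mul_le_mul_of_nonneg_left (hCS τ) hC)
  let a : Lp ℝ 2 μ := (InnerProductSpace.toDual ℝ _).symm G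
  have ha : ∀ τ, g τ = inner ℝ τ a := by
    intro τ
    rw [real_inner_comm, InnerProductSpace.toDual_symm_apply]
    rfl
  have hai : Integrable a (μ.restrict B.ΓI) := B.integrable_I a
  -- Testing the Riesz representative on indicators bounds its averages over all sets, hence its
  -- values almost everywhere.
  have hset : ∀ s, MeasurableSet s → |∫ x in s, a x ∂(μ.restrict B.ΓI)| ≤
      ∫ _ in s, C ∂(μ.restrict B.ΓI) := by
    intro s hs
    have hsI := hs.inter hmI
    have hind : MemLp ((s ∩ B.ΓI).indicator fun _ => (1 : ℝ)) 2 μ :=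
      memLp_indicator_const 2 hsI 1 (Or.inr (measure_ne_top _ _))
    have h1 := hg (hind.toLp _)
    have h2 : g (hind.toLp _) = ∫ x in s, a x ∂(μ.restrict B.ΓI) := by
      rw [ha, real_inner_comm, inner_toLp, Measure.restrict_restrict hs, ← integral_indicator hsI]
      refine integral_congr_ae (ae_of_all _ fun x => ?_)
      by_cases hx : x ∈ s ∩ B.ΓI
      · simp only [indicator_of_mem hx]
        simp
      · simp only [indicator_of_notMem hx]
        simp
    have h3 : B.seminormI (hind.toLp _) = ∫ _ in s, (1 : ℝ) ∂(μ.restrict B.ΓI) := by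
      rw [seminormI_apply, ← integral_indicator hs]
      refine integral_congr_ae ?_
      filter_upwards [ae_restrict_of_ae hind.coeFn_toLp, ae_restrict_mem hmI] with x hx hxI
      rw [hx]
      by_cases hxs : x ∈ s
      · simp [hxs, hxI]
      · simp [hxs]
    rw [h2, h3, ← integral_const_mul] at h1
    simpa using h1
  have hle : ∀ᵐ x ∂(μ.restrict B.ΓI), a x ≤ C :=
    ae_le_of_forall_setIntegral_le hai (integrable_const C) fun s hs _ =>
      (le_abs_self _).trans (hset s hs)
  have hge : ∀ᵐ x ∂(μ.restrict B.ΓI), -a x ≤ C :=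
    ae_le_of_forall_setIntegral_le hai.neg (integrable_const C) fun s hs _ => by
      rw [integral_neg]
      exact (neg_le_abs _).trans (hset s hs)
  have hab : ∀ᵐ x ∂(μ.restrict B.ΓI), ‖a x‖ ≤ C := by
    filter_upwards [hle, hge] with x h1 h2
    rw [Real.norm_eq_abs, abs_le]
    constructor <;> linarith
  have hmem : MemLp a ⊤ (μ.restrict B.ΓI) :=
    memLp_top_of_bound (Lp.aestronglyMeasurable a).restrict C hab
  refine ⟨hmem.toLp _, ?_, fun τ => ?_⟩
  · rw [Lp.norm_toLp, eLpNorm_exponent_top]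
    refine ENNReal.toReal_le_of_le_ofReal hC ?_
    exact eLpNormEssSup_le_of_ae_bound hab
  · have hτI : MemLp (B.ΓI.indicator τ) 2 μ := (Lp.memLp τ).indicator hmI
    -- The bound by the seminorm makes `g` blind to values off `Γ_I`.
    have h0 : g (τ - hτI.toLp _) = 0 := by
      have h1 := hg (τ - hτI.toLp _)
      have h2 : B.seminormI (τ - hτI.toLp _) = 0 := by
        rw [seminormI_apply]
        refine integral_eq_zero_of_ae ?_
        filter_upwards [ae_restrict_of_ae hτI.coeFn_toLp, ae_restrict_mem hmI,
          ae_restrict_of_ae (Lp.coeFn_sub τ (hτI.toLp _))] with x e1 e2 e3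
        rw [e3, Pi.sub_apply, e1, indicator_of_mem e2]
        simp
      rw [h2, mul_zero] at h1
      exact abs_nonpos_iff.1 h1
    rw [map_sub, sub_eq_zero] at h0
    rw [h0, ha, real_inner_comm, inner_toLp, inner_extendI, ← integral_indicator hmI]
    refine integral_congr_ae ?_
    filter_upwards [(ae_restrict_iff' hmI).1 hmem.coeFn_toLp] with x hx
    by_cases hxI : x ∈ B.ΓI
    · simp only [indicator_of_mem hxI, hx hxI, RCLike.inner_apply, conj_trivial]
      exact mul_comm _ _
    · simp [hxI]

/-! ### Uniqueness of the normal trace -/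

lemma isTrace_ofSmooth {φ : E d → ℝ} (h : ContDiff ℝ ∞ φ) (hc : HasCompactSupport φ) :
    IsTrace B.Ω (ofSmooth B.Ω h hc)
      ((h.continuous.memLp_of_hasCompactSupport (μ := surf B.Ω) (p := 2) hc).toLp φ) :=
  Submodule.le_topologicalClosure _ ⟨φ, h, hc, fnOf_ofSmooth _ h hc,
    (h.continuous.memLp_of_hasCompactSupport (μ := surf B.Ω) (p := 2) hc).coeFn_toLp⟩

/-- A smooth function supported in the open set that cuts `Γ_I` out of the boundary has zero trace
on `Γ_D` and `Γ_N`, so it is an allowed test function, and such functions determine `η` on `Γ_I`. -/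
theorem IsNormalExtension.unique {y : HDiv B.Ω} {η η' : B.LInfI} (h : B.IsNormalExtension y η)
    (h' : B.IsNormalExtension y η') : η = η' := by
  obtain ⟨U, hU, hUI⟩ := B.openI
  set f : Lp ℝ 2 (surf B.Ω) := extendI η - extendI η' with hf
  have hintg : Integrable f (surf B.Ω) := (Lp.memLp f).integrable one_le_two
  have hzero := hU.ae_eq_zero_of_integral_contDiff_smul_eq_zero (μ := surf B.Ω) (f := f)
    (hintg.locallyIntegrable.locallyIntegrableOn U) (fun φ hφ hc hs => by
      have ht := isTrace_ofSmooth (B := B) hφ hc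
      have hvan : ∀ Γ : Set (E d), Disjoint B.ΓI Γ → ∀ᵐ x ∂(surf B.Ω), x ∈ Γ →
          (hφ.continuous.memLp_of_hasCompactSupport (μ := surf B.Ω) (p := 2) hc).toLp φ x = 0 := by
        intro Γ hΓ
        filter_upwards [(hφ.continuous.memLp_of_hasCompactSupport
          (μ := surf B.Ω) (p := 2) hc).coeFn_toLp, ae_restrict_mem (measurableSet_frontier' B.Ω)]
          with x e1 e2 hx
        rw [e1]
        refine image_eq_zero_of_notMem_tsupport fun hx' => ?_
        exact disjoint_left.1 hΓ (by rw [hUI]; exact ⟨hs hx', e2⟩) hx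
      have mD := mem_H1Zero_of_isTrace B.measurableSet_D ht (hvan _ B.disjointID)
      have mN := mem_H1Zero_of_isTrace B.measurableSet_N ht (hvan _ B.disjointIN)
      have e1 := h _ mD mN
      have e2 := h' _ mD mN
      rw [innerI_eq _ ht] at e1 e2
      have e3 : inner ℝ f ((hφ.continuous.memLp_of_hasCompactSupport
          (μ := surf B.Ω) (p := 2) hc).toLp φ) = 0 := by
        rw [hf, inner_sub_left, e1, e2, sub_self]
      rw [inner_toLp] at e3
      rw [← e3]
      refine integral_congr_ae (ae_of_all _ fun x => ?_)
      simp)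
  refine Lp.ext ((ae_restrict_iff' B.measurableSet_I).2 ?_)
  filter_upwards [hzero, Lp.coeFn_sub (extendI η) (extendI η'), (memLp_indicator η).coeFn_toLp,
    (memLp_indicator η').coeFn_toLp] with x e1 e2 e3 e4 hx
  have e5 := e1 (by rw [hUI] at hx; exact hx.1)
  rw [hf, e2, Pi.sub_apply, extendI, extendI, e3, e4, indicator_of_mem hx, indicator_of_mem hx,
    sub_eq_zero] at e5
  exact e5

end Body

/-! ### Duality -/

lemma IsTrace.add {Ω : Set (E d)} {v w : H1 Ω} {τ ρ : Lp ℝ 2 (surf Ω)}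
    (h : IsTrace Ω v τ) (k : IsTrace Ω w ρ) : IsTrace Ω (v + w) (τ + ρ) :=
  Submodule.add_mem _ h k

lemma IsTrace.smul {Ω : Set (E d)} {w : H1 Ω} {τ : Lp ℝ 2 (surf Ω)}
    (s : ℝ) (h : IsTrace Ω w τ) : IsTrace Ω (s • w) (s • τ) :=
  Submodule.smul_mem _ s h

namespace Data

variable {B : Body d} (P : Data B)

/-! ### Real-valued energies, admissibility and the gap identity -/

/-- The finite part of the primal energy. -/
def primalReal (v : H1 B.Ω) : ℝ :=
  1 / 2 * ‖grad v‖ ^ 2 + 1 / (2 * P.m) * B.normI v ^ 2 - inner ℝ P.f (fnOf v) - pairing P.g v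

/-- The finite part of the dual energy. -/
def dualReal (y : B.HDivI) : ℝ :=
  -(1 / 2) * ‖y.1.field‖ ^ 2 - P.m / 2 * ‖y.normalTrace‖ ^ 2
    + y.1.normalPairing P.lift - B.innerI y.normalTrace P.lift - pairing P.g P.lift

/-- The constraints of the dual problem. -/
def DualAdmissible (y : B.HDivI) : Prop :=
  y.1.div = -P.f ∧ ∀ v : H1 B.Ω, v ∈ H1Zero B.Ω B.ΓI → v ∈ H1Zero B.Ω B.ΓD →
    y.1.normalPairing v = pairing P.g v

lemma primal_eq {v : H1 B.Ω} (h : TraceEqOn v B.ΓD P.uD) : P.primal v = P.primalReal v := by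
  rw [primal, convexIndicator, if_pos h, add_zero]
  rfl

lemma mem_K_iff {v : H1 B.Ω} : v ∈ P.K ↔ TraceEqOn v B.ΓD P.uD := by
  constructor
  · intro h
    by_contra hn
    refine h ?_
    rw [primal, convexIndicator, if_neg hn, EReal.coe_add_top]
  · intro h
    change P.primal v ≠ ⊤
    rw [P.primal_eq h]
    exact EReal.coe_ne_top _

lemma dual_eq {y : B.HDivI} (h : P.DualAdmissible y) : P.dual y = P.dualReal y := by
  rw [dual, convexIndicator, convexIndicator, if_pos h.1, if_pos h.2, sub_zero, sub_zero]
  rfl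

lemma mem_KStar_iff {y : B.HDivI} : y ∈ P.KStar ↔ P.DualAdmissible y := by
  constructor
  · intro h
    by_contra hn
    refine h ?_
    rw [EReal.neg_eq_top_iff, dual]
    by_cases h1 : y.1.div = -P.f
    · have h2 : ¬ ∀ v : H1 B.Ω, v ∈ H1Zero B.Ω B.ΓI → v ∈ H1Zero B.Ω B.ΓD →
          y.1.normalPairing v = pairing P.g v := fun h2 => hn ⟨h1, h2⟩
      unfold convexIndicator
      rw [if_neg h2, EReal.sub_top]
    · unfold convexIndicator
      rw [if_neg h1, EReal.sub_top, EReal.bot_sub]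
  · intro h
    change -P.dual y ≠ ⊤
    rw [P.dual_eq h, ← EReal.coe_neg]
    exact EReal.coe_ne_top _

lemma sub_lift_mem {v : H1 B.Ω} (h : TraceEqOn v B.ΓD P.uD) :
    v - P.lift ∈ H1Zero B.Ω B.ΓD := by
  obtain ⟨τ, h1, h2⟩ := h
  obtain ⟨ρ, k1, k2⟩ := P.lift_trace
  refine ⟨τ - ρ, Submodule.sub_mem _ h1 k1, ?_⟩
  filter_upwards [ae_restrict_of_ae (Lp.coeFn_sub τ ρ), h2, k2] with x e1 e2 e3
  rw [e1, Pi.sub_apply, e2, e3]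
  simp

/-- The primal-dual gap. -/
theorem primalReal_sub_dualReal {v : H1 B.Ω} (hv : TraceEqOn v B.ΓD P.uD) {y : B.HDivI}
    (hy : P.DualAdmissible y) :
    P.primalReal v - P.dualReal y =
      1 / 2 * ‖grad v - y.1.field‖ ^ 2 + P.boundaryGap y.normalTrace v := by
  -- Applied to `v - P.lift`, the formula turns the lift terms of the dual energy into boundary
  -- terms of `v`; with `div y = -f` only the expansion of the square remains.
  have key := Body.normalPairing_eq (y := y.1) (η := y.normalTrace) y.2.choose_spec hy.2
    (P.sub_lift_mem hv)
  obtain ⟨τ, h1, -⟩ := hv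
  obtain ⟨ρ, k1, -⟩ := P.lift_trace
  have hsub : IsTrace B.Ω (v - P.lift) (τ - ρ) := Submodule.sub_mem _ h1 k1
  rw [← HDiv.normalL_apply, ← pairingL_apply, map_sub, map_sub, HDiv.normalL_apply,
    HDiv.normalL_apply, pairingL_apply, pairingL_apply, Body.innerI_eq _ hsub, inner_sub_right,
    ← Body.innerI_eq _ h1, ← Body.innerI_eq _ k1] at key
  have hn : y.1.normalPairing v = inner ℝ (grad v) y.1.field - inner ℝ P.f (fnOf v) := by
    rw [HDiv.normalPairing, hy.1, inner_neg_right, real_inner_comm P.f]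
    ring
  rw [primalReal, dualReal, boundaryGap, norm_sub_sq_real]
  linarith

/-- By Hölder, the gap is at least the square `(m‖η‖ - ‖v‖_1)² / (2m)`. -/
lemma boundaryGap_nonneg (η : B.LInfI) {v : H1 B.Ω} {τ : Lp ℝ 2 (surf B.Ω)}
    (h : IsTrace B.Ω v τ) : 0 ≤ P.boundaryGap η v := by
  have hm := P.m_pos
  have h1 := Body.abs_inner_extendI_le η τ
  rw [← Body.innerI_eq η h, ← Body.normI_eq h] at h1
  have h2 := neg_le_of_abs_le h1
  have h3 : P.m / 2 * ‖η‖ ^ 2 + 1 / (2 * P.m) * B.normI v ^ 2 - ‖η‖ * B.normI v =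
      1 / (2 * P.m) * (P.m * ‖η‖ - B.normI v) ^ 2 := by
    field_simp
    ring
  have h4 : 0 ≤ 1 / (2 * P.m) * (P.m * ‖η‖ - B.normI v) ^ 2 := by positivity
  rw [boundaryGap]
  linarith

/-! ### First variation, boundary multiplier and strong duality -/

/-- The first variation of the smooth part of the primal energy. -/
def variation (u : H1 B.Ω) : H1 B.Ω →L[ℝ] ℝ :=
  (innerSL ℝ (grad u)).comp (gradL B.Ω) - (innerSL ℝ P.f).comp (fnOfL B.Ω) - pairingL P.g

lemma variation_apply (u w : H1 B.Ω) :
    P.variation u w = inner ℝ (grad u) (grad w) - inner ℝ P.f (fnOf w) - pairing P.g w := rfl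

lemma le_of_forall_small {a b K t : ℝ} (ht : 0 < t)
    (h : ∀ s, 0 < s → s ≤ t → a ≤ b + s * K) : a ≤ b := by
  have hlim : Tendsto (fun s : ℝ => b + s * K) (𝓝[>] 0) (𝓝 b) := by
    have : Continuous fun s : ℝ => b + s * K := by fun_prop
    have h1 := (this.tendsto 0).mono_left (nhdsWithin_le_nhds (s := Ioi 0))
    simpa using h1
  refine ge_of_tendsto hlim ?_
  filter_upwards [Ioc_mem_nhdsGT ht] with s hs
  exact h s hs.1 hs.2

/-- Convexity along the segment from `u` to `u + t x`: difference quotients increase with the step.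
-/
lemma seminorm_add_smul_le {X : Type*} [AddCommGroup X] [Module ℝ X] (p : Seminorm ℝ X) (u x : X)
    {s t : ℝ} (hs : 0 < s) (hst : s ≤ t) :
    p (u + s • x) ≤ p u + s * ((p (u + t • x) - p u) / t) := by
  have ht : 0 < t := hs.trans_le hst
  have e : u + s • x = (1 - s / t) • u + (s / t) • (u + t • x) := by
    rw [smul_add, smul_smul, div_mul_cancel₀ _ ht.ne', sub_smul, one_smul]
    abel
  have hst' : s / t ≤ 1 := (div_le_one ht).2 hst
  have h1 := map_add_le_add p ((1 - s / t) • u) ((s / t) • (u + t • x))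
  rw [← e, map_smul_eq_mul, map_smul_eq_mul, Real.norm_of_nonneg (by linarith),
    Real.norm_of_nonneg (by positivity)] at h1
  refine h1.trans (le_of_eq ?_)
  field_simp
  ring

lemma traceEqOn_add {u : H1 B.Ω} (hu : TraceEqOn u B.ΓD P.uD) {w : H1 B.Ω}
    (hw : w ∈ H1Zero B.Ω B.ΓD) : TraceEqOn (u + w) B.ΓD P.uD := by
  obtain ⟨τ, h1, h2⟩ := hu
  obtain ⟨ρ, k1, k2⟩ := hw
  refine ⟨τ + ρ, h1.add k1, ?_⟩
  filter_upwards [ae_restrict_of_ae (Lp.coeFn_add τ ρ), h2, k2] with x e1 e2 e3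
  rw [e1, Pi.add_apply, e2, e3]
  simp

lemma primalReal_add_smul (u w : H1 B.Ω) (s : ℝ) :
    P.primalReal (u + s • w) = P.primalReal u + s * P.variation u w +
      s ^ 2 * (1 / 2 * ‖grad w‖ ^ 2) +
      1 / (2 * P.m) * (B.normI (u + s • w) ^ 2 - B.normI u ^ 2) := by
  have e1 : grad (u + s • w) = grad u + s • grad w := by
    rw [grad_eq, map_add, map_smul]
    rfl
  have e2 : fnOf (u + s • w) = fnOf u + s • fnOf w := by
    rw [fnOf_eq, map_add, map_smul]
    rfl
  have e3 : pairing P.g (u + s • w) = pairing P.g u + s * pairing P.g w := by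
    rw [← pairingL_apply, map_add, map_smul]
    rfl
  have e4 : ‖s • grad w‖ ^ 2 = s ^ 2 * ‖grad w‖ ^ 2 := by
    rw [norm_smul, mul_pow, Real.norm_eq_abs, sq_abs]
  rw [primalReal, primalReal, variation_apply, e1, e2, e3, norm_add_sq_real, inner_add_right,
    inner_smul_right, inner_smul_right, e4]
  ring

/-- The variational inequality at a primal solution. -/
theorem neg_variation_le {u : H1 B.Ω} (hu : P.IsPrimalSolution u) {τu : Lp ℝ 2 (surf B.Ω)}
    (hτu : IsTrace B.Ω u τu) {w : H1 B.Ω} (hw : w ∈ H1Zero B.Ω B.ΓD) {τ : Lp ℝ 2 (surf B.Ω)}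
    (hτ : IsTrace B.Ω w τ) {t : ℝ} (ht : 0 < t) :
    -P.variation u w ≤ B.seminormI τu / P.m *
      ((B.seminormI (τu + t • τ) - B.seminormI τu) / t) := by
  have hm := P.m_pos
  have huD := P.mem_K_iff.1 hu.1
  obtain ⟨Q, hQ⟩ : ∃ Q, Q = (B.seminormI (τu + t • τ) - B.seminormI τu) / t := ⟨_, rfl⟩
  rw [← hQ]
  -- Compare `u` with `u + s w` for `0 < s ≤ t` and divide by `s`. `K` collects the second-order
  -- terms, which disappear as `s → 0` while `t` stays fixed.
  refine le_of_forall_small (K := 1 / 2 * ‖grad w‖ ^ 2 + 1 / (2 * P.m) * Q ^ 2) ht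
    fun s hs hst => ?_
  have htr : IsTrace B.Ω (u + s • w) (τu + s • τ) :=
    hτu.add (hτ.smul s)
  have hD : TraceEqOn (u + s • w) B.ΓD P.uD :=
    P.traceEqOn_add huD ((H1Zero B.Ω B.ΓD).smul_mem s hw)
  have hmin := hu.2 (u + s • w)
  rw [P.primal_eq huD, P.primal_eq hD, EReal.coe_le_coe_iff,
    primalReal_add_smul, Body.normI_eq hτu, Body.normI_eq htr] at hmin
  have hconv := seminorm_add_smul_le B.seminormI τu τ hs hst
  rw [← hQ] at hconv
  have hsq := mul_le_mul_of_nonneg_left (pow_le_pow_left₀ (apply_nonneg B.seminormI _) hconv 2)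
    (by positivity : 0 ≤ 1 / (2 * P.m))
  generalize B.seminormI (τu + s • τ) = q at hmin hsq
  generalize B.seminormI τu = r at hmin hsq ⊢
  have e : 1 / (2 * P.m) * (r + s * Q) ^ 2 = 1 / (2 * P.m) * r ^ 2 +
      s * (r / P.m * Q + s * (1 / (2 * P.m) * Q ^ 2)) := by
    field_simp
    ring
  have hfin : 0 ≤ s * (P.variation u w + r / P.m * Q +
      s * (1 / 2 * ‖grad w‖ ^ 2 + 1 / (2 * P.m) * Q ^ 2)) := by
    linarith
  have := nonneg_of_mul_nonneg_right hfin hs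
  linarith

/-- The boundary multiplier at a primal solution. -/
theorem exists_multiplier {u : H1 B.Ω} (hu : P.IsPrimalSolution u) {τu : Lp ℝ 2 (surf B.Ω)}
    (hτu : IsTrace B.Ω u τu) :
    ∃ η : B.LInfI, ‖η‖ ≤ B.normI u / P.m ∧ B.innerI η u = -(B.normI u ^ 2 / P.m) ∧
      ∀ w ∈ H1Zero B.Ω B.ΓD, B.innerI η w = P.variation u w := by
  have hm := P.m_pos
  let X := H1 B.Ω × Lp ℝ 2 (surf B.Ω)
  let p : Seminorm ℝ X := B.seminormI.comp (LinearMap.snd ℝ (H1 B.Ω) (Lp ℝ 2 (surf B.Ω)))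
  -- Working with pairs of a function and its trace avoids having to make the trace a linear map.
  let V : Submodule ℝ X := (smoothTraceGraph B.Ω).topologicalClosure ⊓
    (H1Zero B.Ω B.ΓD).comap (LinearMap.fst ℝ (H1 B.Ω) (Lp ℝ 2 (surf B.Ω)))
  let f : V →ₗ[ℝ] ℝ := (-(P.variation u).toLinearMap ∘ₗ
    LinearMap.fst ℝ (H1 B.Ω) (Lp ℝ 2 (surf B.Ω))) ∘ₗ V.subtype
  have hC : 0 ≤ B.seminormI τu / P.m := div_nonneg (apply_nonneg _ _) hm.le
  -- The seminorm sees only the boundary component, so the base point may be `(0, τu)` and the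
  -- extension vanishes on pairs `(w, 0)`.
  obtain ⟨g, hg1, hg2, hg3⟩ := exists_extension_subgradient p ((0, τu) : X) hC V f
    fun x t ht => P.neg_variation_le hu hτu x.2.2 x.2.1 ht
  have hp : ∀ x : X, p x = B.seminormI x.2 := fun x => rfl
  obtain ⟨η, hη1, hη2⟩ := Body.exists_LInf_of_le_seminormI
    (g ∘ₗ LinearMap.inr ℝ (H1 B.Ω) (Lp ℝ 2 (surf B.Ω))) hC (fun τ => hg2 (0, τ))
  have hη2' : ∀ τ, g (0, τ) = inner ℝ (Body.extendI η) τ := hη2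
  have hneg : ∀ {w : H1 B.Ω} {τ : Lp ℝ 2 (surf B.Ω)}, IsTrace B.Ω w τ →
      B.innerI (-η) w = -g (0, τ) := by
    intro w τ h
    rw [hη2', Body.innerI_eq _ h, Body.inner_extendI, Body.inner_extendI, ← integral_neg]
    refine integral_congr_ae ?_
    filter_upwards [Lp.coeFn_neg η] with x hx
    rw [hx, Pi.neg_apply, neg_mul]
  -- The sign is reversed because `g` extends the negative of the first variation.
  refine ⟨-η, ?_, ?_, fun w hw => ?_⟩
  · rw [norm_neg, Body.normI_eq hτu]
    exact hη1
  · rw [hneg hτu, hg3, hp, Body.normI_eq hτu]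
    ring
  · obtain ⟨τ, hτ, -⟩ := id hw
    have h0 : g (w, 0) = 0 := by
      have h1 := hg2 (w, 0)
      rw [hp, map_zero, mul_zero] at h1
      exact abs_nonpos_iff.1 h1
    have h1 : g (w, τ) = -P.variation u w := hg1 ⟨(w, τ), hτ, hw⟩
    have h2 : ((w, τ) : X) = (w, 0) + (0, τ) := by simp
    rw [h2, map_add, h0, zero_add] at h1
    rw [hneg hτ, h1, neg_neg]

lemma mem_H1Zero_of_isTest {φ : E d → ℝ} (h : IsTest B.Ω φ) {Γ : Set (E d)}
    (hΓ : MeasurableSet Γ) : ofSmooth B.Ω h.1 h.2.1 ∈ H1Zero B.Ω Γ := by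
  refine mem_H1Zero_of_isTrace hΓ (Body.isTrace_ofSmooth h.1 h.2.1) ?_
  filter_upwards [(h.1.continuous.memLp_of_hasCompactSupport (μ := surf B.Ω) (p := 2)
    h.2.1).coeFn_toLp, ae_restrict_mem (measurableSet_frontier' B.Ω)] with x e1 e2 _
  rw [e1]
  refine image_eq_zero_of_notMem_tsupport fun hx => ?_
  rw [B.isOpen.frontier_eq] at e2
  exact e2.2 (h.2.2 hx)

/-- Test functions have zero trace on all parts, so the Neumann pairing drops out and the
stationarity condition is the weak form of `-div ∇u = f`. -/
lemma isWeakDiv_grad {u : H1 B.Ω}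
    (h : ∀ w ∈ H1Zero B.Ω B.ΓD, w ∈ H1Zero B.Ω B.ΓI → P.variation u w = 0) :
    IsWeakDiv B.Ω (grad u) (-P.f) := by
  intro φ hφ
  have h1 := h _ (mem_H1Zero_of_isTest hφ B.measurableSet_D)
    (mem_H1Zero_of_isTest hφ B.measurableSet_I)
  rw [variation_apply, pairing_eq_zero _ (mem_H1Zero_of_isTest hφ B.measurableSet_N)] at h1
  have e1 : inner ℝ (grad u) (grad (ofSmooth B.Ω hφ.1 hφ.2.1)) =
      ∫ x in B.Ω, inner ℝ (grad u x) (gradient φ x) := by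
    rw [L2.inner_def]
    refine integral_congr_ae ?_
    filter_upwards [grad_ofSmooth B.Ω hφ.1 hφ.2.1] with x hx
    rw [hx]
  have e2 : inner ℝ P.f (fnOf (ofSmooth B.Ω hφ.1 hφ.2.1)) =
      - ∫ x in B.Ω, (-P.f) x * φ x := by
    rw [L2.inner_def, ← integral_neg]
    refine integral_congr_ae ?_
    filter_upwards [fnOf_ofSmooth B.Ω hφ.1 hφ.2.1, Lp.coeFn_neg P.f] with x hx hx'
    rw [hx, hx']
    simp [mul_comm]
  rw [← e1, ← e2]
  linarith

/-- Strong duality: the gradient of a primal solution is an admissible dual field without duality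
gap. -/
theorem exists_dualReal_ge {u : H1 B.Ω} (hu : P.IsPrimalSolution u) :
    ∃ y : B.HDivI, P.DualAdmissible y ∧ P.primalReal u ≤ P.dualReal y := by
  have hm := P.m_pos
  have huD := P.mem_K_iff.1 hu.1
  obtain ⟨τu, hτu, -⟩ := id huD
  obtain ⟨η, hη1, hη2, hη3⟩ := P.exists_multiplier hu hτu
  have hvar0 : ∀ w ∈ H1Zero B.Ω B.ΓD, w ∈ H1Zero B.Ω B.ΓI → P.variation u w = 0 :=
    fun w hD hI => by rw [← hη3 w hD, Body.innerI_eq_zero η hI]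
  let y : HDiv B.Ω := ⟨grad u, -P.f, P.isWeakDiv_grad hvar0⟩
  have hpair : ∀ w, y.normalPairing w = P.variation u w + pairing P.g w := by
    intro w
    have : y.normalPairing w = inner ℝ (grad w) (grad u) + inner ℝ (fnOf w) (-P.f) := rfl
    rw [this, variation_apply, inner_neg_right, real_inner_comm, real_inner_comm P.f]
    ring
  have hext : B.IsNormalExtension y η := by
    intro w hD hN
    rw [hpair, hη3 w hD, pairing_eq_zero _ hN, add_zero]
  let yI : B.HDivI := ⟨y, η, hext⟩
  have hadm : P.DualAdmissible yI := by
    refine ⟨rfl, fun w hI hD => ?_⟩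
    change y.normalPairing w = _
    rw [hpair, hvar0 w hD hI, zero_add]
  -- `normalTrace` is selected by choice; uniqueness identifies it with the multiplier.
  have htr : yI.normalTrace = η := Body.IsNormalExtension.unique yI.2.choose_spec hext
  refine ⟨yI, hadm, ?_⟩
  have hgap := P.primalReal_sub_dualReal huD hadm
  have hz : grad u - yI.1.field = 0 := sub_self _
  rw [hz, htr, norm_zero, boundaryGap, hη2] at hgap
  have hsq : ‖η‖ ^ 2 ≤ (B.normI u / P.m) ^ 2 := pow_le_pow_left₀ (norm_nonneg _) hη1 2
  have h1 := mul_le_mul_of_nonneg_left hsq (by positivity : 0 ≤ P.m / 2)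
  -- The two squares contribute at most `‖u‖_1²/(2m)` each and cancel against `(η, u)`, so the gap
  -- at `(u, ∇u)` is at most zero.
  have h2 : P.m / 2 * (B.normI u / P.m) ^ 2 + -(B.normI u ^ 2 / P.m) +
      1 / (2 * P.m) * B.normI u ^ 2 = 0 := by
    field_simp
    ring
  linarith

end Data

end Insulation

end

/-! ### The error identity and its representations -/

open Insulation in
theorem theorem4p4 {d : ℕ} (B : Insulation.Body d) (P : Insulation.Data B)
    (u : Insulation.H1 B.Ω) (hu : P.IsPrimalSolution u)
    (z : B.HDivI) (hz : P.IsDualSolution z)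
    (v : Insulation.H1 B.Ω) (hv : v ∈ P.K) (y : B.HDivI) (hy : y ∈ P.KStar) :
    P.rhoTotSq u z v y = P.gapSq v y ∧
    P.gapSq v y =
      ((1 / 2 * ‖Insulation.grad v - y.1.field‖ ^ 2 + P.boundaryGap y.normalTrace v : ℝ) : EReal) ∧
    P.rhoPrimalSq u v =
      ((1 / 2 * ‖Insulation.grad v - Insulation.grad u‖ ^ 2 + P.boundaryGap z.normalTrace v : ℝ) : EReal) ∧
    P.rhoDualSq z y =
      ((1 / 2 * ‖y.1.field - z.1.field‖ ^ 2 + P.boundaryGap y.normalTrace u : ℝ) : EReal) := by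
  have hv' := P.mem_K_iff.1 hv
  have hu' := P.mem_K_iff.1 hu.1
  have hy' := P.mem_KStar_iff.1 hy
  have hz' := P.mem_KStar_iff.1 hz.1
  obtain ⟨τu, hτu, -⟩ := id hu'
  obtain ⟨y₀, hy₀, hle⟩ := P.exists_dualReal_ge hu
  -- Together with `hle` this gives `I(u) ≤ D(y₀) ≤ D(z)`.
  have hmax := hz.2 y₀
  rw [P.dual_eq hy₀, P.dual_eq hz', EReal.coe_le_coe_iff] at hmax
  have gvy := P.primalReal_sub_dualReal hv' hy'
  have gvz := P.primalReal_sub_dualReal hv' hz'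
  have guy := P.primalReal_sub_dualReal hu' hy'
  have guz := P.primalReal_sub_dualReal hu' hz'
  have hb := P.boundaryGap_nonneg z.normalTrace hτu
  -- The gap at `(u, z)` is nonpositive and a sum of two nonnegative terms, so both vanish.
  have hsq : ‖grad u - z.1.field‖ ^ 2 = 0 := le_antisymm (by linarith) (sq_nonneg _)
  have hgrad : grad u = z.1.field := by
    rw [← sub_eq_zero, ← norm_eq_zero]
    exact pow_eq_zero_iff (two_ne_zero) |>.1 hsq
  have hstrong : P.primalReal u = P.dualReal z := by
    rw [hsq] at guz
    linarith
  unfold Data.rhoTotSq Data.gapSq Data.rhoPrimalSq Data.rhoDualSq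
  rw [P.primal_eq hv', P.primal_eq hu', P.dual_eq hy', P.dual_eq hz']
  norm_cast
  -- Strong duality replaces `I(u)` by `D(z)` or conversely, so the two distances become the gaps at
  -- `(v, z)` and `(u, y)`.
  refine ⟨?_, ?_, ?_, ?_⟩
  · rw [hstrong]; ring
  · exact gvy
  · rw [hgrad, hstrong]; exact gvz
  · rw [← hstrong, ← hgrad, norm_sub_rev]
    linarith
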